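/- For integers $m,n$ let $A_{m,n}=\begin{pmatrix}0&1&0\\0&0&1\\1&-m&-n\end{pmatrix}\in SL(3,\mathbb Z)$, acting on column vectors in $\mathbb R^3$. For an operator $M\in SL(3,\mathbb Z)$ with characteristic polynomial irreducible over $\mathbb Q$ and three distinct real eigenvalues, the three planes spanned by pairs of linearly independent eigenvectors cut $\mathbb R^3$ into open orthants. The sail of an orthant is the boundary of the convex hull of all nonzero integer points in the closure of the orthant; its faces (vertices, edges, polygons) are the nonempty proper intersections of this convex hull with its supporting planes. Let $\Gamma$ be the group of operators in $SL(3,\mathbb Z)$ that commute with $M$ and map the sail onto itself. The torus triangulation is the factor of the sail by $\Gamma$, together with its decomposition into the images of the faces. **Proposition 3.4.** Let $a\ge 0$ be an integer, $m=a-1$, $n=3+2a$, $M=A_{m,n}$. Then the characteristic polynomial of $M$ is irreducible over $\mathbb Q$ and $M$ has three distinct real eigenvalues. Consider the orthant containing $(0,0,1)$, its sail, and $\Gamma$. The point $(0,0,1)$ lies on the sail, and the following holds. 1. The operators $X=(2I+M^{-1})^{-2}$ and $Y=M^{-2}$ commute and freely generate $\Gamma\cong\mathbb Z^2$. 2. The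 points $$A=(1,-2a-3,4a^2+11a+10),\quad B=(0,0,1),\quad C=(-4a-11,2a+5,-a-2),\quad D=(-a-2,0,a^2+3a+3),$$ $$E=(-2,1,0),\quad F=(-2a-3,a+1,1),\quad G=(0,-1-a,2a^2+5a+4)$$ are vertices of the sail, and $X(A)=D$, $X(B)=C$, $Y(A)=B$, $Y(G)=E$, $Y(D)=C$ (so $X$ maps the segment $AB$ to $DC$ and $Y$ maps the broken line $AGD$ to $BEC$). 3. The vertices $B,E,F$, the edges $AB,AG,GD,BG,DF,EF,CF$ and the polygons $ABG$, $BEFDG$ (a pentagon), $EFC$, $CDF$ are faces of the sail, whose vertices are exactly the listed ones. Every face of the sail is the image of exactly one of these fourteen faces under exactly one element of $\Gamma$; thus they form a fundamental region. 4. Each of the open segments $BG$ and $DF$ contains exactly $a$ integer points. The integer points in the (relative) interior of the pentagon $BEFDG$ are exactly the $(a+1)^2$ points $(-j,\,-i+j,\,(2a+3)i-(a+2)j+1)$ with integers $1\le i\le a+1$, $1\le j\le 2i-1$. 5. The torus triangulation is homeomorphic to the following decomposition of $\mathbb R^2/\mathbb Z^2$. Put $A'=(0,0)$, $B'=(0,1)$,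 $C'=(1,1)$, $D'=(1,0)$, $E'=(\tfrac14,\tfrac54)$, $F'=(\tfrac34,\tfrac34)$, $G'=(\tfrac14,\tfrac14)$, and take the images in $\mathbb R^2/\mathbb Z^2$ of the points, segments and convex polygons spanned by the primed points corresponding to the fourteen faces of part 3. That is, there is a homeomorphism from the factor of the sail by $\Gamma$ onto $\mathbb R^2/\mathbb Z^2$ that maps the image of each of the fourteen faces onto the image of the corresponding plane cell, and hence the set of images of all faces of the sail onto the set of these cells. -/

import Mathlib

open Matrix

namespace SailTorus

/-! ### Integer operators acting on real three-space -/

/-- Operators of `SL(3, ℤ)`. -/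
abbrev SL3 : Type := Matrix.SpecialLinearGroup (Fin 3) ℤ

/-- Real three-space, with its product topology. -/
abbrev Space : Type := Fin 3 → ℝ

/-- The Frobenius operator with parameters `m`, `n`. -/
def frobeniusOperator (m n : ℤ) : SL3 :=
  ⟨!![0, 1, 0; 0, 0, 1; 1, -m, -n], by simp [Matrix.det_fin_three]⟩

/-- The real matrix of an integer operator. -/
def realMatrix (g : SL3) : Matrix (Fin 3) (Fin 3) ℝ := g.1.map (fun k : ℤ => (k : ℝ))

/-- An integer operator acts on column vectors. -/
def act (g : SL3) (x : Space) : Space := realMatrix g *ᵥ x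

theorem act_one (x : Space) : act 1 x = x := by
  have h : realMatrix 1 = 1 := by
    ext i j
    simp [realMatrix, Matrix.one_apply]
  simp [act, h]

theorem act_mul (g h : SL3) (x : Space) : act (g * h) x = act g (act h x) := by
  have e : realMatrix (g * h) = realMatrix g * realMatrix h := by
    ext i j
    simp [realMatrix, Matrix.mul_apply]
  simp [act, e, Matrix.mulVec_mulVec]

theorem act_inv_act (g : SL3) (x : Space) : act g⁻¹ (act g x) = x := by
  rw [← act_mul, inv_mul_cancel, act_one]

/-- Points all of whose coordinates are integers. -/
def IsIntegerPoint (x : Space) : Prop := ∀ i, ∃ k : ℤ, x i = k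

/-! ### Orthants, sails and their faces -/

/-- The real eigenvalues of an operator. -/
def realEigenvalues (M : SL3) : Set ℝ :=
  {r | Module.End.HasEigenvalue (Matrix.toLin' (realMatrix M)) r}

/-- The planes spanned by two linearly independent eigenvectors of `M`. -/
def eigenplanes (M : SL3) : Set (Submodule ℝ Space) :=
  {P | ∃ (u v : Space) (r s : ℝ),
    Module.End.HasEigenvector (Matrix.toLin' (realMatrix M)) r u ∧
    Module.End.HasEigenvector (Matrix.toLin' (realMatrix M)) s v ∧
    LinearIndependent ℝ ![u, v] ∧ P = Submodule.span ℝ {u, v}}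

/-- The open orthant containing `p`: the connected component of `p` in the complement of the
eigenplanes of `M`. -/
def orthant (M : SL3) (p : Space) : Set Space :=
  connectedComponentIn {x | ∀ P ∈ eigenplanes M, x ∉ P} p

/-- The convex hull of all integer points, except the origin, in the closed orthant. -/
def hull (M : SL3) (p : Space) : Set Space :=
  convexHull ℝ {x | x ∈ closure (orthant M p) ∧ x ≠ 0 ∧ IsIntegerPoint x}

/-- The sail of `M` in the orthant containing `p`. -/
def sail (M : SL3) (p : Space) : Set Space := frontier (hull M p)

/-- The faces (vertices, edges and polygons) of the sail: the nonempty proper intersections of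
the hull with its supporting planes. -/
def sailFaces (M : SL3) (p : Space) : Set (Set Space) :=
  {F | F.Nonempty ∧ F ≠ hull M p ∧ IsExposed ℝ (hull M p) F}

/-- The dimension of the affine span of a (nonempty) set. -/
noncomputable def faceDim (F : Set Space) : ℕ := Module.finrank ℝ (vectorSpan ℝ F)

/-! ### The period group and the torus decomposition -/

/-- The operators of `SL(3, ℤ)` which commute with `M` and map the sail onto itself. -/
def periodGroup (M : SL3) (p : Space) : Subgroup SL3 where
  carrier := {g | g * M = M * g ∧ act g '' sail M p = sail M p}
  one_mem' := by
    refine ⟨by simp, ?_⟩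
    have : act 1 = id := funext act_one
    rw [this, Set.image_id]
  mul_mem' := by
    rintro g h ⟨hg, hg'⟩ ⟨hh, hh'⟩
    refine ⟨by rw [mul_assoc, hh, ← mul_assoc, hg, mul_assoc], ?_⟩
    have : act (g * h) = act g ∘ act h := funext (act_mul g h)
    rw [this, Set.image_comp, hh', hg']
  inv_mem' := by
    rintro g ⟨hg, hg'⟩
    refine ⟨?_, ?_⟩
    · have hc : Commute g M := hg
      exact hc.inv_left
    · conv_lhs => rw [← hg']
      rw [Set.image_image]
      simp [act_inv_act]

/-- Two points of the sail are equivalent if an element of the period group maps one to the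
other. -/
def orbitSetoid (M : SL3) (p : Space) : Setoid (sail M p) where
  r x y := ∃ g ∈ periodGroup M p, act g x = y
  iseqv :=
    { refl := fun x => ⟨1, Subgroup.one_mem _, act_one x⟩
      symm := by
        rintro x y ⟨g, hg, h⟩
        exact ⟨g⁻¹, Subgroup.inv_mem _ hg, by rw [← h, act_inv_act]⟩
      trans := by
        rintro x y z ⟨g, hg, h⟩ ⟨k, hk, h'⟩
        exact ⟨k * g, Subgroup.mul_mem _ hk hg, by rw [act_mul, h, h']⟩ }

/-- The factor of the sail by its period group, with the quotient topology. -/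
abbrev SailQuotient (M : SL3) (p : Space) : Type := Quotient (orbitSetoid M p)

/-- The image in the factor of a part `F` of the sail. -/
def quotientImage (M : SL3) (p : Space) (F : Set Space) : Set (SailQuotient M p) :=
  (fun x : sail M p => (Quotient.mk (orbitSetoid M p) x : SailQuotient M p)) '' {x | x.1 ∈ F}

/-- The torus triangulation: the images of all (closed) faces in the factor of the sail. -/
def torusTriangulation (M : SL3) (p : Space) : Set (Set (SailQuotient M p)) :=
  quotientImage M p '' sailFaces M p

/-! ### The explicit fundamental region -/

/-- Names of the vertices in the closure of the fundamental region. -/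
inductive Label : Type
  | A | B | C | D | E | F | G

/-- The integer coordinates of the seven named points. -/
def coords (a : ℕ) : Label → Fin 3 → ℤ
  | .A => ![1, -2 * a - 3, 4 * a ^ 2 + 11 * a + 10]
  | .B => ![0, 0, 1]
  | .C => ![-4 * a - 11, 2 * a + 5, -a - 2]
  | .D => ![-a - 2, 0, a ^ 2 + 3 * a + 3]
  | .E => ![-2, 1, 0]
  | .F => ![-2 * a - 3, a + 1, 1]
  | .G => ![0, -1 - a, 2 * a ^ 2 + 5 * a + 4]

/-- The seven named points, in real three-space. -/
def pt (a : ℕ) (l : Label) : Space := fun i => (coords a l i : ℝ)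

/-- Representatives of the vertices. -/
def vertexCells : Set (Set Label) := {{.B}, {.E}, {.F}}

/-- Representatives of the edges. -/
def edgeCells : Set (Set Label) :=
  {{.A, .B}, {.A, .G}, {.G, .D}, {.B, .G}, {.D, .F}, {.E, .F}, {.C, .F}}

/-- The vertices of the pentagon. -/
def pentagon : Set Label := {.B, .E, .F, .D, .G}

/-- Representatives of the polygons. -/
def polygonCells : Set (Set Label) :=
  {{.A, .B, .G}, pentagon, {.E, .F, .C}, {.C, .D, .F}}

/-- All cells of the fundamental region, each given by the set of its vertices. -/
def cells : Set (Set Label) := vertexCells ∪ edgeCells ∪ polygonCells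

/-- The convex polygon (or segment, or point) with the given vertices. -/
def cell (a : ℕ) (c : Set Label) : Set Space := convexHull ℝ (pt a '' c)

/-! ### The model decomposition of the torus -/

/-- The two-dimensional torus `ℝ²/ℤ²`. -/
abbrev Torus : Type := AddCircle (1 : ℝ) × AddCircle (1 : ℝ)

/-- Seven points in the plane. The hexagon `A B E C D G` is a fundamental domain of `ℤ²`: the
translation by `(1, 0)` maps the side `AB` to `DC`, and the translation by `(0, 1)` maps the broken
line `AGD` to `BEC`. The pentagon `B E F D G` and the triangles `A B G`, `E F C`, `C D F`
subdivide the hexagon. -/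
noncomputable def modelPt : Label → ℝ × ℝ
  | .A => (0, 0)
  | .B => (0, 1)
  | .C => (1, 1)
  | .D => (1, 0)
  | .E => (1 / 4, 5 / 4)
  | .F => (3 / 4, 3 / 4)
  | .G => (1 / 4, 1 / 4)

/-- The image in the torus of the plane cell with the given vertices. -/
def modelCell (c : Set Label) : Set Torus :=
  (fun x : ℝ × ℝ => ((x.1 : AddCircle (1 : ℝ)), (x.2 : AddCircle (1 : ℝ)))) ''
    convexHull ℝ (modelPt '' c)

end SailTorus

open SailTorus

namespace SailTorus

/-! ### Linear forms and the linear action -/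

/-! Let t₀ < t₁ < t₂ be the roots of the characteristic polynomial of M⁻¹. The left eigenvectors of
M, normalised to take the value 1 at B, are coordinates in which every operator commuting with M is
diagonal, and the orthant is the open octant where all three are positive.

The hull is found by guessing its facets and certifying the guess. Each of the four polygons lies in
a plane `tileForm = 1`, and its translates under X^i Y^j give the family `faceForm`. All these forms
are positive combinations of the eigenforms (`tileForm_eq`), so at a given point of the cone only
finitely many stay below a given bound and the smallest one is attained (`exists_faceForm_min`). If
the form of some polygon is the smallest at a point, comparison with the neighbours across its sides
places the point in the cone over that polygon (`exists_weight_of_le`). No nonzero integer point of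
that cone lies strictly below the polygon (`one_le_sum_weight`). Hence the hull is exactly the set
where all the forms are at least 1 (`convexHull_eq_polyhedron`), and the sail is the part where some
form equals 1.

A face of the sail lies in a single translated polygon, where it is spanned by the vertices at which
a supporting functional is extremal. The possible vertex sets form a finite list, so existence and
uniqueness of the representing cell reduce to decidable statements about labels
(`exists_cell_of_face`, `cell_unique`).

An element g of the period group sends B to a vertex of the sail. Being unimodular, g can only send
it to a vertex of norm 1, and the orbits of B, E, F have the distinct norms 1, a + 2, (a + 2)². So g
B = X^i Y^j B, and g = X^i Y^j because a commuting operator is determined by the image of B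
(`mem_periodGroup_iff`).

For the homeomorphism, both the factor of the sail and the torus are Hausdorff images of one compact
space, the barycentric weights on the six triangles of the triangulated fundamental region. The two
maps have the same fibres, because both identify weights exactly when a period carries one to the
other (`weightsToSail_eq_iff`). -/

theorem act_apply (g : SL3) (x : Space) (i : Fin 3) :
    act g x i = (g.1 i 0 : ℝ) * x 0 + (g.1 i 1 : ℝ) * x 1 + (g.1 i 2 : ℝ) * x 2 := by
  simp [act, realMatrix, Matrix.mulVec, dotProduct, Fin.sum_univ_three]

/-- The action of an integer operator, as a continuous linear map. -/
noncomputable def actL (g : SL3) : Space →L[ℝ] Space :=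
  LinearMap.toContinuousLinearMap (Matrix.toLin' (realMatrix g))

theorem actL_apply (g : SL3) (x : Space) : actL g x = act g x := by
  simp [actL, act]

theorem act_sum {ι : Type*} (s : Finset ι) (g : SL3) (w : ι → ℝ) (f : ι → Space) :
    act g (∑ l ∈ s, w l • f l) = ∑ l ∈ s, w l • act g (f l) := by
  simp [← actL_apply]

theorem continuous_act (g : SL3) : Continuous (act g) := by
  have : act g = actL g := funext fun x => (actL_apply g x).symm
  rw [this]
  exact (actL g).continuous

theorem act_act_inv (g : SL3) (x : Space) : act g (act g⁻¹ x) = x := by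
  rw [← act_mul, mul_inv_cancel, act_one]

theorem act_injective (g : SL3) : Function.Injective (act g) :=
  Function.LeftInverse.injective (act_inv_act g)

theorem eq_of_act_eq {g h : SL3} (H : ∀ x, act g x = act h x) : g = h := by
  apply Subtype.ext
  ext i j
  have := congrFun (H (Pi.single j 1)) i
  simpa [act, realMatrix, Matrix.mulVec_single] using this

/-- The linear form with the given coefficients. -/
noncomputable def lin (p q r : ℝ) : Space →L[ℝ] ℝ :=
  LinearMap.toContinuousLinearMap
    { toFun := fun x => p * x 0 + q * x 1 + r * x 2
      map_add' := fun x y => by simp; ring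
      map_smul' := fun c x => by simp; ring }

theorem lin_apply (p q r : ℝ) (x : Space) : lin p q r x = p * x 0 + q * x 1 + r * x 2 := rfl

theorem eq_lin (f : Space →L[ℝ] ℝ) :
    f = lin (f ![1, 0, 0]) (f ![0, 1, 0]) (f ![0, 0, 1]) := by
  ext x
  have hx : x = x 0 • ![1, 0, 0] + x 1 • ![0, 1, 0] + x 2 • ![0, 0, 1] := by
    ext i; fin_cases i <;> simp
  conv_lhs => rw [hx]
  simp only [map_add, map_smul, lin_apply, smul_eq_mul]
  ring

/-- The point with integer coordinates `z`. -/
def intPt (z : Fin 3 → ℤ) : Space := fun i => (z i : ℝ)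

theorem isIntegerPoint_iff (x : Space) : IsIntegerPoint x ↔ ∃ z, x = intPt z :=
  ⟨fun h => ⟨fun i => (h i).choose, funext fun i => (h i).choose_spec⟩,
    fun ⟨z, hz⟩ i => ⟨z i, congrFun hz i⟩⟩

theorem intPt_injective : Function.Injective intPt := fun z w h =>
  funext fun i => by simpa [intPt] using congrFun h i

theorem act_intPt (g : SL3) (z : Fin 3 → ℤ) : act g (intPt z) = intPt (g.1 *ᵥ z) := by
  ext i
  simp [act_apply, intPt, Matrix.mulVec, dotProduct, Fin.sum_univ_three]

theorem pt_eq_intPt (a : ℕ) (l : Label) : pt a l = intPt (coords a l) := rfl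

theorem IsIntegerPoint.act {x : Space} (h : IsIntegerPoint x) (g : SL3) :
    IsIntegerPoint (act g x) := by
  obtain ⟨z, rfl⟩ := (isIntegerPoint_iff x).1 h
  rw [act_intPt]
  exact (isIntegerPoint_iff _).2 ⟨_, rfl⟩

/-! ### Labels -/

instance : DecidableEq Label := fun x y => by
  cases x <;> cases y <;> first | exact isTrue rfl | exact isFalse (by intro h; cases h)

instance : Fintype Label := ⟨{.A, .B, .C, .D, .E, .F, .G}, fun x => by cases x <;> decide⟩

theorem sum_label {V : Type*} [AddCommMonoid V] (f : Label → V) :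
    ∑ l, f l = f .A + f .B + f .C + f .D + f .E + f .F + f .G := by
  have : (Finset.univ : Finset Label) = {.A, .B, .C, .D, .E, .F, .G} := rfl
  rw [this]
  repeat rw [Finset.sum_insert (by decide)]
  rw [Finset.sum_singleton]
  simp only [add_assoc]

/-- Coordinates of a weighted sum of the named points. -/
theorem sum_pt_apply (a : ℕ) (w : Label → ℝ) (i : Fin 3) :
    (∑ l, w l • pt a l) i = ∑ l, w l * pt a l i := by
  simp

/-! ### The operators -/

theorem sl_mul_apply (g h : SL3) (i j : Fin 3) :
    (g * h).1 i j = g.1 i 0 * h.1 0 j + g.1 i 1 * h.1 1 j + g.1 i 2 * h.1 2 j := by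
  rw [Matrix.SpecialLinearGroup.coe_mul, Matrix.mul_apply, Fin.sum_univ_three]

theorem sl_one_apply (i j : Fin 3) : (1 : SL3).1 i j = if i = j then 1 else 0 := by
  rw [Matrix.SpecialLinearGroup.coe_one, Matrix.one_apply]

theorem sl_ext {g h : SL3} (H : ∀ i j, g.1 i j = h.1 i j) : g = h :=
  Subtype.ext (Matrix.ext H)

/-- The operator `M`. -/
def opM (a : ℕ) : SL3 := frobeniusOperator ((a : ℤ) - 1) (3 + 2 * (a : ℤ))

/-- The inverse of `M`. -/
def opN (a : ℕ) : SL3 :=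
  ⟨!![(a : ℤ) - 1, 3 + 2 * a, 1; 1, 0, 0; 0, 1, 0], by simp [Matrix.det_fin_three]⟩

/-- The first generator of the period group. -/
def opX (a : ℕ) : SL3 :=
  ⟨!![8 * (a : ℤ) + 24, -8 * a ^ 2 - 32 * a - 28, -4 * a - 11;
      -4 * a - 11, 4 * a ^ 2 + 15 * a + 13, 2 * a + 5;
      2 * a + 5, -2 * a ^ 2 - 7 * a - 6, -a - 2], by
    rw [Matrix.det_fin_three]; simp; try ring⟩

/-- The inverse of the first generator. -/
def opXinv (a : ℕ) : SL3 :=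
  ⟨!![(a : ℤ) ^ 2 + 4 * a + 4, 2 * a ^ 2 + 9 * a + 10, a + 3;
      a + 3, 2 * a + 7, 1;
      1, 4, 4], by
    rw [Matrix.det_fin_three]; simp; try ring⟩

/-- The second generator of the period group. -/
def opY (a : ℕ) : SL3 :=
  ⟨!![(a : ℤ) ^ 2 + 4, 2 * a ^ 2 + a - 2, a - 1;
      a - 1, 2 * a + 3, 1;
      1, 0, 0], by
    rw [Matrix.det_fin_three]; simp; try ring⟩

/-- The inverse of the second generator. -/
def opYinv (a : ℕ) : SL3 :=
  ⟨!![0, 0, 1;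
      1, -(a : ℤ) + 1, -2 * a - 3;
      -2 * a - 3, 2 * a ^ 2 + a - 2, 4 * a ^ 2 + 11 * a + 10], by
    rw [Matrix.det_fin_three]; simp; try ring⟩

theorem opM_inv (a : ℕ) : (opM a)⁻¹ = opN a := by
  rw [inv_eq_iff_mul_eq_one]
  refine sl_ext fun i j => ?_
  rw [sl_mul_apply, sl_one_apply]
  fin_cases i <;> fin_cases j <;> simp [opM, opN, frobeniusOperator]

theorem opX_inv (a : ℕ) : (opX a)⁻¹ = opXinv a := by
  rw [inv_eq_iff_mul_eq_one]
  refine sl_ext fun i j => ?_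
  rw [sl_mul_apply, sl_one_apply]
  fin_cases i <;> fin_cases j <;> simp [opX, opXinv] <;> try ring

theorem opY_inv (a : ℕ) : (opY a)⁻¹ = opYinv a := by
  rw [inv_eq_iff_mul_eq_one]
  refine sl_ext fun i j => ?_
  rw [sl_mul_apply, sl_one_apply]
  fin_cases i <;> fin_cases j <;> simp [opY, opYinv] <;> try ring

theorem opY_eq (a : ℕ) : opY a = (opM a) ^ (-2 : ℤ) := by
  have : (opM a) ^ (-2 : ℤ) = (opM a)⁻¹ * (opM a)⁻¹ := by
    rw [show (-2 : ℤ) = -1 + -1 by norm_num, _root_.zpow_add, _root_.zpow_neg_one]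
  rw [this, opM_inv]
  refine sl_ext fun i j => ?_
  rw [sl_mul_apply]
  fin_cases i <;> fin_cases j <;> simp [opY, opN] <;> try ring

/-- The matrix 2I + M⁻¹ has determinant -1, so the identity lives among matrices and not in SL(3,
ℤ). The negative power is identified by multiplying the square of 2I + M⁻¹ by the explicit matrix.
-/
theorem opX_eq (a : ℕ) : (opX a : Matrix (Fin 3) (Fin 3) ℤ) =
    (2 • (1 : Matrix (Fin 3) (Fin 3) ℤ) + (((opM a)⁻¹ : SL3) : Matrix (Fin 3) (Fin 3) ℤ)) ^
      (-2 : ℤ) := by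
  rw [show (-2 : ℤ) = -((2 : ℕ) : ℤ) by norm_num, Matrix.zpow_neg_natCast, opM_inv]
  symm
  apply Matrix.inv_eq_left_inv
  have h2 : 2 • (1 : Matrix (Fin 3) (Fin 3) ℤ) + (opN a : Matrix (Fin 3) (Fin 3) ℤ) =
      !![(a : ℤ) + 1, 3 + 2 * a, 1; 1, 2, 0; 0, 1, 2] := by
    rw [two_smul]
    ext i j
    fin_cases i <;> fin_cases j <;> simp [opN] <;> try ring
  rw [h2, pow_two, opX]
  ext i j
  rw [Matrix.mul_apply, Fin.sum_univ_three]
  simp only [Matrix.mul_apply, Fin.sum_univ_three]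
  fin_cases i <;> fin_cases j <;> simp <;> ring

theorem commute_opX_opY (a : ℕ) : Commute (opX a) (opY a) := by
  refine sl_ext fun i j => ?_
  rw [sl_mul_apply, sl_mul_apply]
  fin_cases i <;> fin_cases j <;> simp [opX, opY] <;> try ring

theorem commute_opX_opM (a : ℕ) : Commute (opX a) (opM a) := by
  refine sl_ext fun i j => ?_
  rw [sl_mul_apply, sl_mul_apply]
  fin_cases i <;> fin_cases j <;> simp [opX, opM, frobeniusOperator] <;> try ring

theorem commute_opY_opM (a : ℕ) : Commute (opY a) (opM a) := by
  rw [opY_eq]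
  exact (Commute.refl (opM a)).zpow_left _

/-- The operators `X ^ i * Y ^ j`. -/
def per (a : ℕ) (d : ℤ × ℤ) : SL3 := opX a ^ d.1 * opY a ^ d.2

theorem per_zero (a : ℕ) : per a 0 = 1 := by simp [per]

theorem per_add (a : ℕ) (d d' : ℤ × ℤ) : per a (d + d') = per a d * per a d' := by
  have h : Commute (opY a ^ d.2) (opX a ^ d'.1) :=
    ((commute_opX_opY a).symm.zpow_left _).zpow_right _
  simp only [per, Prod.fst_add, Prod.snd_add, _root_.zpow_add]
  rw [mul_assoc, mul_assoc, ← mul_assoc (opX a ^ d'.1), ← h.eq]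
  simp only [mul_assoc]

theorem per_neg (a : ℕ) (d : ℤ × ℤ) : per a (-d) = (per a d)⁻¹ := by
  rw [eq_inv_iff_mul_eq_one, ← per_add, neg_add_cancel, per_zero]

theorem commute_per_opM (a : ℕ) (d : ℤ × ℤ) : Commute (per a d) (opM a) :=
  ((commute_opX_opM a).zpow_left _).mul_left ((commute_opY_opM a).zpow_left _)

theorem closure_eq_range_per (a : ℕ) (g : SL3) :
    g ∈ Subgroup.closure {opX a, opY a} ↔ ∃ d, g = per a d := by
  constructor
  · intro h
    induction h using Subgroup.closure_induction with
    | mem x hx =>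
      rcases hx with rfl | hx
      · exact ⟨(1, 0), by simp [per]⟩
      · exact ⟨(0, 1), by simp only [Set.mem_singleton_iff] at hx; simp [per, hx]⟩
    | one => exact ⟨0, (per_zero a).symm⟩
    | mul x y _ _ hx hy =>
      obtain ⟨d, rfl⟩ := hx
      obtain ⟨d', rfl⟩ := hy
      exact ⟨d + d', (per_add a d d').symm⟩
    | inv x _ hx =>
      obtain ⟨d, rfl⟩ := hx
      exact ⟨-d, (per_neg a d).symm⟩
  · rintro ⟨d, rfl⟩
    exact mul_mem (zpow_mem (Subgroup.subset_closure (by simp)) _)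
      (zpow_mem (Subgroup.subset_closure (by simp)) _)

theorem act_per_add (a : ℕ) (d d' : ℤ × ℤ) (x : Space) :
    act (per a (d + d')) x = act (per a d) (act (per a d') x) := by
  rw [per_add, act_mul]

theorem act_per_zero (a : ℕ) (x : Space) : act (per a 0) x = x := by
  rw [per_zero, act_one]

theorem act_per_neg_act (a : ℕ) (d : ℤ × ℤ) (x : Space) :
    act (per a (-d)) (act (per a d) x) = x := by
  rw [← act_per_add, neg_add_cancel, act_per_zero]

theorem act_per_act_neg (a : ℕ) (d : ℤ × ℤ) (x : Space) :
    act (per a d) (act (per a (-d)) x) = x := by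
  rw [← act_per_add, add_neg_cancel, act_per_zero]

theorem per_X (a : ℕ) : per a (1, 0) = opX a := by simp [per]
theorem per_X_neg (a : ℕ) : per a (-1, 0) = opXinv a := by simp [per, ← opX_inv]
theorem per_Y (a : ℕ) : per a (0, 1) = opY a := by simp [per]
theorem per_Y_neg (a : ℕ) : per a (0, -1) = opYinv a := by simp [per, ← opY_inv]

theorem act_opX (a : ℕ) (x : Space) : act (opX a) x =
    ![(8 * a + 24) * x 0 + (-8 * a ^ 2 - 32 * a - 28) * x 1 + (-4 * a - 11) * x 2,
      (-4 * a - 11) * x 0 + (4 * a ^ 2 + 15 * a + 13) * x 1 + (2 * a + 5) * x 2,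
      (2 * a + 5) * x 0 + (-2 * a ^ 2 - 7 * a - 6) * x 1 + (-a - 2) * x 2] := by
  ext i; rw [act_apply]; fin_cases i <;> simp [opX]

theorem act_opXinv (a : ℕ) (x : Space) : act (opXinv a) x =
    ![(a ^ 2 + 4 * a + 4) * x 0 + (2 * a ^ 2 + 9 * a + 10) * x 1 + (a + 3) * x 2,
      (a + 3) * x 0 + (2 * a + 7) * x 1 + x 2,
      x 0 + 4 * x 1 + 4 * x 2] := by
  ext i; rw [act_apply]; fin_cases i <;> simp [opXinv]

theorem act_opY (a : ℕ) (x : Space) : act (opY a) x =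
    ![(a ^ 2 + 4) * x 0 + (2 * a ^ 2 + a - 2) * x 1 + (a - 1) * x 2,
      (a - 1) * x 0 + (2 * a + 3) * x 1 + x 2, x 0] := by
  ext i; rw [act_apply]; fin_cases i <;> simp [opY]

theorem act_opYinv (a : ℕ) (x : Space) : act (opYinv a) x =
    ![x 2, x 0 + (-a + 1) * x 1 + (-2 * a - 3) * x 2,
      (-2 * a - 3) * x 0 + (2 * a ^ 2 + a - 2) * x 1 + (4 * a ^ 2 + 11 * a + 10) * x 2] := by
  ext i; rw [act_apply]; fin_cases i <;> simp [opYinv]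

theorem act_opM (a : ℕ) (x : Space) : act (opM a) x =
    ![x 1, x 2, x 0 - (a - 1) * x 1 - (3 + 2 * a) * x 2] := by
  ext i; rw [act_apply]; fin_cases i <;> simp [opM, frobeniusOperator] <;> try ring

theorem act_X_A (a : ℕ) : act (opX a) (pt a .A) = pt a .D := by
  rw [act_opX]; ext i; fin_cases i <;> simp [pt, coords] <;> try ring
theorem act_X_B (a : ℕ) : act (opX a) (pt a .B) = pt a .C := by
  rw [act_opX]; ext i; fin_cases i <;> simp [pt, coords]
theorem act_Y_A (a : ℕ) : act (opY a) (pt a .A) = pt a .B := by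
  rw [act_opY]; ext i; fin_cases i <;> simp [pt, coords] <;> try ring
theorem act_Y_G (a : ℕ) : act (opY a) (pt a .G) = pt a .E := by
  rw [act_opY]; ext i; fin_cases i <;> simp [pt, coords] <;> try ring
theorem act_Y_D (a : ℕ) : act (opY a) (pt a .D) = pt a .C := by
  rw [act_opY]; ext i; fin_cases i <;> simp [pt, coords] <;> try ring

end SailTorus

namespace SailTorus

/-! ### The roots of the characteristic polynomial of `M⁻¹` -/

/-- The three roots, with their locations. -/
structure Roots (a : ℕ) (t : Fin 3 → ℝ) : Prop where
  root : ∀ k, t k ^ 3 = (a - 1) * t k ^ 2 + (2 * a + 3) * t k + 1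
  lo0 : -3 < t 0
  hi0 : t 0 < -2
  lo1 : -1 < t 1
  hi1 : t 1 < 0
  lo2 : 1 < t 2

theorem exists_roots (a : ℕ) : ∃ t, Roots a t := by
  have ha : (0 : ℝ) ≤ a := Nat.cast_nonneg a
  let q : ℝ → ℝ := fun t => t ^ 3 - (a - 1) * t ^ 2 - (2 * a + 3) * t - 1
  have hq : Continuous q := by fun_prop
  obtain ⟨t0, ⟨h0, h0'⟩, e0⟩ : (0 : ℝ) ∈ q '' Set.Ioo (-3) (-2) :=
    intermediate_value_Ioo (by norm_num) hq.continuousOn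
      ⟨by simp only [q]; nlinarith, by simp only [q]; nlinarith⟩
  obtain ⟨t1, ⟨h1, h1'⟩, e1⟩ : (0 : ℝ) ∈ q '' Set.Ioo (-1) 0 :=
    intermediate_value_Ioo' (by norm_num) hq.continuousOn
      ⟨by simp only [q]; nlinarith, by simp only [q]; nlinarith⟩
  -- The endpoint works because q(a + 3) = (a + 3)(2a + 9) - 1 > 0. Only the lower bound is kept.
  obtain ⟨t2, ⟨h2, h2'⟩, e2⟩ : (0 : ℝ) ∈ q '' Set.Ioo 1 (a + 3) :=
    intermediate_value_Ioo (by linarith) hq.continuousOn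
      ⟨by simp only [q]; nlinarith, by simp only [q]; nlinarith⟩
  simp only [q] at e0 e1 e2
  refine ⟨![t0, t1, t2], ?_, h0, h0', h1, h1', h2⟩
  intro k
  fin_cases k
  · change t0 ^ 3 = _ * t0 ^ 2 + _ * t0 + 1; linarith
  · change t1 ^ 3 = _ * t1 ^ 2 + _ * t1 + 1; linarith
  · change t2 ^ 3 = _ * t2 ^ 2 + _ * t2 + 1; linarith

/-- The left eigenvector of `M` with eigenvalue `s⁻¹`. -/
noncomputable def ell (a : ℕ) (s : ℝ) : Space →L[ℝ] ℝ := lin s (s ^ 2 - (a - 1) * s) 1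

theorem ell_apply (a : ℕ) (s : ℝ) (x : Space) :
    ell a s x = s * x 0 + (s ^ 2 - (a - 1) * s) * x 1 + x 2 := by
  simp [ell, lin_apply]

/-- The right eigenvector of `M` with eigenvalue `s⁻¹`. -/
noncomputable def eigvec (s : ℝ) : Space := ![s ^ 2, s, 1]

/-- This normalisation lets the eigenvalue of a commuting operator g be written as the value of the
eigenform at g B, which is done throughout. -/
theorem ell_base (a : ℕ) (s : ℝ) : ell a s (pt a .B) = 1 := by
  simp [ell_apply, pt, coords]

namespace Roots

variable {a : ℕ} {t : Fin 3 → ℝ} (ht : Roots a t)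
include ht

theorem ne_zero (k : Fin 3) : t k ≠ 0 := by
  intro h
  have := ht.root k
  rw [h] at this
  norm_num at this

theorem lt01 : t 0 < t 1 := by have := ht.hi0; have := ht.lo1; linarith
theorem lt12 : t 1 < t 2 := by have := ht.hi1; have := ht.lo2; linarith
theorem lt02 : t 0 < t 2 := ht.lt01.trans ht.lt12

/-- Two rounds of divided differences: subtract root equations and cancel the differences of
distinct roots. -/
theorem sum_roots : t 0 + t 1 + t 2 = a - 1 := by
  have h0 := ht.root 0
  have h1 := ht.root 1
  have h2 := ht.root 2
  have h01 : t 0 - t 1 ≠ 0 := by have := ht.lt01; linarith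
  have h02 : t 0 - t 2 ≠ 0 := by have := ht.lt02; linarith
  have h12 : t 1 - t 2 ≠ 0 := by have := ht.lt12; linarith
  have e1 : t 0 ^ 2 + t 0 * t 1 + t 1 ^ 2 = (a - 1) * (t 0 + t 1) + (2 * a + 3) :=
    mul_left_cancel₀ h01 (by linear_combination h0 - h1)
  have e2 : t 0 ^ 2 + t 0 * t 2 + t 2 ^ 2 = (a - 1) * (t 0 + t 2) + (2 * a + 3) :=
    mul_left_cancel₀ h02 (by linear_combination h0 - h2)
  exact mul_left_cancel₀ h12 (by linear_combination e1 - e2)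

theorem sum_mul_roots : t 0 * t 1 + t 0 * t 2 + t 1 * t 2 = -(2 * a + 3) := by
  have h0 := ht.root 0
  have h1 := ht.root 1
  have h01 : t 0 - t 1 ≠ 0 := by have := ht.lt01; linarith
  have e1 : t 0 ^ 2 + t 0 * t 1 + t 1 ^ 2 = (a - 1) * (t 0 + t 1) + (2 * a + 3) :=
    mul_left_cancel₀ h01 (by linear_combination h0 - h1)
  linear_combination (t 0 + t 1) * ht.sum_roots - e1

theorem prod_roots : t 0 * t 1 * t 2 = 1 := by
  linear_combination ht.root 0 - t 0 ^ 2 * ht.sum_roots + t 0 * ht.sum_mul_roots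

theorem ell_opM (k : Fin 3) (x : Space) :
    t k * ell a (t k) (act (opM a) x) = ell a (t k) x := by
  rw [act_opM, ell_apply, ell_apply]
  simp
  linear_combination x 2 * ht.root k

theorem act_opM_eigvec (k : Fin 3) : act (opM a) (eigvec (t k)) = (t k)⁻¹ • eigvec (t k) := by
  have h := ht.ne_zero k
  rw [act_opM]
  ext i
  fin_cases i
  · simp [eigvec]; field_simp
  · simp [eigvec]; field_simp
  · simp [eigvec]; field_simp; linear_combination ht.root k

theorem eq_zero_of_ell {x : Space} (h : ∀ k, ell a (t k) x = 0) : x = 0 := by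
  have h0 := h 0
  have h1 := h 1
  have h2 := h 2
  rw [ell_apply] at h0 h1 h2
  have h01 : t 0 - t 1 ≠ 0 := by have := ht.lt01; linarith
  have h02 : t 0 - t 2 ≠ 0 := by have := ht.lt02; linarith
  have h12 : t 1 - t 2 ≠ 0 := by have := ht.lt12; linarith
  have e1 : x 0 + (t 0 + t 1 - (a - 1)) * x 1 = 0 :=
    mul_left_cancel₀ h01 (by linear_combination h0 - h1)
  have e2 : x 0 + (t 0 + t 2 - (a - 1)) * x 1 = 0 :=
    mul_left_cancel₀ h02 (by linear_combination h0 - h2)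
  have e3 : x 1 = 0 := mul_left_cancel₀ h12 (by linear_combination e1 - e2)
  rw [e3] at e1 h0
  have e4 : x 0 = 0 := by linarith
  rw [e4] at h0
  ext i
  fin_cases i
  · exact e4
  · exact e3
  · simpa using h0

theorem ext_ell {x y : Space} (h : ∀ k, ell a (t k) x = ell a (t k) y) : x = y := by
  rw [← sub_eq_zero]
  exact ht.eq_zero_of_ell fun k => by rw [map_sub, h k, sub_self]

/-- Left and right eigenvectors for different eigenvalues are orthogonal. Concretely the value is 1
- t₀t₁t₂. -/
theorem ell_eigvec_ne {k j : Fin 3} (h : k ≠ j) : ell a (t k) (eigvec (t j)) = 0 := by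
  have h1 := ht.sum_roots
  have h3 := ht.prod_roots
  rw [ell_apply]
  fin_cases k <;> fin_cases j <;> simp [eigvec] at h ⊢
  · linear_combination t 0 * t 1 * h1 - h3
  · linear_combination t 0 * t 2 * h1 - h3
  · linear_combination t 1 * t 0 * h1 - h3
  · linear_combination t 1 * t 2 * h1 - h3
  · linear_combination t 2 * t 0 * h1 - h3
  · linear_combination t 2 * t 1 * h1 - h3

/-- The value is t₀ times the derivative of the cubic at t₀. Of the three such values only this one
is negative, which explains the sign pattern required in `form_eq`. -/
theorem ell_eigvec_zero : ell a (t 0) (eigvec (t 0)) < 0 := by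
  have h1 := ht.sum_roots
  have h3 := ht.prod_roots
  have : ell a (t 0) (eigvec (t 0)) = t 0 * ((t 0 - t 1) * (t 0 - t 2)) := by
    rw [ell_apply]; simp [eigvec]; linear_combination t 0 ^ 2 * h1 - h3
  rw [this]
  have := ht.lt01
  have := ht.lt02
  have := ht.hi0
  exact mul_neg_of_neg_of_pos (by linarith) (mul_pos_of_neg_of_neg (by linarith) (by linarith))

theorem ell_eigvec_one : 0 < ell a (t 1) (eigvec (t 1)) := by
  have h1 := ht.sum_roots
  have h3 := ht.prod_roots
  have : ell a (t 1) (eigvec (t 1)) = -t 1 * ((t 1 - t 0) * (t 2 - t 1)) := by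
    rw [ell_apply]; simp [eigvec]; linear_combination t 1 ^ 2 * h1 - h3
  rw [this]
  have := ht.lt01
  have := ht.lt12
  have := ht.hi1
  exact mul_pos (by linarith) (mul_pos (by linarith) (by linarith))

theorem ell_eigvec_two : 0 < ell a (t 2) (eigvec (t 2)) := by
  have h1 := ht.sum_roots
  have h3 := ht.prod_roots
  have : ell a (t 2) (eigvec (t 2)) = t 2 * ((t 2 - t 0) * (t 2 - t 1)) := by
    rw [ell_apply]; simp [eigvec]; linear_combination t 2 ^ 2 * h1 - h3
  rw [this]
  have := ht.lt02
  have := ht.lt12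
  have := ht.lo2
  exact mul_pos (by linarith) (mul_pos (by linarith) (by linarith))

theorem ell_eigvec_self_ne (k : Fin 3) : ell a (t k) (eigvec (t k)) ≠ 0 := by
  fin_cases k
  · exact ht.ell_eigvec_zero.ne
  · exact ht.ell_eigvec_one.ne'
  · exact ht.ell_eigvec_two.ne'

theorem eq_sum_eigvec (x : Space) :
    x = ∑ j, (ell a (t j) x / ell a (t j) (eigvec (t j))) • eigvec (t j) := by
  apply ht.ext_ell
  intro k
  rw [map_sum, Finset.sum_eq_single k]
  · rw [map_smul, smul_eq_mul, div_mul_cancel₀ _ (ht.ell_eigvec_self_ne k)]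
  · intro j _ hj
    rw [map_smul, ht.ell_eigvec_ne hj.symm, smul_zero]
  · simp

/-- A linear form with the right signs on the eigenvectors is a positive combination of the
eigenforms. -/
theorem form_eq (f : Space →L[ℝ] ℝ) (h0 : f (eigvec (t 0)) < 0) (h1 : 0 < f (eigvec (t 1)))
    (h2 : 0 < f (eigvec (t 2))) :
    ∃ w : Fin 3 → ℝ, (∀ k, 0 < w k) ∧ ∀ x, f x = ∑ k, w k * ell a (t k) x := by
  refine ⟨fun k => f (eigvec (t k)) / ell a (t k) (eigvec (t k)), ?_, ?_⟩
  · intro k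
    fin_cases k
    · exact div_pos_of_neg_of_neg h0 ht.ell_eigvec_zero
    · exact div_pos h1 ht.ell_eigvec_one
    · exact div_pos h2 ht.ell_eigvec_two
  · intro x
    conv_lhs => rw [ht.eq_sum_eigvec x]
    rw [map_sum]
    refine Finset.sum_congr rfl fun k _ => ?_
    rw [map_smul, smul_eq_mul]
    ring

/-- Operators commuting with `M` act diagonally. -/
theorem ell_act {g : SL3} (hg : Commute g (opM a)) (k : Fin 3) (x : Space) :
    ell a (t k) (act g x) = ell a (t k) (act g (pt a .B)) * ell a (t k) x := by
  have hB : pt a .B = ![0, 0, 1] := by ext i; fin_cases i <;> simp [pt, coords]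
  set f : Space →L[ℝ] ℝ := (ell a (t k)).comp (actL g) with hf
  have fx : ∀ y, f y = ell a (t k) (act g y) := fun y => by simp [hf, actL_apply]
  -- Pulling an eigenform back along a commuting g gives a left eigenvector for the same eigenvalue.
  -- That eigenspace is a line: the relation at two basis vectors determines the first two
  -- coefficients from the third.
  have key : ∀ y, t k * f (act (opM a) y) = f y := fun y => by
    rw [fx, fx, ← act_mul, hg.eq, act_mul, ht.ell_opM]
  have e1 := key ![1, 0, 0]
  have e2 := key ![0, 0, 1]
  have hn := ht.ne_zero k
  rw [← fx, ← fx, hB, ell_apply]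
  rw [act_opM] at e1 e2
  obtain ⟨p, q, r, hpqr⟩ : ∃ p q r, f = lin p q r := ⟨_, _, _, eq_lin f⟩
  rw [hpqr] at e1 e2 ⊢
  simp only [lin_apply] at e1 e2 ⊢
  simp at e1 e2 ⊢
  have e3 : q = (t k ^ 2 - (a - 1) * t k) * r := by
    apply mul_left_cancel₀ hn
    linear_combination e2 - r * ht.root k
  rw [e3]
  linear_combination -x 0 * e1

/-- All three eigenvalues of a commuting operator can be read off from the image of B, so questions
about periods become questions about points. -/
theorem eq_of_act_base {g h : SL3} (hg : Commute g (opM a)) (hh : Commute h (opM a))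
    (H : act g (pt a .B) = act h (pt a .B)) : g = h := by
  apply eq_of_act_eq
  intro x
  apply ht.ext_ell
  intro k
  rw [ht.ell_act hg, ht.ell_act hh, H]

/-! ### Multipliers of the periods -/

/-- As C = X B and X = (2I + M⁻¹)⁻², the eigenvalue of X is (2 + t)⁻². -/
theorem ell_C (k : Fin 3) : ell a (t k) (pt a .C) * (2 + t k) ^ 2 = 1 := by
  rw [ell_apply]
  simp [pt, coords]
  linear_combination ((2 * a + 5) * t k + (4 * a + 9)) * ht.root k

end Roots
end SailTorus

/-! ### Orbits of the named points, the norm form, eigenvalues of the periods -/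

namespace SailTorus

/-- The shift of a label with respect to the representative of its orbit. -/
def shift : Label → ℤ × ℤ
  | .A => (0, -1)
  | .B => (0, 0)
  | .C => (1, 0)
  | .D => (1, -1)
  | .E => (0, 0)
  | .F => (0, 0)
  | .G => (0, -1)

/-- The representative of the orbit of a label. -/
def rep : Label → Label
  | .A => .B
  | .B => .B
  | .C => .B
  | .D => .B
  | .E => .E
  | .F => .F
  | .G => .E

/-- This encodes a named point by a representative and a period. Incidences between translated cells
thereby become statements about `rep` and `shift` that no longer involve `a` and can be decided. -/
theorem pt_eq_act (a : ℕ) (l : Label) : pt a l = act (per a (shift l)) (pt a (rep l)) := by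
  have hA : pt a .A = act (per a (0, -1)) (pt a .B) := by
    rw [← act_Y_A, ← per_Y, ← act_per_add]; simp [← Prod.zero_eq_mk, act_per_zero]
  have hG : pt a .G = act (per a (0, -1)) (pt a .E) := by
    rw [← act_Y_G, ← per_Y, ← act_per_add]; simp [← Prod.zero_eq_mk, act_per_zero]
  cases l
  · exact hA
  · exact (act_per_zero a _).symm
  · rw [← act_X_B, ← per_X]; rfl
  · rw [← act_X_A, hA, ← per_X, ← act_per_add]; rfl
  · exact (act_per_zero a _).symm
  · exact (act_per_zero a _).symm
  · exact hG

/-- The norm form. -/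
def normZ (a : ℕ) (z : Fin 3 → ℤ) : ℤ :=
  z 1 ^ 3 - (2 * a + 3) * z 1 ^ 2 * (z 0 - (a - 1) * z 1)
    + z 1 ^ 2 * z 2 * ((2 * a + 3) ^ 2 - 2 * (a - 1)) + z 1 * (z 0 - (a - 1) * z 1) ^ 2 * (a - 1)
    + z 1 * (z 0 - (a - 1) * z 1) * z 2 * (-(a - 1) * (2 * a + 3) - 3)
    + z 1 * z 2 ^ 2 * ((a - 1) ^ 2 + 2 * (2 * a + 3)) + (z 0 - (a - 1) * z 1) ^ 3
    - (2 * a + 3) * (z 0 - (a - 1) * z 1) ^ 2 * z 2 + (z 0 - (a - 1) * z 1) * z 2 ^ 2 * (a - 1)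
    + z 2 ^ 3

/-- The three values are pairwise distinct, so the norm separates the orbits of B, E and F. The
default 0 is never reached, since `rep` takes no other value. -/
theorem normZ_rep (a : ℕ) (l : Label) : normZ a (coords a (rep l)) =
    match rep l with | .B => 1 | .E => (a : ℤ) + 2 | .F => (a + 2) ^ 2 | _ => 0 := by
  cases l <;> simp [rep, normZ, coords] <;> ring

theorem rep_injective_of_norm {a : ℕ} {l l' : Label}
    (h : normZ a (coords a (rep l)) = normZ a (coords a (rep l'))) : rep l = rep l' := by
  have ha : (0 : ℤ) ≤ a := Int.natCast_nonneg a
  rw [normZ_rep, normZ_rep] at h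
  cases l <;> cases l' <;> simp only [rep] at h ⊢ <;> exfalso <;> nlinarith

theorem ell_opY (a : ℕ) (s : ℝ) : ell a s (act (opY a) (pt a .B)) = s ^ 2 := by
  rw [act_opY, ell_apply]
  simp [pt, coords]
  ring

namespace Roots

variable {a : ℕ} {t : Fin 3 → ℝ} (ht : Roots a t)
include ht

/-- As a polynomial in the root the eigenform is z₁t² + (z₀ - (a - 1)z₁)t + z₂, so the product over
the roots is symmetric and hence an integer. After writing the coefficients as symmetric functions
of the roots, only multiples of t₀t₁t₂ - 1 remain. -/
theorem prod_ell_intPt (z : Fin 3 → ℤ) :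
    ell a (t 0) (intPt z) * ell a (t 1) (intPt z) * ell a (t 2) (intPt z) = (normZ a z : ℝ) := by
  have h1 := ht.sum_roots
  have h2 := ht.sum_mul_roots
  have h3 := ht.prod_roots
  simp only [ell_apply, intPt, normZ]
  push_cast
  have h2' : (2 * a + 3 : ℝ) = -(t 0 * t 1 + t 0 * t 2 + t 1 * t 2) := by linarith
  rw [h2', ← h1]
  set y : ℝ := z 0 - (t 0 + t 1 + t 2) * z 1 with hy
  have hz : (z 0 : ℝ) = y + (t 0 + t 1 + t 2) * z 1 := by rw [hy]; ring
  rw [hz]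
  generalize (z 1 : ℝ) = p
  generalize (z 2 : ℝ) = r
  linear_combination (exp := 1) (p ^ 3 * (t 0 * t 1 * t 2 + 1)
    + p ^ 2 * y * (t 0 * t 1 + t 0 * t 2 + t 1 * t 2) - 2 * p ^ 2 * r * (t 0 + t 1 + t 2)
    + p * y ^ 2 * (t 0 + t 1 + t 2) - 3 * p * y * r + y ^ 3) * h3

theorem ell_zpow {g : SL3} (hg : Commute g (opM a)) (k : Fin 3) (n : ℤ) (x : Space) :
    ell a (t k) (act (g ^ n) x) = ell a (t k) (act g (pt a .B)) ^ n * ell a (t k) x := by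
  have h0 : ell a (t k) (act g (pt a .B)) ≠ 0 := by
    intro h
    have := ht.ell_act hg k (act g⁻¹ (pt a .B))
    rw [act_act_inv, h, zero_mul, ell_base] at this
    exact one_ne_zero this
  have hinv : ∀ y, ell a (t k) (act g⁻¹ y) = (ell a (t k) (act g (pt a .B)))⁻¹ * ell a (t k) y := by
    intro y
    have := ht.ell_act hg k (act g⁻¹ y)
    rw [act_act_inv] at this
    rw [this, inv_mul_cancel_left₀ h0]
  induction n using Int.induction_on generalizing x with
  | zero => simp [act_one]
  | succ n ih =>
    rw [_root_.zpow_add_one, act_mul, ih, ht.ell_act hg k x, zpow_add_one₀ h0]; ring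
  | pred n ih =>
    rw [_root_.zpow_sub_one, act_mul, ih, hinv, zpow_sub_one₀ h0]; ring

theorem ell_per (k : Fin 3) (d : ℤ × ℤ) (x : Space) : ell a (t k) (act (per a d) x) =
    ell a (t k) (pt a .C) ^ d.1 * (t k ^ 2) ^ d.2 * ell a (t k) x := by
  rw [per, act_mul, ht.ell_zpow (commute_opX_opM a), ht.ell_zpow (commute_opY_opM a), act_X_B,
    ell_opY]
  ring

theorem ell_C_pos (k : Fin 3) : 0 < ell a (t k) (pt a .C) := by
  have h := ht.ell_C k
  by_contra hc
  have := mul_nonpos_of_nonpos_of_nonneg (not_lt.1 hc) (sq_nonneg (2 + t k))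
  linarith

theorem mult_pos (k : Fin 3) (d : ℤ × ℤ) :
    0 < ell a (t k) (pt a .C) ^ d.1 * (t k ^ 2) ^ d.2 :=
  mul_pos (zpow_pos (ht.ell_C_pos k) _) (zpow_pos (by have := ht.ne_zero k; positivity) _)

theorem ell_C_lt_one {k : Fin 3} (hk : -1 < t k) : ell a (t k) (pt a .C) < 1 := by
  have h := ht.ell_C k
  have := ht.ell_C_pos k
  by_contra hc
  nlinarith [mul_nonneg (sub_nonneg.2 (not_lt.1 hc)) (sq_nonneg (2 + t k))]

/-- The two generators are multiplicatively independent. -/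
theorem eq_zero_of_mult_eq_one {d : ℤ × ℤ}
    (h : ∀ k, ell a (t k) (pt a .C) ^ d.1 * (t k ^ 2) ^ d.2 = 1) : d = 0 := by
  have hl : ∀ k, d.1 * Real.log (ell a (t k) (pt a .C)) + d.2 * Real.log (t k ^ 2) = 0 := by
    intro k
    have := congrArg Real.log (h k)
    rwa [Real.log_one, Real.log_mul, Real.log_zpow, Real.log_zpow] at this
    · exact (zpow_pos (ht.ell_C_pos k) _).ne'
    · exact (zpow_pos (by have := ht.ne_zero k; positivity) _).ne'
  have p1 : Real.log (ell a (t 1) (pt a .C)) < 0 :=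
    Real.log_neg (ht.ell_C_pos 1) (ht.ell_C_lt_one ht.lo1)
  have p2 : Real.log (ell a (t 2) (pt a .C)) < 0 :=
    Real.log_neg (ht.ell_C_pos 2) (ht.ell_C_lt_one (by have := ht.lo2; linarith))
  have q1 : Real.log (t 1 ^ 2) < 0 := by
    have := ht.lo1
    have := ht.hi1
    exact Real.log_neg (by nlinarith) (by nlinarith)
  have q2 : 0 < Real.log (t 2 ^ 2) := by
    have := ht.lo2
    exact Real.log_pos (by nlinarith)
  have e1 := hl 1
  have e2 := hl 2
  set P1 := Real.log (ell a (t 1) (pt a .C))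
  set P2 := Real.log (ell a (t 2) (pt a .C))
  set Q1 := Real.log (t 1 ^ 2)
  set Q2 := Real.log (t 2 ^ 2)
  -- A regulator computed from two of the three eigenvalues: X contracts in both directions, while Y
  -- contracts in the first and expands in the second.
  have hdet : P1 * Q2 - Q1 * P2 < 0 := by
    have m1 := mul_neg_of_neg_of_pos p1 q2
    have m2 := mul_pos_of_neg_of_neg q1 p2
    linarith
  have h1 : (d.1 : ℝ) = 0 := by
    apply mul_right_cancel₀ hdet.ne
    linear_combination Q2 * e1 - Q1 * e2
  have h2 : (d.2 : ℝ) = 0 := by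
    rw [h1] at e1
    apply mul_right_cancel₀ q1.ne
    linear_combination e1
  exact Prod.ext (by exact_mod_cast h1) (by exact_mod_cast h2)

/-- The periods have determinant 1, so they preserve the norm. -/
theorem prod_mult (d : ℤ × ℤ) :
    ell a (t 0) (pt a .C) ^ d.1 * (t 0 ^ 2) ^ d.2 * (ell a (t 1) (pt a .C) ^ d.1 * (t 1 ^ 2) ^ d.2) *
      (ell a (t 2) (pt a .C) ^ d.1 * (t 2 ^ 2) ^ d.2) = 1 := by
  have hC : ell a (t 0) (pt a .C) * ell a (t 1) (pt a .C) * ell a (t 2) (pt a .C) = 1 := by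
    rw [pt_eq_intPt, ht.prod_ell_intPt]
    have : normZ a (coords a .C) = 1 := by simp [normZ, coords]; ring
    rw [this]; norm_num
  calc _ = (ell a (t 0) (pt a .C) * ell a (t 1) (pt a .C) * ell a (t 2) (pt a .C)) ^ d.1 *
        ((t 0 * t 1 * t 2) ^ 2) ^ d.2 := by
        rw [mul_pow, mul_pow, mul_zpow, mul_zpow, mul_zpow, mul_zpow]; ring
    _ = 1 := by rw [hC, ht.prod_roots]; simp

theorem eq_zero_of_act_per_eq {d : ℤ × ℤ} {x : Space} (hx : ∀ k, ell a (t k) x ≠ 0)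
    (h : act (per a d) x = x) : d = 0 := by
  apply ht.eq_zero_of_mult_eq_one
  intro k
  have := ht.ell_per k d x
  rw [h] at this
  exact (mul_right_cancel₀ (hx k) (by linear_combination this)).symm

end Roots

/-! ### Irreducibility -/

theorem charpoly_opM (a : ℕ) : ((opM a).1.map (fun k : ℤ => (k : ℚ))).charpoly =
    Polynomial.X ^ 3 + Polynomial.C (2 * a + 3 : ℚ) * Polynomial.X ^ 2
      + Polynomial.C (a - 1 : ℚ) * Polynomial.X - 1 := by
  rw [Matrix.charpoly, Matrix.det_fin_three]
  simp [opM, frobeniusOperator]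
  ring

theorem natDegree_charpoly_opM (a : ℕ) :
    ((opM a).1.map (fun k : ℤ => (k : ℚ))).charpoly.natDegree = 3 := by
  simp [Matrix.charpoly_natDegree_eq_dim]

/-- A cubic without rational roots is irreducible. A rational root would be an integer dividing 1,
and both 1 and -1 fail for a ≥ 0. -/
theorem irreducible_charpoly_opM (a : ℕ) :
    Irreducible ((opM a).1.map (fun k : ℤ => (k : ℚ))).charpoly := by
  have hm := Matrix.charpoly_monic ((opM a).1.map (fun k : ℤ => (k : ℚ)))
  have hd := natDegree_charpoly_opM a
  rw [hm.irreducible_iff_roots_eq_zero_of_degree_le_three (by omega) (by omega)]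
  rw [Multiset.eq_zero_iff_forall_notMem]
  intro r hr
  have hr := (Polynomial.mem_roots'.1 hr).2
  rw [Polynomial.IsRoot, charpoly_opM] at hr
  simp at hr
  let P : Polynomial ℤ := Polynomial.X ^ 3 + (Polynomial.C (2 * a + 3 : ℤ) * Polynomial.X ^ 2
      + Polynomial.C (a - 1 : ℤ) * Polynomial.X - 1)
  have hP : P.Monic := by
    apply Polynomial.monic_X_pow_add
    have : (Polynomial.C (2 * a + 3 : ℤ) * Polynomial.X ^ 2
      + Polynomial.C (a - 1 : ℤ) * Polynomial.X - 1 : Polynomial ℤ) =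
      Polynomial.C (2 * a + 3 : ℤ) * Polynomial.X ^ 2
      + Polynomial.C (a - 1 : ℤ) * Polynomial.X + Polynomial.C (-1) := by simp; ring
    rw [this]
    exact lt_of_le_of_lt Polynomial.degree_quadratic_le (by norm_num)
  obtain ⟨k, hk⟩ := isInteger_of_is_root_of_monic (K := ℚ) hP (r := r) (by
    simp only [P, map_add, map_sub, map_mul, map_pow, Polynomial.aeval_X, Polynomial.aeval_C,
      map_one]
    simp
    linear_combination hr)
  simp at hk
  rw [← hk] at hr
  have hk' : k * (k ^ 2 + (2 * a + 3) * k + (a - 1)) = 1 := by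
    have : ((k * (k ^ 2 + (2 * a + 3) * k + (a - 1)) : ℤ) : ℚ) = 1 := by
      push_cast; linear_combination hr
    exact_mod_cast this
  have ha : (0 : ℤ) ≤ a := Int.natCast_nonneg a
  rcases Int.eq_one_or_neg_one_of_mul_eq_one hk' with rfl | rfl
  · linarith
  · linarith

/-! ### Integer points in eigencoordinates -/

namespace Roots

variable {a : ℕ} {t : Fin 3 → ℝ} (ht : Roots a t)
include ht

/-- Integer points do not lie on the invariant planes. -/
theorem ell_intPt_ne_zero (k : Fin 3) {z : Fin 3 → ℤ} (hz : z ≠ 0) :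
    ell a (t k) (intPt z) ≠ 0 := by
  intro h
  apply hz
  have hn := ht.ne_zero k
  have hr := ht.root k
  set p := ((opM a).1.map (fun k : ℤ => (k : ℚ))).charpoly with hp
  have hroot : Polynomial.aeval (t k)⁻¹ p = 0 := by
    rw [hp, charpoly_opM]
    simp
    field_simp
    linear_combination -hr
  have hmin : minpoly ℚ (t k)⁻¹ = p :=
    (minpoly.eq_of_irreducible_of_monic (irreducible_charpoly_opM a) hroot
      (Matrix.charpoly_monic _)).symm
  -- Dividing the vanishing eigenform by t and eliminating t through the cubic gives a quadratic
  -- relation for t⁻¹. The minimal polynomial of t⁻¹ has degree 3, so all coefficients of the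
  -- relation vanish.
  let f : Polynomial ℚ := Polynomial.C (z 1 : ℚ) * Polynomial.X ^ 2 +
    Polynomial.C ((2 * a + 3) * z 1 + z 2 : ℚ) * Polynomial.X + Polynomial.C (z 0 : ℚ)
  have hf : Polynomial.aeval (t k)⁻¹ f = 0 := by
    rw [ell_apply] at h
    simp only [intPt] at h
    have h' : t k = (a - 1) + (2 * a + 3) * (t k)⁻¹ + (t k)⁻¹ ^ 2 := by
      field_simp
      linear_combination hr
    have h'' : z 0 + (t k - (a - 1)) * z 1 + (t k)⁻¹ * z 2 = 0 := by
      field_simp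
      linear_combination h
    simp only [f, map_add, map_mul, map_pow, Polynomial.aeval_X, Polynomial.aeval_C]
    simp
    linear_combination h'' - z 1 * h'
  have hf0 : f = 0 := by
    by_contra hne
    have h1 := Polynomial.natDegree_le_natDegree (minpoly.degree_le_of_ne_zero ℚ (t k)⁻¹ hne hf)
    rw [hmin, hp, natDegree_charpoly_opM] at h1
    have h2 : f.natDegree ≤ 2 := Polynomial.natDegree_quadratic_le
    omega
  have c0 : f.coeff 0 = 0 := by rw [hf0]; simp
  have c1 : f.coeff 1 = 0 := by rw [hf0]; simp
  have c2 : f.coeff 2 = 0 := by rw [hf0]; simp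
  simp only [f, Polynomial.coeff_add, Polynomial.coeff_C_mul, Polynomial.coeff_X_pow,
    Polynomial.coeff_X, Polynomial.coeff_C] at c0 c1 c2
  norm_num at c0 c1 c2
  rw [c2] at c1
  ext i
  fin_cases i
  · exact c0
  · exact c2
  · simpa using c1

/-- Only finitely many integer points have bounded eigencoordinates. -/
theorem finite_integer_points (C : ℝ) :
    {x : Space | IsIntegerPoint x ∧ ∀ k, |ell a (t k) x| ≤ C}.Finite := by
  let L : Space →ₗ[ℝ] Space := LinearMap.pi fun k => (ell a (t k)).toLinearMap
  have hL : Function.Injective L := by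
    intro x y h
    exact ht.ext_ell fun k => congrFun h k
  let Le := LinearEquiv.ofInjectiveEndo L hL
  let K : Space →L[ℝ] Space := LinearMap.toContinuousLinearMap Le.symm.toLinearMap
  have hK : ∀ x, K (L x) = x := fun x => Le.symm_apply_apply x
  set R := ‖K‖ * |C| with hR
  have hfin : (Set.pi Set.univ fun _ : Fin 3 => Set.Icc (-⌈R⌉) ⌈R⌉).Finite :=
    Set.Finite.pi fun _ => Set.finite_Icc _ _
  refine (hfin.image intPt).subset ?_
  rintro x ⟨hx, hb⟩
  obtain ⟨z, rfl⟩ := (isIntegerPoint_iff x).1 hx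
  refine ⟨z, ?_, rfl⟩
  intro i _
  have h1 : ‖L (intPt z)‖ ≤ |C| := by
    rw [pi_norm_le_iff_of_nonneg (abs_nonneg C)]
    exact fun k => (hb k).trans (le_abs_self C)
  have h2 : ‖intPt z‖ ≤ R := by
    conv_lhs => rw [← hK (intPt z)]
    exact (K.le_opNorm _).trans (mul_le_mul_of_nonneg_left h1 (norm_nonneg _))
  have h3 : |(z i : ℝ)| ≤ R := (norm_le_pi_norm (intPt z) i).trans h2
  have h4 := abs_le.1 (h3.trans (Int.le_ceil R))
  exact ⟨by exact_mod_cast h4.1, by exact_mod_cast h4.2⟩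

end Roots
end SailTorus

namespace SailTorus

/-! ### The four polygons and their supporting forms -/

/-- The four polygons of the fundamental region. -/
inductive Tile : Type
  | abg | pent | efc | cdf

/-- The vertices of the polygons. -/
def tileCell : Tile → Finset Label
  | .abg => {.A, .B, .G}
  | .pent => {.B, .E, .F, .D, .G}
  | .efc => {.E, .F, .C}
  | .cdf => {.C, .D, .F}

instance : DecidableEq Tile := fun x y => by
  cases x <;> cases y <;> first | exact isTrue rfl | exact isFalse (by intro h; cases h)

instance : Fintype Tile := ⟨{.abg, .pent, .efc, .cdf}, fun x => by cases x <;> decide⟩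

/-- The linear form which equals `1` on a polygon. -/
noncomputable def tileForm (a : ℕ) : Tile → (Space →L[ℝ] ℝ)
  | .abg => lin a (2 * a + 3) 1
  | .pent => lin (a + 1) (2 * a + 3) 1
  | .efc => lin ((a + 2) ^ 2 / (a + 3)) ((2 * a ^ 2 + 9 * a + 11) / (a + 3)) ((a + 4) / (a + 3))
  | .cdf => lin ((a ^ 2 + 5 * a + 5) / 2) ((2 * a ^ 2 + 11 * a + 13) / 2) ((a + 4) / 2)

theorem cast_add_ne (a : ℕ) : (a : ℝ) + 1 ≠ 0 ∧ (a : ℝ) + 2 ≠ 0 ∧ (a : ℝ) + 3 ≠ 0 :=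
  ⟨by positivity, by positivity, by positivity⟩

theorem tileForm_pt (a : ℕ) (n : Tile) {l : Label} (hl : l ∈ tileCell n) :
    tileForm a n (pt a l) = 1 := by
  obtain ⟨h1, h2, h3⟩ := cast_add_ne a
  cases n <;> cases l <;> simp [tileCell] at hl <;>
    simp [tileForm, lin_apply, pt, coords] <;> field_simp <;> ring

/-! The difference of the forms of adjacent polygons vanishes on the common edge. -/

/-- The side AB is carried to DC by X, so the polygon beyond AB is the X⁻¹-translate of CDF, whose
form is the one of CDF composed with X. The other sides on the boundary of the region are treated in
the same way. -/
theorem cdf_X_eq (a : ℕ) (y : Space) : tileForm a .cdf (act (per a (1, 0)) y) =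
    tileForm a .abg y + 1 / 2 * lin (-(2 * a + 3)) (-1) 0 y := by
  rw [per_X, act_opX]; simp [tileForm, lin_apply]; ring

theorem pent_Y_eq (a : ℕ) (y : Space) : tileForm a .pent (act (per a (0, 1)) y) =
    tileForm a .abg y +
      (a + 1) * lin (a ^ 2 + 2 * a + 2) (2 * a ^ 2 + 5 * a + 4) (a + 1) y := by
  rw [per_Y, act_opY]; simp [tileForm, lin_apply]; ring

theorem pent_eq (a : ℕ) (y : Space) : tileForm a .pent y = tileForm a .abg y + y 0 := by
  simp [tileForm, lin_apply]; ring

theorem abg_Yinv_eq (a : ℕ) (y : Space) : tileForm a .abg (act (per a (0, -1)) y) =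
    tileForm a .pent y + (a + 1) * lin (-1) (-2) 0 y := by
  rw [per_Y_neg, act_opYinv]; simp [tileForm, lin_apply]; ring

theorem efc_eq (a : ℕ) (y : Space) : tileForm a .efc y =
    tileForm a .pent y + 1 / (a + 3) * lin 1 2 1 y := by
  obtain ⟨h1, h2, h3⟩ := cast_add_ne a
  simp [tileForm, lin_apply]; field_simp; ring

theorem cdf_eq (a : ℕ) (y : Space) : tileForm a .cdf y = tileForm a .pent y +
    1 / 2 * lin (a ^ 2 + 3 * a + 3) (2 * a ^ 2 + 7 * a + 7) (a + 2) y := by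
  simp [tileForm, lin_apply]; ring

theorem efc_Y_eq (a : ℕ) (y : Space) : tileForm a .efc (act (per a (0, 1)) y) =
    tileForm a .pent y + (a + 2) / (a + 3) *
      lin (a ^ 3 + 4 * a ^ 2 + 6 * a + 3) (2 * a ^ 3 + 9 * a ^ 2 + 14 * a + 8)
        (a ^ 2 + 3 * a + 2) y := by
  obtain ⟨h1, h2, h3⟩ := cast_add_ne a
  rw [per_Y, act_opY]; simp [tileForm, lin_apply]; field_simp; ring

theorem cdf_eq_efc (a : ℕ) (y : Space) : tileForm a .cdf y = tileForm a .efc y +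
    (a + 1) / (2 * (a + 3)) * lin (a ^ 2 + 5 * a + 7) (2 * a ^ 2 + 11 * a + 17) (a + 4) y := by
  obtain ⟨h1, h2, h3⟩ := cast_add_ne a
  simp [tileForm, lin_apply]; field_simp; ring

theorem pent_Yinv_eq (a : ℕ) (y : Space) : tileForm a .pent (act (per a (0, -1)) y) =
    tileForm a .efc y + (a + 2) / (a + 3) * lin (-(a + 2)) (-(2 * a + 4)) 1 y := by
  obtain ⟨h1, h2, h3⟩ := cast_add_ne a
  rw [per_Y_neg, act_opYinv]; simp [tileForm, lin_apply]; field_simp; ring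

theorem abg_Xinv_eq (a : ℕ) (y : Space) : tileForm a .abg (act (per a (-1, 0)) y) =
    tileForm a .cdf y + 1 / 2 * lin (2 * a ^ 3 + 11 * a ^ 2 + 21 * a + 15)
      (4 * a ^ 3 + 24 * a ^ 2 + 49 * a + 37) (2 * a ^ 2 + 9 * a + 10) y := by
  rw [per_X_neg, act_opXinv]; simp [tileForm, lin_apply]; ring

/-! ### The cones over the polygons -/

/-- The triangles obtained from the polygons by cutting the pentagon. -/
inductive Tri : Type
  | abg | gbe | gef | gfd | efc | cdf

/-- The vertices of the triangles. -/
def triCell : Tri → Finset Label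
  | .abg => {.A, .B, .G}
  | .gbe => {.G, .B, .E}
  | .gef => {.G, .E, .F}
  | .gfd => {.G, .F, .D}
  | .efc => {.E, .F, .C}
  | .cdf => {.C, .D, .F}

/-- The polygon containing a triangle. -/
def triTile : Tri → Tile
  | .abg => .abg
  | .gbe => .pent
  | .gef => .pent
  | .gfd => .pent
  | .efc => .efc
  | .cdf => .cdf

theorem triCell_subset (τ : Tri) : triCell τ ⊆ tileCell (triTile τ) := by
  cases τ <;> decide

/-- The diagonal `GE` of the pentagon. -/
noncomputable def diagGE (a : ℕ) : Space →L[ℝ] ℝ :=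
  lin (-(2 * a ^ 2 + 5 * a + 4)) (-(4 * a ^ 2 + 10 * a + 8)) (-(2 * a + 2))

/-- The diagonal `GF` of the pentagon. -/
noncomputable def diagGF (a : ℕ) : Space →L[ℝ] ℝ :=
  lin (-(2 * a ^ 3 + 7 * a ^ 2 + 10 * a + 5)) (-(4 * a ^ 3 + 16 * a ^ 2 + 23 * a + 12))
    (-(2 * a ^ 2 + 5 * a + 3))

/-- Here u is the form of a polygon, v that of its neighbour and W the form vanishing on their
common side: minimality of u puts the point on the polygon's side of that edge. -/
theorem nonneg_of_eq_add_mul {u v κ W : ℝ} (e : v = u + κ * W) (hκ : 0 < κ) (h : u ≤ v) :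
    0 ≤ W :=
  nonneg_of_mul_nonneg_right (by linarith : 0 ≤ κ * W) hκ

/-- Nonnegative weights supported on the vertices of a triangle. -/
structure IsWeight (τ : Tri) (w : Label → ℝ) : Prop where
  nonneg : ∀ l, 0 ≤ w l
  supp : ∀ l, l ∉ triCell τ → w l = 0

/-- The cone over the pentagon is cut out by five forms. -/
theorem exists_weight_pentagon {a : ℕ} {y : Space} (eBE : 0 ≤ lin (-1) (-2) 0 y)
    (eEF : 0 ≤ lin 1 2 1 y)
    (eFD : 0 ≤ lin (a ^ 2 + 3 * a + 3) (2 * a ^ 2 + 7 * a + 7) (a + 2) y)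
    (eDG : 0 ≤ lin (a ^ 3 + 4 * a ^ 2 + 6 * a + 3) (2 * a ^ 3 + 9 * a ^ 2 + 14 * a + 8)
      (a ^ 2 + 3 * a + 2) y) (eGB : 0 ≤ -y 0) :
    ∃ τ, triTile τ = .pent ∧ ∃ w, IsWeight τ w ∧ y = ∑ l, w l • pt a l := by
  obtain ⟨h1, h2, h3⟩ := cast_add_ne a
  have h4 : (2 * a ^ 2 + 3 * a + 2 : ℝ) ≠ 0 := by positivity
  -- The diagonals from G cut the pentagon into three triangles, and the signs of their forms choose
  -- one. Each weight is the form of the opposite side divided by its value at the vertex.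
  rcases le_total (diagGE a y) 0 with hGE | hGE
  · have hGE' : 0 ≤ -diagGE a y := by linarith
    refine ⟨.gbe, rfl, fun
      | .B => -diagGE a y / (2 * (a + 1))
      | .E => -y 0 / 2
      | .G => lin (-1) (-2) 0 y / (2 * (a + 1))
      | _ => 0, ⟨?_, ?_⟩, ?_⟩
    · intro l
      cases l <;> simp only [le_refl] <;> positivity
    · intro l hl
      cases l <;> simp [triCell] at hl ⊢
    · ext i
      rw [sum_pt_apply, sum_label]
      fin_cases i <;> simp [pt, coords, lin_apply, diagGE] <;> field_simp <;> ring
  rcases le_total (diagGF a y) 0 with hGF | hGF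
  · have hGF' : 0 ≤ -diagGF a y := by linarith
    refine ⟨.gef, rfl, fun
      | .F => diagGE a y / (2 * a ^ 2 + 3 * a + 2)
      | .E => -diagGF a y / (2 * a ^ 2 + 3 * a + 2)
      | .G => lin 1 2 1 y / (2 * a ^ 2 + 3 * a + 2)
      | _ => 0, ⟨?_, ?_⟩, ?_⟩
    · intro l
      cases l <;> simp only [le_refl] <;> positivity
    · intro l hl
      cases l <;> simp [triCell] at hl ⊢
    · ext i
      rw [sum_pt_apply, sum_label]
      fin_cases i <;> simp [pt, coords, lin_apply, diagGE, diagGF] <;> field_simp <;> ring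
  · refine ⟨.gfd, rfl, fun
      | .D => diagGF a y / (a + 1)
      | .F => lin (a ^ 3 + 4 * a ^ 2 + 6 * a + 3) (2 * a ^ 3 + 9 * a ^ 2 + 14 * a + 8)
        (a ^ 2 + 3 * a + 2) y / (a + 1)
      | .G => lin (a ^ 2 + 3 * a + 3) (2 * a ^ 2 + 7 * a + 7) (a + 2) y
      | _ => 0, ⟨?_, ?_⟩, ?_⟩
    · intro l
      cases l <;> simp only [le_refl] <;> positivity
    · intro l hl
      cases l <;> simp [triCell] at hl ⊢
    · ext i
      rw [sum_pt_apply, sum_label]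
      fin_cases i <;> simp [pt, coords, lin_apply, diagGF] <;> field_simp <;> ring

/-- A point at which the form of a polygon is minimal belongs to the cone over the polygon. -/
theorem exists_weight_of_le {a : ℕ} {n : Tile} {y : Space}
    (h : ∀ d n', tileForm a n y ≤ tileForm a n' (act (per a d) y)) :
    ∃ τ, triTile τ = n ∧ ∃ w, IsWeight τ w ∧ y = ∑ l, w l • pt a l := by
  obtain ⟨h1, h2, h3⟩ := cast_add_ne a
  have h0 : ∀ n', tileForm a n y ≤ tileForm a n' y := fun n' => by
    have := h 0 n'
    rwa [act_per_zero] at this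
  cases n
  -- Of all competitors only the neighbours across AB, AG and BG are needed. Their edge forms are,
  -- up to scale, the coordinates at G, B and A.
  · have eG := nonneg_of_eq_add_mul (cdf_X_eq a y) (by positivity) (h _ _)
    have eB := nonneg_of_eq_add_mul (pent_Y_eq a y) (by positivity) (h _ _)
    have eA : 0 ≤ y 0 := by have := pent_eq a y; have := h0 .pent; linarith
    refine ⟨.abg, rfl, fun
      | .A => y 0
      | .B => lin (a ^ 2 + 2 * a + 2) (2 * a ^ 2 + 5 * a + 4) (a + 1) y / (a + 1)
      | .G => lin (-(2 * a + 3)) (-1) 0 y / (a + 1)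
      | _ => 0, ⟨?_, ?_⟩, ?_⟩
    · intro l
      cases l <;> simp only [le_refl] <;> positivity
    · intro l hl
      cases l <;> simp [triCell] at hl ⊢
    · ext i
      rw [sum_pt_apply, sum_label]
      fin_cases i <;> simp [pt, coords, lin_apply] <;> field_simp <;> ring
  · have eBE := nonneg_of_eq_add_mul (abg_Yinv_eq a y) (by positivity) (h _ _)
    have eEF := nonneg_of_eq_add_mul (efc_eq a y) (by positivity) (h0 _)
    have eFD := nonneg_of_eq_add_mul (cdf_eq a y) (by positivity) (h0 _)
    have eDG := nonneg_of_eq_add_mul (efc_Y_eq a y) (by positivity) (h _ _)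
    have eGB : 0 ≤ -y 0 := by have := pent_eq a y; have := h0 .abg; linarith
    exact exists_weight_pentagon eBE eEF eFD eDG eGB
  · have eE := nonneg_of_eq_add_mul (cdf_eq_efc a y) (by positivity) (h0 _)
    have eF := nonneg_of_eq_add_mul (pent_Yinv_eq a y) (by positivity) (h _ _)
    have eC : 0 ≤ -lin 1 2 1 y := nonneg_of_eq_add_mul (u := tileForm a .efc y)
      (κ := 1 / (a + 3)) (by have := efc_eq a y; linarith) (by positivity) (h0 .pent)
    refine ⟨.efc, rfl, fun
      | .E => lin (a ^ 2 + 5 * a + 7) (2 * a ^ 2 + 11 * a + 17) (a + 4) y / (a + 3)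
      | .F => lin (-(a + 2)) (-(2 * a + 4)) 1 y / (a + 3)
      | .C => -lin 1 2 1 y / (a + 3)
      | _ => 0, ⟨?_, ?_⟩, ?_⟩
    · intro l
      cases l <;> simp only [le_refl] <;> positivity
    · intro l hl
      cases l <;> simp [triCell] at hl ⊢
    · ext i
      rw [sum_pt_apply, sum_label]
      fin_cases i <;> simp [pt, coords, lin_apply] <;> field_simp <;> ring
  · have eF := nonneg_of_eq_add_mul (abg_Xinv_eq a y) (by positivity) (h _ _)
    have eD : 0 ≤ -lin (a ^ 2 + 5 * a + 7) (2 * a ^ 2 + 11 * a + 17) (a + 4) y :=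
      nonneg_of_eq_add_mul (u := tileForm a .cdf y) (κ := (a + 1) / (2 * (a + 3)))
        (by have := cdf_eq_efc a y; linarith) (by positivity) (h0 .efc)
    have eC : 0 ≤ -lin (a ^ 2 + 3 * a + 3) (2 * a ^ 2 + 7 * a + 7) (a + 2) y :=
      nonneg_of_eq_add_mul (u := tileForm a .cdf y) (κ := 1 / 2)
        (by have := cdf_eq a y; linarith) (by positivity) (h0 .pent)
    refine ⟨.cdf, rfl, fun
      | .C => -lin (a ^ 2 + 3 * a + 3) (2 * a ^ 2 + 7 * a + 7) (a + 2) y / 2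
      | .D => -lin (a ^ 2 + 5 * a + 7) (2 * a ^ 2 + 11 * a + 17) (a + 4) y / (2 * (a + 1))
      | .F => lin (2 * a ^ 3 + 11 * a ^ 2 + 21 * a + 15) (4 * a ^ 3 + 24 * a ^ 2 + 49 * a + 37)
        (2 * a ^ 2 + 9 * a + 10) y / (2 * (a + 1))
      | _ => 0, ⟨?_, ?_⟩, ?_⟩
    · intro l
      cases l <;> simp only [le_refl] <;> positivity
    · intro l hl
      cases l <;> simp [triCell] at hl ⊢
    · ext i
      rw [sum_pt_apply, sum_label]
      fin_cases i <;> simp [pt, coords, lin_apply] <;> field_simp <;> ring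

theorem tileForm_sum {a : ℕ} {τ : Tri} {w : Label → ℝ} (hw : IsWeight τ w) :
    tileForm a (triTile τ) (∑ l, w l • pt a l) = ∑ l, w l := by
  rw [map_sum]
  refine Finset.sum_congr rfl fun l _ => ?_
  rw [map_smul, smul_eq_mul]
  by_cases hl : l ∈ triCell τ
  · rw [tileForm_pt a _ (triCell_subset τ hl), mul_one]
  · rw [hw.supp l hl, zero_mul]

/-- There are no nonzero integer points below a polygon. -/
theorem one_le_sum_weight {a : ℕ} {τ : Tri} {w : Label → ℝ} (hw : IsWeight τ w)
    {z : Fin 3 → ℤ} (hz : z ≠ 0) (h : intPt z = ∑ l, w l • pt a l) : 1 ≤ ∑ l, w l := by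
  have hn : 0 ≤ ∑ l, w l := Finset.sum_nonneg fun l _ => hw.nonneg l
  have hpos : 0 < ∑ l, w l := by
    refine lt_of_le_of_ne hn fun h0 => hz ?_
    have hz0 := (Finset.sum_eq_zero_iff_of_nonneg fun l _ => hw.nonneg l).1 h0.symm
    have : intPt z = intPt 0 := by
      rw [h]
      ext i
      simp [intPt, hz0]
    exact intPt_injective this
  have hpt := tileForm_sum (a := a) hw
  rw [← h] at hpt
  have ne : ∀ n : ℤ, (0 : ℝ) < n → (1 : ℝ) ≤ n := fun n h => by
    have : (0 : ℤ) < n := by exact_mod_cast h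
    exact_mod_cast this
  have c0 := congrFun h 0
  have c1 := congrFun h 1
  have c2 := congrFun h 2
  rw [sum_pt_apply, sum_label] at c0 c1 c2
  rw [sum_label] at hpos ⊢
  cases τ
  -- The form has integer coefficients, so its positive value at an integer point is at least 1. The
  -- pentagon's triangles, treated last, work in the same way.
  case abg =>
    have e : ((a * z 0 + (2 * a + 3) * z 1 + z 2 : ℤ) : ℝ) = ∑ l, w l := by
      rw [← hpt]; simp [triTile, tileForm, lin_apply, intPt]
    rw [← sum_label, ← e] at hpos ⊢
    exact ne _ hpos
  -- The form has denominator a + 3, so its integrality is not available. Instead -z₀ - 2z₁ equals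
  -- the sum of the weights at C and F; if the total is below 1 this integer is 0, leaving a
  -- multiple of E whose second coordinate is its weight.
  case efc =>
    have sA := hw.supp .A (by decide)
    have sB := hw.supp .B (by decide)
    have sD := hw.supp .D (by decide)
    have sG := hw.supp .G (by decide)
    have nE := hw.nonneg .E
    have nF := hw.nonneg .F
    have nC := hw.nonneg .C
    simp [sA, sB, sD, sG, pt, coords, intPt] at c0 c1 c2 hpos ⊢
    by_contra hlt
    have k1 : ((-z 0 - 2 * z 1 : ℤ) : ℝ) = w .C + w .F := by push_cast; rw [c0, c1]; ring
    have k2 : -z 0 - 2 * z 1 ≤ 0 := by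
      by_contra hc
      have := ne (-z 0 - 2 * z 1) (by exact_mod_cast not_le.1 hc)
      linarith
    have k3 : w .C + w .F ≤ 0 := by rw [← k1]; exact_mod_cast k2
    have wC : w .C = 0 := by linarith
    have wF : w .F = 0 := by linarith
    rw [wC, wF] at c1 hpos
    have := ne (z 1) (by rw [c1]; linarith)
    linarith
  -- Two integers, twice the weight at C and the sum of the weights at D and F, leave C/2 as the
  -- only candidate below the triangle. Its second coordinate (2a + 5)/2 is not an integer.
  case cdf =>
    have sA := hw.supp .A (by decide)
    have sB := hw.supp .B (by decide)
    have sE := hw.supp .E (by decide)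
    have sG := hw.supp .G (by decide)
    have nD := hw.nonneg .D
    have nF := hw.nonneg .F
    have nC := hw.nonneg .C
    simp [sA, sB, sE, sG, pt, coords, intPt] at c0 c1 c2 hpos ⊢
    by_contra hlt
    set k : ℤ := -((a ^ 2 + 3 * a + 3) * z 0 + (2 * a ^ 2 + 7 * a + 7) * z 1 + (a + 2) * z 2) with hk
    have k1 : (k : ℝ) = 2 * w .C := by rw [hk]; push_cast; rw [c0, c1, c2]; ring
    obtain ⟨j, hj⟩ : ∃ j : ℤ, j = (a + 1) * z 0 + (2 * a + 3) * z 1 + z 2 - k := ⟨_, rfl⟩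
    have k2 : (j : ℝ) = w .D + w .F := by
      rw [hj]; push_cast; rw [k1, c0, c1, c2]; ring
    have k3 : j ≤ 0 := by
      by_contra hc
      have := ne j (by exact_mod_cast not_le.1 hc)
      linarith
    have k4 : w .D + w .F ≤ 0 := by rw [← k2]; exact_mod_cast k3
    have wD : w .D = 0 := by linarith
    have wF : w .F = 0 := by linarith
    rw [wF] at c1 hpos
    rw [wD] at hpos
    have k5 : k < 2 := by
      have : (k : ℝ) < 2 := by rw [k1]; linarith
      exact_mod_cast this
    have k6 : 0 < k := by
      have : (0 : ℝ) < k := by rw [k1]; linarith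
      exact_mod_cast this
    have k7 : k = 1 := by omega
    have k8 : 2 * z 1 = 2 * a + 5 := by
      have : (2 * z 1 : ℝ) = 2 * a + 5 := by
        rw [k7] at k1
        push_cast at k1
        rw [c1]
        linear_combination (-(2 * a + 5) : ℝ) * k1
      exact_mod_cast this
    omega
  all_goals
    have e : (((a + 1) * z 0 + (2 * a + 3) * z 1 + z 2 : ℤ) : ℝ) = ∑ l, w l := by
      rw [← hpt]; simp [triTile, tileForm, lin_apply, intPt]
    rw [← sum_label, ← e] at hpos ⊢
    exact ne _ hpos

namespace Roots

variable {a : ℕ} {t : Fin 3 → ℝ} (ht : Roots a t)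
include ht

/-- The forms of the polygons are positive combinations of the eigenforms. -/
theorem tileForm_eq (n : Tile) : ∃ w : Fin 3 → ℝ, (∀ k, 0 < w k) ∧
    ∀ x, tileForm a n x = ∑ k, w k * ell a (t k) x := by
  have ha : (0 : ℝ) ≤ a := Nat.cast_nonneg a
  have r0 := ht.root 0
  have r1 := ht.root 1
  have l0 := ht.lo0
  have u0 := ht.hi0
  have l1 := ht.lo1
  have u1 := ht.hi1
  have l2 := ht.lo2
  have p0 : 0 < t 0 ^ 2 := by nlinarith
  have p1 : 0 < t 1 ^ 2 := by nlinarith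
  have p2 : 0 < t 2 ^ 2 := by nlinarith
  cases n
  -- Reduced modulo the cubic, the values at the right eigenvectors become products whose signs can
  -- be read off from the location of the roots.
  · have e : ∀ k, tileForm a .abg (eigvec (t k)) = t k ^ 2 * (t k + 1) := fun k => by
      simp [tileForm, lin_apply, eigvec]; linear_combination -ht.root k
    apply ht.form_eq <;> rw [e]
    · exact mul_neg_of_pos_of_neg p0 (by linarith)
    · exact mul_pos p1 (by linarith)
    · exact mul_pos p2 (by linarith)
  · have e : ∀ k, tileForm a .pent (eigvec (t k)) = t k ^ 2 * (t k + 2) := fun k => by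
      simp [tileForm, lin_apply, eigvec]; linear_combination -ht.root k
    apply ht.form_eq <;> rw [e]
    · exact mul_neg_of_pos_of_neg p0 (by linarith)
    · exact mul_pos p1 (by linarith)
    · exact mul_pos p2 (by linarith)
  · have e : ∀ k, tileForm a .efc (eigvec (t k)) =
        t k * ((a + 4) * t k ^ 2 + (a + 8) * t k - (2 * a + 1)) / (a + 3) := fun k => by
      obtain ⟨h1, h2, h3⟩ := cast_add_ne a
      simp [tileForm, lin_apply, eigvec]; field_simp; linear_combination (-(a + 4) : ℝ) * ht.root k
    have h3 : (0 : ℝ) < a + 3 := by positivity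
    apply ht.form_eq
    · rw [e]
      refine div_neg_of_neg_of_pos (mul_neg_of_neg_of_pos (by linarith) ?_) h3
      -- The quadratic factor has no sign independent of `a` until the cubic is used: with t₀ = -2 -
      -- u and 0 < u < 1 it becomes u(a + 3 - u - u²).
      obtain ⟨u, hu⟩ : ∃ u, u = -(t 0 + 2) := ⟨_, rfl⟩
      have hu0 : 0 < u := by linarith
      have hu1 : u < 1 := by linarith
      have e0 : t 0 = -2 - u := by rw [hu]; ring
      rw [e0] at r0 ⊢
      have : (a + 4) * (-2 - u) ^ 2 + (a + 8) * (-2 - u) - (2 * a + 1) = u * (a + 3 - u - u ^ 2) := by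
        linear_combination -r0
      rw [this]
      exact mul_pos hu0 (by nlinarith)
    · rw [e]
      exact div_pos (mul_pos_of_neg_of_neg u1 (by nlinarith)) h3
    · simp only [tileForm, lin_apply, eigvec]
      simp
      positivity
  · have e : ∀ k, tileForm a .cdf (eigvec (t k)) = t k ^ 2 * ((t k + 2) * (t k + 3)) / 2 :=
      fun k => by
        simp [tileForm, lin_apply, eigvec]
        linear_combination (-(a + 4) / 2 - t k / 2 : ℝ) * ht.root k
    apply ht.form_eq <;> rw [e]
    · exact div_neg_of_neg_of_pos (mul_neg_of_pos_of_neg p0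
        (mul_neg_of_neg_of_pos (by linarith) (by linarith))) two_pos
    · exact div_pos (mul_pos p1 (mul_pos (by linarith) (by linarith))) two_pos
    · exact div_pos (mul_pos p2 (mul_pos (by linarith) (by linarith))) two_pos

end Roots
end SailTorus

/-! ### The polyhedron cut out by the translated forms, and the hull -/

namespace SailTorus

/-- The open cone on which the eigenforms are positive. -/
def cone (a : ℕ) (t : Fin 3 → ℝ) : Set Space := {x | ∀ k, 0 < ell a (t k) x}

theorem convex_cone (a : ℕ) (t : Fin 3 → ℝ) : Convex ℝ (cone a t) := by
  have : cone a t = ⋂ k, {x | 0 < ell a (t k) x} := by ext x; simp [cone]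
  rw [this]
  exact convex_iInter fun k => convex_halfSpace_gt (ell a (t k)).toLinearMap.isLinear 0

theorem isOpen_cone (a : ℕ) (t : Fin 3 → ℝ) : IsOpen (cone a t) := by
  have : cone a t = ⋂ k, {x | 0 < ell a (t k) x} := by ext x; simp [cone]
  rw [this]
  exact isOpen_iInter_of_finite fun k => isOpen_lt continuous_const (ell a (t k)).continuous

theorem smul_mem_cone {a : ℕ} {t : Fin 3 → ℝ} {x : Space} (hx : x ∈ cone a t) {c : ℝ}
    (hc : 0 < c) : c • x ∈ cone a t := fun k => by
  rw [map_smul, smul_eq_mul]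
  exact mul_pos hc (hx k)

theorem add_mem_cone {a : ℕ} {t : Fin 3 → ℝ} {x y : Space} (hx : x ∈ cone a t)
    (hy : y ∈ cone a t) : x + y ∈ cone a t := fun k => by
  rw [map_add]
  exact add_pos (hx k) (hy k)

/-- The form of a translate of a polygon. -/
noncomputable def faceForm (a : ℕ) (d : ℤ × ℤ) (n : Tile) : Space →L[ℝ] ℝ :=
  (tileForm a n).comp (actL (per a d))

theorem faceForm_apply (a : ℕ) (d : ℤ × ℤ) (n : Tile) (x : Space) :
    faceForm a d n x = tileForm a n (act (per a d) x) := by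
  simp [faceForm, actL_apply]

theorem faceForm_zero (a : ℕ) (n : Tile) (x : Space) : faceForm a 0 n x = tileForm a n x := by
  rw [faceForm_apply, act_per_zero]

theorem faceForm_act (a : ℕ) (d d' : ℤ × ℤ) (n : Tile) (x : Space) :
    faceForm a d n (act (per a d') x) = faceForm a (d + d') n x := by
  rw [faceForm_apply, faceForm_apply, act_per_add]

/-- The intersection of the cone with the half-spaces defined by the polygons. -/
def polyhedron (a : ℕ) (t : Fin 3 → ℝ) : Set Space :=
  {x | x ∈ cone a t ∧ ∀ d n, 1 ≤ faceForm a d n x}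

theorem convex_polyhedron (a : ℕ) (t : Fin 3 → ℝ) : Convex ℝ (polyhedron a t) := by
  have : polyhedron a t = cone a t ∩ ⋂ d, ⋂ n, {x | 1 ≤ faceForm a d n x} := by
    ext x; simp [polyhedron]
  rw [this]
  exact (convex_cone a t).inter (convex_iInter fun d => convex_iInter fun n =>
    convex_halfSpace_ge (faceForm a d n).toLinearMap.isLinear 1)

/-- Positive vectors whose coordinates have product at least one form a convex set. -/
theorem one_le_prod_of_convex {p q : Fin 3 → ℝ} (hp : ∀ k, 0 < p k) (hq : ∀ k, 0 < q k)
    (hp1 : 1 ≤ p 0 * p 1 * p 2) (hq1 : 1 ≤ q 0 * q 1 * q 2) {α β : ℝ} (hα : 0 ≤ α) (hβ : 0 ≤ β)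
    (hαβ : α + β = 1) :
    1 ≤ (α * p 0 + β * q 0) * (α * p 1 + β * q 1) * (α * p 2 + β * q 2) := by
  -- The weighted inequality of arithmetic and geometric means in each coordinate, then multiplied
  -- over the three coordinates.
  have key : ∀ k, p k ^ α * q k ^ β ≤ α * p k + β * q k := fun k =>
    Real.geom_mean_le_arith_mean2_weighted hα hβ (hp k).le (hq k).le hαβ
  have pos : ∀ k, 0 ≤ p k ^ α * q k ^ β := fun k =>
    mul_nonneg (Real.rpow_nonneg (hp k).le _) (Real.rpow_nonneg (hq k).le _)
  have e : (p 0 ^ α * q 0 ^ β) * (p 1 ^ α * q 1 ^ β) * (p 2 ^ α * q 2 ^ β) =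
      (p 0 * p 1 * p 2) ^ α * (q 0 * q 1 * q 2) ^ β := by
    rw [Real.mul_rpow (mul_pos (hp 0) (hp 1)).le (hp 2).le, Real.mul_rpow (hp 0).le (hp 1).le,
      Real.mul_rpow (mul_pos (hq 0) (hq 1)).le (hq 2).le, Real.mul_rpow (hq 0).le (hq 1).le]
    ring
  calc (1 : ℝ) ≤ (p 0 * p 1 * p 2) ^ α * (q 0 * q 1 * q 2) ^ β :=
        one_le_mul_of_one_le_of_one_le (Real.one_le_rpow hp1 hα) (Real.one_le_rpow hq1 hβ)
    _ = _ := e.symm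
    _ ≤ _ := mul_le_mul (mul_le_mul (key 0) (key 1) (pos 1) ((pos 0).trans (key 0))) (key 2)
        (pos 2) (mul_nonneg ((pos 0).trans (key 0)) ((pos 1).trans (key 1)))

/-- A closed substitute for the open cone: the bound on the product keeps limits away from the
invariant planes. -/
theorem isClosed_normSet (a : ℕ) (t : Fin 3 → ℝ) : IsClosed {x : Space |
    (∀ k, 0 ≤ ell a (t k) x) ∧
      1 ≤ ell a (t 0) x * ell a (t 1) x * ell a (t 2) x} := by
  have e : {x : Space | (∀ k, 0 ≤ ell a (t k) x) ∧
      1 ≤ ell a (t 0) x * ell a (t 1) x * ell a (t 2) x} = (⋂ k, {x | 0 ≤ ell a (t k) x}) ∩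
      {x | 1 ≤ ell a (t 0) x * ell a (t 1) x * ell a (t 2) x} := by ext x; simp
  rw [e]
  exact (isClosed_iInter fun k => isClosed_le continuous_const (ell a (t k)).continuous).inter
    (isClosed_le continuous_const (by fun_prop))

namespace Roots

variable {a : ℕ} {t : Fin 3 → ℝ} (ht : Roots a t)
include ht

theorem ell_act_per_pos_iff (d : ℤ × ℤ) (k : Fin 3) (x : Space) :
    0 < ell a (t k) (act (per a d) x) ↔ 0 < ell a (t k) x := by
  rw [ht.ell_per]
  exact mul_pos_iff_of_pos_left (ht.mult_pos k d)

theorem act_mem_cone {x : Space} (d : ℤ × ℤ) (hx : x ∈ cone a t) : act (per a d) x ∈ cone a t :=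
  fun k => (ht.ell_act_per_pos_iff d k x).2 (hx k)

/-- Periods preserve the cone, so B, E and F suffice. At E the eigenform is (t + 1)/(t + 2). At F
every term is nonnegative for negative t, and for t₂ the sign comes from t² + 2t - 1 after clearing
a positive factor. -/
theorem pt_mem_cone (l : Label) : pt a l ∈ cone a t := by
  have ha : (0 : ℝ) ≤ a := Nat.cast_nonneg a
  have hB : pt a .B ∈ cone a t := fun k => by rw [ell_base]; exact one_pos
  have hE : pt a .E ∈ cone a t := by
    intro k
    have e : ell a (t k) (pt a .E) * (t k + 2) ^ 2 = (t k + 1) * (t k + 2) := by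
      rw [ell_apply]; simp [pt, coords]
      linear_combination (t k + 2) * ht.root k
    have e' : 0 < (t k + 1) * (t k + 2) := by
      fin_cases k
      · have := ht.hi0
        exact mul_pos_of_neg_of_neg (by change t 0 + 1 < 0; linarith)
          (by change t 0 + 2 < 0; linarith)
      · have := ht.lo1
        exact mul_pos (by change 0 < t 1 + 1; linarith) (by change 0 < t 1 + 2; linarith)
      · have := ht.lo2
        exact mul_pos (by change 0 < t 2 + 1; linarith) (by change 0 < t 2 + 2; linarith)
    rw [← e] at e'
    exact pos_of_mul_pos_left e' (sq_nonneg _)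
  have hF : pt a .F ∈ cone a t := by
    have e : ∀ k, ell a (t k) (pt a .F) = (a + 1) * t k ^ 2 - (a ^ 2 + 2 * a + 2) * t k + 1 := by
      intro k
      rw [ell_apply]; simp [pt, coords]; ring
    intro k
    fin_cases k
    · have := ht.hi0
      change 0 < ell a (t 0) (pt a .F)
      rw [e]
      have : 0 ≤ (a ^ 2 + 2 * a + 2) * -t 0 := mul_nonneg (by positivity) (by linarith)
      have : 0 ≤ (a + 1) * t 0 ^ 2 := by positivity
      linarith
    · have := ht.hi1
      change 0 < ell a (t 1) (pt a .F)
      rw [e]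
      have : 0 ≤ (a ^ 2 + 2 * a + 2) * -t 1 := mul_nonneg (by positivity) (by linarith)
      have : 0 ≤ (a + 1) * t 1 ^ 2 := by positivity
      linarith
    · have := ht.lo2
      change 0 < ell a (t 2) (pt a .F)
      have e' : ell a (t 2) (pt a .F) * (t 2 * (t 2 + 2) ^ 2) = t 2 ^ 2 + 2 * t 2 - 1 := by
        rw [e]
        linear_combination ((a + 1) * t 2 ^ 2 + (2 * a + 1) * t 2 - 1) * ht.root 2
      have e'' : 0 < t 2 ^ 2 + 2 * t 2 - 1 := by nlinarith
      rw [← e'] at e''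
      exact pos_of_mul_pos_left e'' (by positivity)
  rw [pt_eq_act]
  apply ht.act_mem_cone
  cases l <;> first | exact hB | exact hE | exact hF

theorem eq_zero_of_act_per_eq' {d : ℤ × ℤ} {x : Space} (hx : x ∈ cone a t)
    (h : act (per a d) x = x) : d = 0 :=
  ht.eq_zero_of_act_per_eq (fun k => (hx k).ne') h

theorem per_injective {d d' : ℤ × ℤ} (h : per a d = per a d') : d = d' := by
  have h1 : act (per a (d - d')) (pt a .B) = pt a .B := by
    rw [sub_eq_add_neg, per_add, h, ← per_add, add_neg_cancel, act_per_zero]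
  exact sub_eq_zero.1 (ht.eq_zero_of_act_per_eq' (ht.pt_mem_cone .B) h1)

theorem norm_pt (l : Label) :
    ell a (t 0) (pt a l) * ell a (t 1) (pt a l) * ell a (t 2) (pt a l) =
      (normZ a (coords a (rep l)) : ℝ) := by
  rw [← ht.prod_ell_intPt, ← pt_eq_intPt, pt_eq_act a l, ht.ell_per, ht.ell_per, ht.ell_per]
  linear_combination (ell a (t 0) (pt a (rep l)) * ell a (t 1) (pt a (rep l)) *
    ell a (t 2) (pt a (rep l))) * ht.prod_mult (shift l)

/-- Labels of equivalent points. -/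
theorem act_pt_eq_iff (d : ℤ × ℤ) (l l' : Label) :
    act (per a d) (pt a l) = pt a l' ↔ rep l = rep l' ∧ d + shift l = shift l' := by
  constructor
  · intro h
    have hr : rep l = rep l' := by
      -- The norm separates the orbits. Within an orbit the shift is determined, because no
      -- nontrivial period fixes a point of the cone.
      apply rep_injective_of_norm (a := a)
      have h1 := ht.norm_pt l'
      rw [← h, ht.ell_per, ht.ell_per, ht.ell_per] at h1
      have : (normZ a (coords a (rep l)) : ℝ) = normZ a (coords a (rep l')) := by
        rw [← h1, ← ht.norm_pt l]
        linear_combination -(ell a (t 0) (pt a l) * ell a (t 1) (pt a l) *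
          ell a (t 2) (pt a l)) * ht.prod_mult d
      exact_mod_cast this
    refine ⟨hr, ?_⟩
    rw [pt_eq_act a l, pt_eq_act a l', ← act_per_add, hr] at h
    have h1 : act (per a (d + shift l - shift l')) (pt a (rep l')) = pt a (rep l') := by
      rw [sub_eq_neg_add, act_per_add, h, act_per_neg_act]
    exact sub_eq_zero.1 (ht.eq_zero_of_act_per_eq' (ht.pt_mem_cone _) h1)
  · rintro ⟨hr, hs⟩
    rw [pt_eq_act a l, pt_eq_act a l', ← act_per_add, hs, hr]

theorem pt_injective : Function.Injective (pt a) := by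
  intro l l' h
  have := (ht.act_pt_eq_iff 0 l l').1 (by rw [act_per_zero, h])
  revert this
  cases l <;> cases l' <;> decide

theorem faceForm_pos (d : ℤ × ℤ) (n : Tile) {x : Space} (hx : x ∈ cone a t) :
    0 < faceForm a d n x := by
  obtain ⟨w, hw, e⟩ := ht.tileForm_eq n
  rw [faceForm_apply, e]
  exact Finset.sum_pos (fun k _ => mul_pos (hw k) (ht.act_mem_cone d hx k)) Finset.univ_nonempty

/-- Distinct periods send B to distinct integer points with positive eigencoordinates, and a bounded
region contains finitely many of these. This is the discreteness used for local finiteness and for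
the Hausdorff property. -/
theorem finite_mult_le (C : ℝ) :
    {d : ℤ × ℤ | ∀ k, ell a (t k) (act (per a d) (pt a .B)) ≤ C}.Finite := by
  have hinj : Function.Injective fun d => act (per a d) (pt a .B) := by
    intro d d' h
    exact ht.per_injective (ht.eq_of_act_base (commute_per_opM a d) (commute_per_opM a d') h)
  refine ((ht.finite_integer_points C).preimage hinj.injOn).subset ?_
  intro d hd
  refine ⟨IsIntegerPoint.act ((isIntegerPoint_iff _).2 ⟨_, pt_eq_intPt a .B⟩) _, fun k => ?_⟩
  rw [abs_of_pos (ht.act_mem_cone d (ht.pt_mem_cone .B) k)]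
  exact hd k

/-- Each form is a positive combination of the eigenforms, so a bound on its value at the translate
of x bounds each eigenvalue of the period. -/
theorem finite_faceForm_le {x : Space} (hx : x ∈ cone a t) (C : ℝ) :
    {p : (ℤ × ℤ) × Tile | faceForm a p.1 p.2 x ≤ C}.Finite := by
  have h : ∀ n, {d | faceForm a d n x ≤ C}.Finite := by
    intro n
    obtain ⟨w, hw, e⟩ := ht.tileForm_eq n
    refine (ht.finite_mult_le (∑ k, |C| / (w k * ell a (t k) x))).subset ?_
    intro d hd k
    have pos : ∀ j, 0 < w j * ell a (t j) x := fun j => mul_pos (hw j) (hx j)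
    have h1 : w k * ell a (t k) (act (per a d) x) ≤ C := by
      have hd' : faceForm a d n x ≤ C := hd
      rw [faceForm_apply, e] at hd'
      exact (Finset.single_le_sum (f := fun j => w j * ell a (t j) (act (per a d) x))
        (fun j _ => (mul_pos (hw j) (ht.act_mem_cone d hx j)).le) (Finset.mem_univ k)).trans hd'
    rw [ht.ell_act (commute_per_opM a d)] at h1
    have h2 : ell a (t k) (act (per a d) (pt a .B)) ≤ |C| / (w k * ell a (t k) x) := by
      rw [le_div_iff₀ (pos k)]
      have := le_abs_self C
      linarith
    exact h2.trans (Finset.single_le_sum (f := fun j => |C| / (w j * ell a (t j) x))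
      (fun j _ => div_nonneg (abs_nonneg C) (pos j).le) (Finset.mem_univ k))
  refine ((Set.finite_iUnion h).prod (Set.finite_univ (α := Tile))).subset ?_
  rintro ⟨d, n⟩ hp
  exact ⟨Set.mem_iUnion.2 ⟨n, hp⟩, trivial⟩

/-- Local finiteness makes the lower envelope of the infinite family attained; the minimising index
names a polygon whose cone contains the translated point. -/
theorem exists_faceForm_min {x : Space} (hx : x ∈ cone a t) :
    ∃ d n, ∀ d' n', faceForm a d n x ≤ faceForm a d' n' x := by
  obtain ⟨⟨d, n⟩, h1, h2⟩ := Set.exists_min_image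
    {p : (ℤ × ℤ) × Tile | faceForm a p.1 p.2 x ≤ faceForm a 0 .abg x}
    (fun p => faceForm a p.1 p.2 x) (ht.finite_faceForm_le hx _) ⟨(0, .abg), le_refl (faceForm a 0 .abg x)⟩
  refine ⟨d, n, fun d' n' => ?_⟩
  rcases le_total (faceForm a d' n' x) (faceForm a 0 .abg x) with h | h
  · exact h2 (d', n') h
  · exact le_trans h1 h

omit ht in
theorem exists_weight_of_min {x : Space} {d : ℤ × ℤ} {n : Tile}
    (h : ∀ d' n', faceForm a d n x ≤ faceForm a d' n' x) :
    ∃ τ, triTile τ = n ∧ ∃ w, IsWeight τ w ∧ act (per a d) x = ∑ l, w l • pt a l ∧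
      ∑ l, w l = faceForm a d n x := by
  obtain ⟨τ, hτ, w, hw, e⟩ := exists_weight_of_le (a := a) (n := n) (y := act (per a d) x)
    (fun d' n' => by
      rw [← faceForm_apply, ← act_per_add, ← faceForm_apply]
      exact h _ _)
  refine ⟨τ, hτ, w, hw, e, ?_⟩
  rw [faceForm_apply, ← hτ, e, tileForm_sum hw]

theorem isIntegerPoint_mem_polyhedron {x : Space} (hx : x ∈ cone a t) (hi : IsIntegerPoint x) :
    x ∈ polyhedron a t := by
  refine ⟨hx, fun d' n' => ?_⟩
  obtain ⟨d, n, h⟩ := ht.exists_faceForm_min hx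
  obtain ⟨τ, -, w, hw, e, hs⟩ := exists_weight_of_min h
  refine le_trans ?_ (h d' n')
  rw [← hs]
  obtain ⟨z, hz⟩ := (isIntegerPoint_iff _).1 (hi.act (per a d))
  refine one_le_sum_weight hw (z := z) ?_ (hz ▸ e)
  rintro rfl
  have := ht.act_mem_cone d hx 0
  rw [hz] at this
  have h0 : intPt 0 = 0 := by ext i; simp [intPt]
  rw [h0, map_zero] at this
  exact lt_irrefl _ this

omit ht in
theorem isIntegerPoint_pt (l : Label) : IsIntegerPoint (pt a l) :=
  (isIntegerPoint_iff _).2 ⟨_, pt_eq_intPt a l⟩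

theorem pt_mem_polyhedron (l : Label) : pt a l ∈ polyhedron a t :=
  ht.isIntegerPoint_mem_polyhedron (ht.pt_mem_cone l) (isIntegerPoint_pt l)

/-- Integer points satisfy the inequalities since the smallest form is a total weight, bounded by
`one_le_sum_weight`. Conversely, a point of total weight σ ≥ 1 is a convex combination of points σv
with v a translated vertex, and σv lies between the integer points v and mv for a large integer m.
-/
theorem convexHull_eq_polyhedron :
    convexHull ℝ {x | x ∈ cone a t ∧ IsIntegerPoint x} = polyhedron a t := by
  apply Set.Subset.antisymm
  · exact convexHull_min (fun x hx => ht.isIntegerPoint_mem_polyhedron hx.1 hx.2)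
      (convex_polyhedron a t)
  · intro x hx
    set S := {x | x ∈ cone a t ∧ IsIntegerPoint x} with hS
    obtain ⟨d, n, h⟩ := ht.exists_faceForm_min hx.1
    obtain ⟨τ, -, w, hw, e, hs⟩ := exists_weight_of_min h
    set σ := ∑ l, w l with hσ
    have hσ1 : 1 ≤ σ := by rw [hs]; exact hx.2 d n
    have hv : ∀ l, σ • act (per a (-d)) (pt a l) ∈ convexHull ℝ S := by
      intro l
      set v := act (per a (-d)) (pt a l) with hv
      have hvS : v ∈ S := ⟨ht.act_mem_cone _ (ht.pt_mem_cone l), (isIntegerPoint_pt l).act _⟩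
      -- The extra 1 forces m > 1 even when σ = 1, so that division by m - 1 is allowed.
      have hk : σ ≤ (⌈σ⌉₊ + 1 : ℕ) := (Nat.le_ceil σ).trans (by push_cast; linarith)
      set m := ⌈σ⌉₊ + 1
      have hm : (1 : ℝ) < m := by
        have : 1 < m := by
          have : 0 < ⌈σ⌉₊ := Nat.ceil_pos.2 (by linarith)
          omega
        exact_mod_cast this
      have hmS : (m : ℝ) • v ∈ S := by
        refine ⟨smul_mem_cone hvS.1 (by linarith), fun i => ?_⟩
        obtain ⟨z, hz⟩ := hvS.2 i
        exact ⟨m * z, by simp [hz]⟩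
      have := (convex_convexHull ℝ S) (subset_convexHull ℝ S hvS) (subset_convexHull ℝ S hmS)
        (a := (m - σ) / (m - 1)) (b := (σ - 1) / (m - 1))
        (div_nonneg (by linarith) (by linarith)) (div_nonneg (by linarith) (by linarith))
        (by rw [← add_div, div_eq_one_iff_eq (by linarith)]; ring)
      convert this using 1
      rw [smul_smul, ← add_smul]
      congr 1
      field_simp
      have : (m : ℝ) - 1 ≠ 0 := by linarith
      field_simp
      ring
    have hx' : x = ∑ l, (w l / σ) • (σ • act (per a (-d)) (pt a l)) := by
      rw [← act_per_neg_act a d x, e, act_sum]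
      refine Finset.sum_congr rfl fun l _ => ?_
      rw [smul_smul, div_mul_cancel₀ _ (by linarith)]
    rw [hx']
    refine (convex_convexHull ℝ S).sum_mem (fun l _ => div_nonneg (hw.nonneg l) (by linarith)) ?_
      fun l _ => hv l
    rw [← Finset.sum_div, ← hσ, div_self (by linarith)]

/-- The cone is open, so closedness is not formal. Integer points of the cone have norm at least 1,
being positive integers in norm; this condition is convex in the cone and so passes to their hull,
where it replaces strict positivity by a closed condition. -/
theorem isClosed_polyhedron : IsClosed (polyhedron a t) := by
  set N := {x : Space | (∀ k, 0 ≤ ell a (t k) x) ∧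
      1 ≤ ell a (t 0) x * ell a (t 1) x * ell a (t 2) x} with hN
  set N' := {x : Space | x ∈ cone a t ∧
      1 ≤ ell a (t 0) x * ell a (t 1) x * ell a (t 2) x} with hN'
  have hconv : Convex ℝ N' := by
    intro x hx y hy α β hα hβ hαβ
    refine ⟨convex_cone a t hx.1 hy.1 hα hβ hαβ, ?_⟩
    simp only [map_add, map_smul, smul_eq_mul]
    exact one_le_prod_of_convex (p := fun k => ell a (t k) x) (q := fun k => ell a (t k) y)
      hx.1 hy.1 hx.2 hy.2 hα hβ hαβ
  have hsub : polyhedron a t ⊆ N := by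
    rw [← ht.convexHull_eq_polyhedron]
    have : convexHull ℝ {x | x ∈ cone a t ∧ IsIntegerPoint x} ⊆ N' := by
      refine convexHull_min ?_ hconv
      rintro x ⟨hx, hi⟩
      refine ⟨hx, ?_⟩
      have hpos := mul_pos (mul_pos (hx 0) (hx 1)) (hx 2)
      obtain ⟨z, rfl⟩ := (isIntegerPoint_iff x).1 hi
      rw [ht.prod_ell_intPt] at hpos ⊢
      have : 0 < normZ a z := by exact_mod_cast hpos
      exact_mod_cast this
    exact fun x hx => ⟨fun k => ((this hx).1 k).le, (this hx).2⟩
  have e : polyhedron a t = N ∩ ⋂ d, ⋂ n, {x | 1 ≤ faceForm a d n x} := by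
    ext x
    constructor
    · intro hx
      exact ⟨hsub hx, by simpa using hx.2⟩
    · rintro ⟨⟨h1, h2⟩, h3⟩
      refine ⟨fun k => lt_of_le_of_ne (h1 k) fun h0 => ?_, by simpa using h3⟩
      fin_cases k <;> simp at h0 <;> simp [← h0] at h2 <;> linarith
  rw [e]
  exact (isClosed_normSet a t).inter (isClosed_iInter fun d => isClosed_iInter fun n =>
    isClosed_le continuous_const (faceForm a d n).continuous)

/-- If σ > 1 is the smallest form value, σ⁻¹x still satisfies every inequality, and adding vectors
of the cone only increases the forms. The open set σ⁻¹x + cone contains x. -/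
theorem mem_interior_polyhedron {x : Space} (hx : x ∈ polyhedron a t)
    (h : ∀ d n, 1 < faceForm a d n x) : x ∈ interior (polyhedron a t) := by
  obtain ⟨d, n, hmin⟩ := ht.exists_faceForm_min hx.1
  set σ := faceForm a d n x
  have hσ : 1 < σ := h d n
  have hσ0 : 0 < σ := by linarith
  rw [mem_interior]
  refine ⟨(fun y => y - σ⁻¹ • x) ⁻¹' cone a t, ?_, (isOpen_cone a t).preimage (by fun_prop), ?_⟩
  · intro y hy
    have hy' : y - σ⁻¹ • x ∈ cone a t := hy
    have ey : y = (y - σ⁻¹ • x) + σ⁻¹ • x := by simp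
    refine ⟨ey ▸ add_mem_cone hy' (smul_mem_cone hx.1 (inv_pos.2 hσ0)), fun d' n' => ?_⟩
    rw [ey, map_add, map_smul, smul_eq_mul]
    have h1 := ht.faceForm_pos d' n' hy'
    have h2 : 1 ≤ σ⁻¹ * faceForm a d' n' x := by
      rw [← inv_mul_cancel₀ hσ0.ne']
      exact mul_le_mul_of_nonneg_left (hmin d' n') (inv_pos.2 hσ0).le
    linarith
  · have : x - σ⁻¹ • x = (1 - σ⁻¹) • x := by rw [sub_smul, one_smul]
    change x - σ⁻¹ • x ∈ cone a t
    rw [this]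
    exact smul_mem_cone hx.1 (sub_pos.2 (inv_lt_one_of_one_lt₀ hσ))

omit ht in
theorem notMem_interior_polyhedron {x : Space} {d : ℤ × ℤ} {n : Tile}
    (h : faceForm a d n x = 1) : x ∉ interior (polyhedron a t) := by
  intro hx
  have hc : ContinuousAt (fun s : ℝ => s • x) 1 := by fun_prop
  have h1 : ∀ᶠ s in nhds (1 : ℝ), s • x ∈ polyhedron a t :=
    hc (by simpa using mem_interior_iff_mem_nhds.1 hx)
  obtain ⟨s, hs, hs1⟩ := ((h1.filter_mono nhdsWithin_le_nhds).and
    (self_mem_nhdsWithin (s := Set.Iio (1 : ℝ)))).exists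
  have := hs.2 d n
  rw [map_smul, smul_eq_mul, h, mul_one] at this
  exact absurd this (not_le.2 hs1)

theorem frontier_polyhedron :
    frontier (polyhedron a t) = {x | x ∈ polyhedron a t ∧ ∃ d n, faceForm a d n x = 1} := by
  rw [frontier, ht.isClosed_polyhedron.closure_eq]
  ext x
  constructor
  · rintro ⟨hx, hi⟩
    refine ⟨hx, ?_⟩
    by_contra hc
    push Not at hc
    exact hi (ht.mem_interior_polyhedron hx fun d n => lt_of_le_of_ne (hx.2 d n) (hc d n).symm)
  · rintro ⟨hx, d, n, h⟩
    exact ⟨hx, notMem_interior_polyhedron h⟩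

theorem act_mem_polyhedron {x : Space} (d : ℤ × ℤ) (hx : x ∈ polyhedron a t) :
    act (per a d) x ∈ polyhedron a t :=
  ⟨ht.act_mem_cone d hx.1, fun d' n => by rw [faceForm_act]; exact hx.2 _ _⟩

/-! ### The orthant -/

theorem eigenvector_spec {r : ℝ} {u : Space}
    (hu : Module.End.HasEigenvector (Matrix.toLin' (realMatrix (opM a))) r u) :
    ∃ k, r = (t k)⁻¹ ∧ ∀ j, j ≠ k → ell a (t j) u = 0 := by
  have h1 : act (opM a) u = r • u := by
    have := hu.apply_eq_smul
    simpa [act] using this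
  have h2 : ∀ k, (t k * r - 1) * ell a (t k) u = 0 := fun k => by
    have := ht.ell_opM k u
    rw [h1, map_smul, smul_eq_mul] at this
    linear_combination this
  obtain ⟨k, hk⟩ : ∃ k, ell a (t k) u ≠ 0 := by
    by_contra hc
    push Not at hc
    exact hu.2 (ht.eq_zero_of_ell hc)
  have hr : t k * r = 1 := by
    rcases mul_eq_zero.1 (h2 k) with h | h
    · linarith
    · exact absurd h hk
  refine ⟨k, eq_inv_of_mul_eq_one_right hr, fun j hj => ?_⟩
  rcases mul_eq_zero.1 (h2 j) with h | h
  · exfalso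
    have hr0 : r ≠ 0 := right_ne_zero_of_mul_eq_one hr
    have : t j = t k := mul_right_cancel₀ hr0 (by linarith)
    have h01 := ht.lt01
    have h12 := ht.lt12
    have h02 := ht.lt02
    fin_cases j <;> fin_cases k <;> simp at this hj <;> linarith
  · exact h

theorem hasEigenvector (k : Fin 3) : Module.End.HasEigenvector
    (Matrix.toLin' (realMatrix (opM a))) (t k)⁻¹ (eigvec (t k)) := by
  refine ⟨Module.End.mem_eigenspace_iff.2 ?_, fun h => ?_⟩
  · rw [← ht.act_opM_eigvec k]; simp [act]
  · have := congrFun h 2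
    simp [eigvec] at this

theorem realEigenvalues_eq : realEigenvalues (opM a) = Set.range fun k => (t k)⁻¹ := by
  ext r
  constructor
  · intro hr
    obtain ⟨u, hu⟩ := Module.End.HasEigenvalue.exists_hasEigenvector hr
    obtain ⟨k, hk, -⟩ := ht.eigenvector_spec hu
    exact ⟨k, hk.symm⟩
  · rintro ⟨k, rfl⟩
    exact Module.End.hasEigenvalue_of_hasEigenvector (ht.hasEigenvector k)

theorem injective : Function.Injective t := by
  intro j k h
  have h01 := ht.lt01
  have h12 := ht.lt12
  have h02 := ht.lt02
  fin_cases j <;> fin_cases k <;> simp at h ⊢ <;> linarith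

theorem ncard_realEigenvalues : (realEigenvalues (opM a)).ncard = 3 := by
  rw [ht.realEigenvalues_eq, ← Set.image_univ,
    Set.ncard_image_of_injective _ fun _ _ h => ht.injective (inv_injective h), Set.ncard_univ, Nat.card_fin]

/-- The eigenplanes are the kernels of the eigenforms: each eigenvector is killed by all eigenforms
but one, so two of them leave a common annihilator. -/
theorem compl_eigenplanes :
    {x | ∀ P ∈ eigenplanes (opM a), x ∉ P} = {x | ∀ k, ell a (t k) x ≠ 0} := by
  ext x
  constructor
  · intro h k h0
    obtain ⟨i, j, hij, hik, hjk⟩ : ∃ i j : Fin 3, i ≠ j ∧ i ≠ k ∧ j ≠ k := by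
      clear h0; revert k; decide
    refine h (Submodule.span ℝ {eigvec (t i), eigvec (t j)}) ⟨_, _, _, _, ht.hasEigenvector i,
      ht.hasEigenvector j, ?_, rfl⟩ ?_
    · rw [LinearIndependent.pair_iff]
      intro c c' hc
      have hi := congrArg (ell a (t i)) hc
      have hj := congrArg (ell a (t j)) hc
      rw [map_add, map_smul, map_smul, ht.ell_eigvec_ne hij, map_zero] at hi
      rw [map_add, map_smul, map_smul, ht.ell_eigvec_ne hij.symm, map_zero] at hj
      have ni := ht.ell_eigvec_self_ne i
      have nj := ht.ell_eigvec_self_ne j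
      simp [ni] at hi
      simp [nj] at hj
      exact ⟨hi, hj⟩
    · rw [Submodule.mem_span_pair]
      refine ⟨ell a (t i) x / ell a (t i) (eigvec (t i)),
        ell a (t j) x / ell a (t j) (eigvec (t j)), ?_⟩
      have huniv : (Finset.univ : Finset (Fin 3)) = {i, j, k} := by
        clear h0; revert i j k; decide
      conv_rhs => rw [ht.eq_sum_eigvec x]
      rw [huniv, Finset.sum_insert (by simp [hij, hik]), Finset.sum_insert (by simp [hjk]),
        Finset.sum_singleton, h0]
      simp
  · rintro h P ⟨u, v, r, s, hu, hv, -, rfl⟩ hx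
    obtain ⟨i, -, hi⟩ := ht.eigenvector_spec hu
    obtain ⟨j, -, hj⟩ := ht.eigenvector_spec hv
    obtain ⟨k, hki, hkj⟩ : ∃ k : Fin 3, k ≠ i ∧ k ≠ j := by
      clear hi hj; revert i j; decide
    obtain ⟨c, c', rfl⟩ := Submodule.mem_span_pair.1 hx
    apply h k
    rw [map_add, map_smul, map_smul, hi k hki, hj k hkj]
    simp

/-- On a connected set avoiding the kernels every eigenform keeps its sign, positive at B;
conversely the cone is convex, hence connected. -/
theorem orthant_eq : orthant (opM a) (pt a .B) = cone a t := by
  rw [orthant, ht.compl_eigenplanes]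
  apply Set.Subset.antisymm
  · intro y hy k
    have hpre : IsPreconnected
        (connectedComponentIn {x | ∀ k, ell a (t k) x ≠ 0} (pt a .B)) :=
      isPreconnected_connectedComponentIn
    have himg := hpre.image (ell a (t k)) (ell a (t k)).continuous.continuousOn
    have hB : pt a .B ∈ {x | ∀ k, ell a (t k) x ≠ 0} := fun k => (ht.pt_mem_cone .B k).ne'
    by_contra hc
    have h0 : (0 : ℝ) ∈ ell a (t k) ''
        connectedComponentIn {x | ∀ k, ell a (t k) x ≠ 0} (pt a .B) :=
      himg.Icc_subset ⟨y, hy, rfl⟩ ⟨_, mem_connectedComponentIn hB, rfl⟩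
        ⟨not_lt.1 hc, (ht.pt_mem_cone .B k).le⟩
    obtain ⟨x, hx, hx0⟩ := h0
    exact connectedComponentIn_subset _ _ hx k hx0
  · exact (convex_cone a t).isPreconnected.subset_connectedComponentIn (ht.pt_mem_cone .B)
      fun x hx k => (hx k).ne'

/-- Passing to the closed orthant adds no integer points: by irreducibility no nonzero integer point
lies on an invariant plane. -/
theorem hull_eq : hull (opM a) (pt a .B) = polyhedron a t := by
  rw [← ht.convexHull_eq_polyhedron, hull, ht.orthant_eq]
  congr 1
  ext x
  constructor
  · rintro ⟨h1, h2, h3⟩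
    refine ⟨fun k => ?_, h3⟩
    have h4 : 0 ≤ ell a (t k) x := by
      have : closure (cone a t) ⊆ {x | 0 ≤ ell a (t k) x} :=
        closure_minimal (fun y hy => (hy k).le)
          (isClosed_le continuous_const (ell a (t k)).continuous)
      exact this h1
    obtain ⟨z, rfl⟩ := (isIntegerPoint_iff x).1 h3
    refine lt_of_le_of_ne h4 (ht.ell_intPt_ne_zero k ?_).symm
    rintro rfl
    exact h2 (by ext i; simp [intPt])
  · rintro ⟨h1, h3⟩
    refine ⟨subset_closure h1, ?_, h3⟩
    rintro rfl
    have := h1 0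
    simp at this

theorem mem_sail_iff (x : Space) : x ∈ sail (opM a) (pt a .B) ↔
    x ∈ polyhedron a t ∧ ∃ d n, faceForm a d n x = 1 := by
  rw [sail, ht.hull_eq, ht.frontier_polyhedron]
  rfl

theorem act_mem_sail {x : Space} (d : ℤ × ℤ) (hx : x ∈ sail (opM a) (pt a .B)) :
    act (per a d) x ∈ sail (opM a) (pt a .B) := by
  rw [ht.mem_sail_iff] at hx ⊢
  obtain ⟨h1, d', n, h⟩ := hx
  exact ⟨ht.act_mem_polyhedron d h1, d' - d, n, by rw [faceForm_act, sub_add_cancel, h]⟩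

theorem per_mem_periodGroup (d : ℤ × ℤ) : per a d ∈ periodGroup (opM a) (pt a .B) := by
  refine ⟨commute_per_opM a d, ?_⟩
  ext x
  constructor
  · rintro ⟨y, hy, rfl⟩
    exact ht.act_mem_sail d hy
  · intro hx
    exact ⟨_, ht.act_mem_sail (-d) hx, act_per_act_neg a d x⟩

end Roots
end SailTorus

namespace SailTorus

/-! ### Cells as sets of convex combinations -/

theorem mem_convexHull_image_iff {V : Type*} [AddCommGroup V] [Module ℝ V] (p : Label → V)
    (c : Set Label) (x : V) : x ∈ convexHull ℝ (p '' c) ↔ ∃ w : Label → ℝ, (∀ l, 0 ≤ w l) ∧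
      (∀ l, l ∉ c → w l = 0) ∧ ∑ l, w l = 1 ∧ x = ∑ l, w l • p l := by
  classical
  constructor
  · have hconv : Convex ℝ {x | ∃ w : Label → ℝ, (∀ l, 0 ≤ w l) ∧
      (∀ l, l ∉ c → w l = 0) ∧ ∑ l, w l = 1 ∧ x = ∑ l, w l • p l} := by
      rintro _ ⟨w, h1, h2, h3, rfl⟩ _ ⟨w', h1', h2', h3', rfl⟩ α β hα hβ hαβ
      refine ⟨fun l => α * w l + β * w' l, fun l => ?_, fun l hl => ?_, ?_, ?_⟩
      · exact add_nonneg (mul_nonneg hα (h1 l)) (mul_nonneg hβ (h1' l))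
      · simp [h2 l hl, h2' l hl]
      · rw [Finset.sum_add_distrib, ← Finset.mul_sum, ← Finset.mul_sum, h3, h3', mul_one, mul_one,
          hαβ]
      · rw [Finset.smul_sum, Finset.smul_sum, ← Finset.sum_add_distrib]
        exact Finset.sum_congr rfl fun l _ => by rw [add_smul, mul_smul, mul_smul]
    refine fun hx => convexHull_min ?_ hconv hx
    rintro _ ⟨l, hl, rfl⟩
    refine ⟨Pi.single l 1, fun j => ?_, fun j hj => ?_, by simp, ?_⟩
    · by_cases h : j = l
      · subst h; simp
      · simp [h]
    · have : j ≠ l := fun h => hj (h ▸ hl)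
      simp [this]
    · rw [Finset.sum_eq_single l] <;> simp +contextual
  · rintro ⟨w, h1, h2, h3, rfl⟩
    have e1 : ∑ l, w l • p l = ∑ l ∈ Finset.univ.filter (· ∈ c), w l • p l := by
      symm
      apply Finset.sum_filter_of_ne
      intro l _ hl
      by_contra hc
      exact hl (by rw [h2 l hc, zero_smul])
    have e2 : ∑ l ∈ Finset.univ.filter (· ∈ c), w l = 1 := by
      rw [← h3]
      apply Finset.sum_filter_of_ne
      intro l _ hl
      by_contra hc
      exact hl (h2 l hc)
    rw [e1]
    exact (convex_convexHull ℝ _).sum_mem (fun l _ => h1 l) e2 fun l hl =>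
      subset_convexHull ℝ _ ⟨l, (Finset.mem_filter.1 hl).2, rfl⟩

theorem mem_cell_iff (a : ℕ) (c : Set Label) (x : Space) : x ∈ cell a c ↔
    ∃ w : Label → ℝ, (∀ l, 0 ≤ w l) ∧ (∀ l, l ∉ c → w l = 0) ∧ ∑ l, w l = 1 ∧
      x = ∑ l, w l • pt a l :=
  mem_convexHull_image_iff _ _ _

theorem pt_mem_cell (a : ℕ) {c : Set Label} {l : Label} (h : l ∈ c) : pt a l ∈ cell a c :=
  subset_convexHull ℝ _ ⟨l, h, rfl⟩

theorem cell_singleton (a : ℕ) (l : Label) : cell a {l} = {pt a l} := by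
  simp [cell]

theorem form_eq_one_of_mem_cell {a : ℕ} {c : Set Label} {f : Space →L[ℝ] ℝ}
    (h : ∀ l ∈ c, f (pt a l) = 1) {x : Space} (hx : x ∈ cell a c) : f x = 1 := by
  obtain ⟨w, -, h2, h3, rfl⟩ := (mem_cell_iff a c x).1 hx
  rw [map_sum, ← h3]
  refine Finset.sum_congr rfl fun l _ => ?_
  rw [map_smul, smul_eq_mul]
  by_cases hl : l ∈ c
  · rw [h l hl, mul_one]
  · rw [h2 l hl, zero_mul]

/-- Two sets of labels name the same points up to a period. -/
def Shifts (d : ℤ × ℤ) (c c' : Finset Label) : Prop :=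
  (∀ l ∈ c, ∃ l' ∈ c', rep l = rep l' ∧ d + shift l = shift l') ∧
    ∀ l' ∈ c', ∃ l ∈ c, rep l = rep l' ∧ d + shift l = shift l'

instance (d : ℤ × ℤ) (c c' : Finset Label) : Decidable (Shifts d c c') :=
  inferInstanceAs (Decidable (_ ∧ _))

/-- The cells, as finite sets of labels. -/
def cellList : Fin 14 → Finset Label :=
  ![{.B}, {.E}, {.F}, {.A, .B}, {.A, .G}, {.G, .D}, {.B, .G}, {.D, .F}, {.E, .F}, {.C, .F},
    {.A, .B, .G}, {.B, .E, .F, .D, .G}, {.E, .F, .C}, {.C, .D, .F}]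

theorem mem_cells_iff (c : Set Label) : c ∈ cells ↔ ∃ k, c = (cellList k : Set Label) := by
  constructor
  · intro h
    simp only [cells, vertexCells, edgeCells, polygonCells, pentagon, Set.mem_union,
      Set.mem_insert_iff, Set.mem_singleton_iff] at h
    rcases h with ((h | h | h) | (h | h | h | h | h | h | h)) | (h | h | h | h)
    · exact ⟨0, by rw [h]; simp [cellList]⟩
    · exact ⟨1, by rw [h]; simp [cellList]⟩
    · exact ⟨2, by rw [h]; simp [cellList]⟩
    · exact ⟨3, by rw [h]; simp [cellList]⟩
    · exact ⟨4, by rw [h]; simp [cellList]⟩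
    · exact ⟨5, by rw [h]; simp [cellList]⟩
    · exact ⟨6, by rw [h]; simp [cellList]⟩
    · exact ⟨7, by rw [h]; simp [cellList]⟩
    · exact ⟨8, by rw [h]; simp [cellList]⟩
    · exact ⟨9, by rw [h]; simp [cellList]⟩
    · exact ⟨10, by rw [h]; simp [cellList]⟩
    · exact ⟨11, by rw [h]; simp [cellList]⟩
    · exact ⟨12, by rw [h]; simp [cellList]⟩
    · exact ⟨13, by rw [h]; simp [cellList]⟩
  · rintro ⟨k, rfl⟩
    fin_cases k <;> simp [cellList, cells, vertexCells, edgeCells, polygonCells, pentagon]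

/-- A period relating two cells is the difference of shifts of some of their labels, so quantifying
over labels makes the check finite. -/
theorem shifts_unique : ∀ k k' : Fin 14, ∀ l ∈ cellList k, ∀ l' ∈ cellList k',
    Shifts (shift l' - shift l) (cellList k) (cellList k') → k = k' ∧ shift l' - shift l = 0 := by
  decide +kernel

theorem Shifts.unique {k k' : Fin 14} {d : ℤ × ℤ} (h : Shifts d (cellList k) (cellList k')) :
    k = k' ∧ d = 0 := by
  obtain ⟨l, hl⟩ : ∃ l, l ∈ cellList k := by
    clear h; revert k; decide
  obtain ⟨l', hl', -, hd⟩ := h.1 l hl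
  have e : d = shift l' - shift l := by rw [← hd]; abel
  rw [e] at h ⊢
  exact shifts_unique k k' l hl l' hl' h

/-- Here c stands for the vertices of a polygon on which a supporting functional is extremal. The
five listed pairs are the diagonals of the pentagon: no proper face contains a diagonal, as
`pentagon_max` shows. -/
theorem exists_shifts : ∀ n : Tile, ∀ c ∈ (tileCell n).powerset, c.Nonempty →
    (n = .pent → (Label.B ∈ c ∧ Label.F ∈ c ∨ Label.B ∈ c ∧ Label.D ∈ c ∨
      Label.E ∈ c ∧ Label.D ∈ c ∨ Label.E ∈ c ∧ Label.G ∈ c ∨ Label.F ∈ c ∧ Label.G ∈ c) →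
        c = tileCell .pent) →
    ∃ k, ∃ d ∈ ([(0, 0), (0, 1), (0, -1), (1, 0), (1, -1), (-1, 0)] : List (ℤ × ℤ)),
      Shifts d (cellList k) c := by
  decide +kernel

theorem image_act_cell {a : ℕ} (g : SL3) (c : Set Label) :
    act g '' cell a c = convexHull ℝ (act g '' (pt a '' c)) := by
  have : act g = (actL g).toLinearMap := funext fun x => (actL_apply g x).symm
  rw [cell, this, LinearMap.image_convexHull]

namespace Roots

variable {a : ℕ} {t : Fin 3 → ℝ} (ht : Roots a t)
include ht

theorem shifts_iff (d : ℤ × ℤ) (c c' : Finset Label) : Shifts d c c' ↔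
    act (per a d) '' (pt a '' (c : Set Label)) = pt a '' (c' : Set Label) := by
  constructor
  · rintro ⟨h1, h2⟩
    ext x
    constructor
    · rintro ⟨_, ⟨l, hl, rfl⟩, rfl⟩
      obtain ⟨l', hl', h⟩ := h1 l hl
      exact ⟨l', hl', ((ht.act_pt_eq_iff d l l').2 h).symm⟩
    · rintro ⟨l', hl', rfl⟩
      obtain ⟨l, hl, h⟩ := h2 l' hl'
      exact ⟨_, ⟨l, hl, rfl⟩, (ht.act_pt_eq_iff d l l').2 h⟩
  · intro h
    constructor
    · intro l hl
      have : act (per a d) (pt a l) ∈ pt a '' (c' : Set Label) := h ▸ ⟨_, ⟨l, hl, rfl⟩, rfl⟩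
      obtain ⟨l', hl', e⟩ := this
      exact ⟨l', hl', (ht.act_pt_eq_iff d l l').1 e.symm⟩
    · intro l' hl'
      have : pt a l' ∈ act (per a d) '' (pt a '' (c : Set Label)) := h ▸ ⟨l', hl', rfl⟩
      obtain ⟨_, ⟨l, hl, rfl⟩, e⟩ := this
      exact ⟨l, hl, (ht.act_pt_eq_iff d l l').1 e⟩

omit ht in
/-- A point on a translated polygon is a combination of its vertices. -/
theorem exists_weight_of_eq_one {x : Space} (hx : x ∈ polyhedron a t) {d : ℤ × ℤ} {n : Tile}
    (h : faceForm a d n x = 1) :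
    ∃ τ, triTile τ = n ∧ ∃ w, IsWeight τ w ∧ ∑ l, w l = 1 ∧
      act (per a d) x = ∑ l, w l • pt a l := by
  obtain ⟨τ, hτ, w, hw, e, hs⟩ := exists_weight_of_min (x := x) (d := d) (n := n)
    (fun d' n' => by rw [h]; exact hx.2 d' n')
  exact ⟨τ, hτ, w, hw, hs.trans h, e⟩

theorem cell_subset_polyhedron (c : Set Label) : cell a c ⊆ polyhedron a t :=
  convexHull_min (by rintro _ ⟨l, -, rfl⟩; exact ht.pt_mem_polyhedron l) (convex_polyhedron a t)

/-- The sum of three forms, each at least 1 on the polyhedron, equals 3 exactly where all three are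
1. Such a point is a combination of vertices of the polygon n, and any vertex with positive weight
must itself satisfy the other two equalities. -/
theorem isExposed_cell {c : Finset Label} {n n₁ n₂ : Tile} {d₁ d₂ : ℤ × ℤ} (hc : c ⊆ tileCell n)
    (h1 : ∀ l ∈ c, faceForm a d₁ n₁ (pt a l) = 1 ∧ faceForm a d₂ n₂ (pt a l) = 1)
    (h2 : ∀ l ∈ tileCell n, l ∉ c →
      faceForm a d₁ n₁ (pt a l) ≠ 1 ∨ faceForm a d₂ n₂ (pt a l) ≠ 1) :
    IsExposed ℝ (polyhedron a t) (cell a c) := by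
  intro hne
  have h0 : ∀ l ∈ (c : Set Label), faceForm a 0 n (pt a l) = 1 := fun l hl => by
    rw [faceForm_zero, tileForm_pt a n (hc hl)]
  have hval : ∀ x ∈ cell a c, (-(faceForm a 0 n + faceForm a d₁ n₁ + faceForm a d₂ n₂)) x = -3 := by
    intro x hx
    simp only [_root_.neg_apply, _root_.add_apply]
    rw [form_eq_one_of_mem_cell h0 hx, form_eq_one_of_mem_cell (fun l hl => (h1 l hl).1) hx,
      form_eq_one_of_mem_cell (fun l hl => (h1 l hl).2) hx]
    norm_num
  refine ⟨-(faceForm a 0 n + faceForm a d₁ n₁ + faceForm a d₂ n₂), ?_⟩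
  ext x
  constructor
  · intro hx
    refine ⟨ht.cell_subset_polyhedron _ hx, fun y hy => ?_⟩
    rw [hval x hx]
    simp only [_root_.neg_apply, _root_.add_apply]
    have := hy.2 0 n
    have := hy.2 d₁ n₁
    have := hy.2 d₂ n₂
    linarith
  · rintro ⟨hx, hmax⟩
    obtain ⟨y, hy⟩ := hne
    have hle := hmax y (ht.cell_subset_polyhedron _ hy)
    rw [hval y hy] at hle
    simp only [_root_.neg_apply, _root_.add_apply] at hle
    have k0 := hx.2 0 n
    have k1 := hx.2 d₁ n₁
    have k2 := hx.2 d₂ n₂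
    obtain ⟨τ, rfl, w, hw, hs, e⟩ := exists_weight_of_eq_one hx (d := 0) (n := n) (by linarith)
    rw [act_per_zero] at e
    have zero : ∀ d' n', faceForm a d' n' x = 1 → ∀ l, w l = 0 ∨ faceForm a d' n' (pt a l) = 1 := by
      intro d' n' h l
      have hsum : ∑ l, w l * (faceForm a d' n' (pt a l) - 1) = 0 := by
        rw [e, map_sum] at h
        simp only [map_smul, smul_eq_mul] at h
        simp only [mul_sub, mul_one, Finset.sum_sub_distrib, h, hs, sub_self]
      have := (Finset.sum_eq_zero_iff_of_nonneg fun l _ => mul_nonneg (hw.nonneg l)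
        (sub_nonneg.2 ((ht.pt_mem_polyhedron l).2 d' n'))).1 hsum l (Finset.mem_univ l)
      rcases mul_eq_zero.1 this with h | h
      · exact Or.inl h
      · exact Or.inr (by linarith)
    refine (mem_cell_iff a _ x).2 ⟨w, hw.nonneg, fun l hl => ?_, hs, e⟩
    by_cases hl' : l ∈ triCell τ
    · rcases h2 l (triCell_subset τ hl') hl with h | h
      · exact (zero d₁ n₁ (by linarith) l).resolve_right h
      · exact (zero d₂ n₂ (by linarith) l).resolve_right h
    · exact hw.supp l hl'

theorem mem_sailFaces_of_isExposed {c : Finset Label} {n : Tile} (hc : c ⊆ tileCell n)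
    (hne : c.Nonempty) (h : IsExposed ℝ (polyhedron a t) (cell a c)) :
    cell a c ∈ sailFaces (opM a) (pt a .B) := by
  obtain ⟨l, hl⟩ := hne
  rw [sailFaces, ht.hull_eq]
  refine ⟨⟨_, pt_mem_cell a (c := (c : Set Label)) hl⟩, fun he => ?_, h⟩
  have hf : ∀ l ∈ (c : Set Label), faceForm a 0 n (pt a l) = 1 := fun l hl => by
    rw [faceForm_zero, tileForm_pt a n (hc hl)]
  -- The point 2B shows the cell to be a proper subset: every form is at least 2 there.
  have h2 : (2 : ℝ) • pt a .B ∈ polyhedron a t := by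
    refine ⟨smul_mem_cone (ht.pt_mem_cone .B) two_pos, fun d n => ?_⟩
    have := (ht.pt_mem_polyhedron .B).2 d n
    rw [map_smul, smul_eq_mul]
    linarith
  rw [← he] at h2
  have h3 := form_eq_one_of_mem_cell hf h2
  rw [map_smul, smul_eq_mul] at h3
  have := (ht.pt_mem_polyhedron .B).2 0 n
  linarith

end Roots

/-! ### Incidence of the cells with the supporting forms -/

theorem faceForm_pt_eq_one_iff {a : ℕ} {n n' : Tile} {d : ℤ × ℤ} {κ : ℝ} {L : Space → ℝ}
    (hκ : κ ≠ 0) (he : ∀ y, tileForm a n' (act (per a d) y) = tileForm a n y + κ * L y)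
    {l : Label} (hl : l ∈ tileCell n) : faceForm a d n' (pt a l) = 1 ↔ L (pt a l) = 0 := by
  rw [faceForm_apply, he, tileForm_pt a n hl]
  simp [hκ]

theorem cell_data_of_forms {a : ℕ} {c : Finset Label} {n n₁ n₂ : Tile} {d₁ d₂ : ℤ × ℤ}
    {κ₁ κ₂ : ℝ} {L₁ L₂ : Space → ℝ} (hc : c ⊆ tileCell n) (hκ₁ : κ₁ ≠ 0) (hκ₂ : κ₂ ≠ 0)
    (he₁ : ∀ y, tileForm a n₁ (act (per a d₁) y) = tileForm a n y + κ₁ * L₁ y)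
    (he₂ : ∀ y, tileForm a n₂ (act (per a d₂) y) = tileForm a n y + κ₂ * L₂ y)
    (h1 : ∀ l ∈ c, L₁ (pt a l) = 0 ∧ L₂ (pt a l) = 0)
    (h2 : ∀ l ∈ tileCell n, l ∉ c → L₁ (pt a l) ≠ 0 ∨ L₂ (pt a l) ≠ 0) :
    ∃ (n n₁ n₂ : Tile) (d₁ d₂ : ℤ × ℤ), c ⊆ tileCell n ∧
    (∀ l ∈ c, faceForm a d₁ n₁ (pt a l) = 1 ∧ faceForm a d₂ n₂ (pt a l) = 1) ∧
    (∀ l ∈ tileCell n, l ∉ c →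
      faceForm a d₁ n₁ (pt a l) ≠ 1 ∨ faceForm a d₂ n₂ (pt a l) ≠ 1) := by
  refine ⟨n, n₁, n₂, d₁, d₂, hc, fun l hl => ?_, fun l hl hlc => ?_⟩
  · rw [faceForm_pt_eq_one_iff hκ₁ he₁ (hc hl), faceForm_pt_eq_one_iff hκ₂ he₂ (hc hl)]
    exact h1 l hl
  · rw [Ne, Ne, faceForm_pt_eq_one_iff hκ₁ he₁ hl, faceForm_pt_eq_one_iff hκ₂ he₂ hl]
    exact h2 l hl hlc

/-- Every cell is cut out of a polygon by the supporting forms of two further polygons. -/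
theorem cell_data (a : ℕ) (k : Fin 14) : ∃ (n n₁ n₂ : Tile) (d₁ d₂ : ℤ × ℤ),
    cellList k ⊆ tileCell n ∧
    (∀ l ∈ cellList k, faceForm a d₁ n₁ (pt a l) = 1 ∧ faceForm a d₂ n₂ (pt a l) = 1) ∧
    (∀ l ∈ tileCell n, l ∉ cellList k →
      faceForm a d₁ n₁ (pt a l) ≠ 1 ∨ faceForm a d₂ n₂ (pt a l) ≠ 1) := by
  have ha : (0 : ℝ) ≤ a := Nat.cast_nonneg a
  have z : ∀ n y, tileForm a n (act (per a (0, 0)) y) = tileForm a n y := fun n y =>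
    congrArg _ (act_per_zero a y)
  have k1 : (a : ℝ) + 1 ≠ 0 := by positivity
  have k3 : 1 / ((a : ℝ) + 3) ≠ 0 := by positivity
  have k4 : ((a : ℝ) + 1) / (2 * (a + 3)) ≠ 0 := by positivity
  have k5 : ((a : ℝ) + 2) / (a + 3) ≠ 0 := by positivity
  have k2 : (1 / 2 : ℝ) ≠ 0 := by norm_num
  have e1 : ∀ y, tileForm a .abg (act (per a (0, 0)) y) = tileForm a .pent y + (-1) * y 0 :=
    fun y => by rw [z, pent_eq]; ring
  have e2 : ∀ y, tileForm a .efc (act (per a (0, 0)) y) = _ := fun y => (z _ y).trans (efc_eq a y)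
  have e3 : ∀ y, tileForm a .cdf (act (per a (0, 0)) y) = _ := fun y => (z _ y).trans (cdf_eq a y)
  have e4 : ∀ y, tileForm a .pent (act (per a (0, 0)) y) = tileForm a .abg y + 1 * y 0 :=
    fun y => by rw [z, pent_eq]; ring
  have e5 : ∀ y, tileForm a .pent (act (per a (0, 0)) y) = tileForm a .cdf y + (-(1 / 2)) *
    lin (a ^ 2 + 3 * a + 3) (2 * a ^ 2 + 7 * a + 7) (a + 2) y :=
    fun y => by rw [z, cdf_eq]; ring
  have e6 : ∀ y, tileForm a .pent (act (per a (0, 0)) y) = tileForm a .efc y + (-(1 / (a + 3))) *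
    lin 1 2 1 y := fun y => by rw [z, efc_eq]; ring
  have e7 : ∀ y, tileForm a .efc (act (per a (0, 0)) y) = tileForm a .cdf y +
    (-((a + 1) / (2 * (a + 3)))) * lin (a ^ 2 + 5 * a + 7) (2 * a ^ 2 + 11 * a + 17) (a + 4) y :=
    fun y => by rw [z, cdf_eq_efc]; ring
  have e8 : ∀ n y, tileForm a n (act (per a (0, 0)) y) = tileForm a n y + 1 * 0 :=
    fun n y => by rw [z]; ring
  have e9 := fun n : Tile => cell_data_of_forms (a := a) (c := tileCell n) (n := n)
    (L₁ := fun _ => 0) (L₂ := fun _ => 0) subset_rfl one_ne_zero one_ne_zero (e8 n) (e8 n)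
    (fun _ _ => ⟨rfl, rfl⟩) fun l hl hl' => absurd hl hl'
  -- A vertex is cut out by the two sides meeting there, an edge by its side used twice, and a
  -- polygon by its own form, with the zero function as edge form.
  fin_cases k <;> [
    refine cell_data_of_forms (n := .pent) (by decide) (by norm_num) k1 e1 (abg_Yinv_eq a) ?_ ?_;
    refine cell_data_of_forms (n := .pent) (by decide) k1 k3 (abg_Yinv_eq a) e2 ?_ ?_;
    refine cell_data_of_forms (n := .pent) (by decide) k3 k2 e2 e3 ?_ ?_;
    refine cell_data_of_forms (n := .abg) (by decide) k2 k2 (cdf_X_eq a) (cdf_X_eq a) ?_ ?_;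
    refine cell_data_of_forms (n := .abg) (by decide) k1 k1 (pent_Y_eq a) (pent_Y_eq a) ?_ ?_;
    refine cell_data_of_forms (n := .pent) (by decide) k5 k5 (efc_Y_eq a) (efc_Y_eq a) ?_ ?_;
    refine cell_data_of_forms (n := .abg) (by decide) one_ne_zero one_ne_zero e4 e4 ?_ ?_;
    refine cell_data_of_forms (n := .cdf) (by decide) (neg_ne_zero.2 k2) (neg_ne_zero.2 k2)
      e5 e5 ?_ ?_;
    refine cell_data_of_forms (n := .efc) (by decide) (neg_ne_zero.2 k3) (neg_ne_zero.2 k3)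
      e6 e6 ?_ ?_;
    refine cell_data_of_forms (n := .cdf) (by decide) (neg_ne_zero.2 k4) (neg_ne_zero.2 k4)
      e7 e7 ?_ ?_;
    exact e9 .abg;
    exact e9 .pent;
    exact e9 .efc;
    exact e9 .cdf]
  all_goals first
    | (intro l hl hl'
       cases l <;> simp [cellList, tileCell] at hl hl' <;>
         first
           | (left; apply ne_of_gt; simp [pt, coords, lin_apply] <;> nlinarith)
           | (right; apply ne_of_gt; simp [pt, coords, lin_apply] <;> nlinarith)
           | (left; apply ne_of_lt; simp [pt, coords, lin_apply] <;> nlinarith))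
    | (intro l hl
       cases l <;> simp [cellList] at hl <;> simp [pt, coords, lin_apply] <;> ring_nf <;> simp)

end SailTorus

namespace SailTorus
namespace Roots

variable {a : ℕ} {t : Fin 3 → ℝ} (ht : Roots a t)
include ht

/-! ### Classification of the faces -/

theorem cellList_mem_sailFaces (k : Fin 14) :
    cell a (cellList k : Set Label) ∈ sailFaces (opM a) (pt a .B) := by
  obtain ⟨n, n₁, n₂, d₁, d₂, hc, h1, h2⟩ := cell_data a k
  exact ht.mem_sailFaces_of_isExposed hc (by clear h1 h2 hc; revert k; decide)
    (ht.isExposed_cell hc h1 h2)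

omit ht in
theorem _root_.IsExposed.act_image {H F : Set Space} {g : SL3} (hg : act g '' H = H)
    (hF : IsExposed ℝ H F) : IsExposed ℝ H (act g '' F) := by
  rintro ⟨_, ⟨x, hx, rfl⟩⟩
  obtain ⟨f, hf⟩ := hF ⟨x, hx⟩
  have hval : ∀ y, (f.comp (actL g⁻¹)) (act g y) = f y := fun y => by
    simp [actL_apply, act_inv_act]
  refine ⟨f.comp (actL g⁻¹), ?_⟩
  ext z
  constructor
  · rintro ⟨y, hy, rfl⟩
    rw [hf] at hy
    refine ⟨hg ▸ ⟨y, hy.1, rfl⟩, fun u hu => ?_⟩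
    rw [← hg] at hu
    obtain ⟨v, hv, rfl⟩ := hu
    rw [hval, hval]
    exact hy.2 v hv
  · rintro ⟨hz, hmax⟩
    rw [← hg] at hz
    obtain ⟨y, hy, rfl⟩ := hz
    refine ⟨y, ?_, rfl⟩
    rw [hf]
    refine ⟨hy, fun v hv => ?_⟩
    rw [← hval v, ← hval y]
    exact hmax _ (hg ▸ ⟨v, hv, rfl⟩)

omit ht in
theorem act_image_mem_sailFaces {g : SL3} {F : Set Space}
    (hg : act g '' hull (opM a) (pt a .B) = hull (opM a) (pt a .B))
    (hF : F ∈ sailFaces (opM a) (pt a .B)) : act g '' F ∈ sailFaces (opM a) (pt a .B) := by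
  refine ⟨hF.1.image _, fun h => hF.2.1 ?_, hF.2.2.act_image hg⟩
  rw [← hg] at h
  exact (act_injective g).image_injective h

theorem act_per_image_hull (d : ℤ × ℤ) :
    act (per a d) '' hull (opM a) (pt a .B) = hull (opM a) (pt a .B) := by
  rw [ht.hull_eq]
  ext x
  constructor
  · rintro ⟨y, hy, rfl⟩
    exact ht.act_mem_polyhedron d hy
  · intro hx
    exact ⟨_, ht.act_mem_polyhedron (-d) hx, act_per_act_neg a d x⟩

theorem pt_mem_sailFaces (l : Label) : {pt a l} ∈ sailFaces (opM a) (pt a .B) := by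
  have h : {pt a (rep l)} ∈ sailFaces (opM a) (pt a .B) := by
    have key : ∀ (l : Label) (k : Fin 14), cellList k = {l} →
        {pt a l} ∈ sailFaces (opM a) (pt a .B) := fun l k h => by
      have := ht.cellList_mem_sailFaces k
      rwa [h, Finset.coe_singleton, cell_singleton] at this
    have h0 := key .B 0 (by decide)
    have h1 := key .E 1 (by decide)
    have h2 := key .F 2 (by decide)
    cases l
    exacts [h0, h0, h0, h0, h1, h2, h1]
  rw [pt_eq_act a l, ← Set.image_singleton]
  exact act_image_mem_sailFaces (ht.act_per_image_hull _) h

omit ht in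
/-- A supporting functional takes its maximum at all vertices needed to represent a point. -/
theorem eq_max_of_weight {f : Space →L[ℝ] ℝ} {m : ℝ} {w : Label → ℝ} (hw : ∀ l, 0 ≤ w l)
    (hs : ∑ l, w l = 1) {v : Label → Space} (hv : ∀ l, f (v l) ≤ m)
    (h : f (∑ l, w l • v l) = m) {l : Label} (hl : w l ≠ 0) : f (v l) = m := by
  rw [map_sum] at h
  simp only [map_smul, smul_eq_mul] at h
  have h0 : ∑ l, w l * (m - f (v l)) = 0 := by
    simp only [mul_sub, Finset.sum_sub_distrib, h, ← Finset.sum_mul, hs, one_mul, sub_self]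
  have := (Finset.sum_eq_zero_iff_of_nonneg fun l _ => mul_nonneg (hw l)
    (sub_nonneg.2 (hv l))).1 h0 l (Finset.mem_univ l)
  have := (mul_eq_zero.1 this).resolve_left hl
  linarith

/-- Every named point is exposed in the whole hull, hence extreme in any cell that contains it. -/
theorem extremePoints_cell (c : Set Label) : (cell a c).extremePoints ℝ = pt a '' c := by
  apply Set.Subset.antisymm
  · exact extremePoints_convexHull_subset
  · rintro _ ⟨l, hl, rfl⟩
    have h1 := ht.pt_mem_sailFaces l
    have h2 : pt a l ∈ (hull (opM a) (pt a .B)).extremePoints ℝ :=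
      exposedPoints_subset_extremePoints (mem_exposedPoints_iff_exposed_singleton.2 h1.2.2)
    rw [ht.hull_eq] at h2
    exact inter_extremePoints_subset_extremePoints_of_subset (ht.cell_subset_polyhedron c)
      ⟨pt_mem_cell a hl, h2⟩

/-- Every point of a face lies on some polygon. -/
theorem exists_faceForm_eq_one_of_mem_face {F : Set Space} (hF : F ≠ polyhedron a t)
    (hE : IsExposed ℝ (polyhedron a t) F) {x : Space} (hx : x ∈ F) :
    ∃ d n, faceForm a d n x = 1 := by
  by_contra hc
  push Not at hc
  have hxH := hE.subset hx
  have hint := ht.mem_interior_polyhedron hxH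
    fun d n => lt_of_le_of_ne (hxH.2 d n) (hc d n).symm
  apply hF
  obtain ⟨f, hf⟩ := hE ⟨x, hx⟩
  have hmax : ∀ y ∈ polyhedron a t, f y ≤ f x := by rw [hf] at hx; exact hx.2
  apply Set.Subset.antisymm hE.subset
  intro z hz
  -- A functional maximal at an interior point is constant: moving slightly past x, away from z,
  -- would otherwise increase it. The face would then be the whole hull.
  have hcont : ContinuousAt (fun s : ℝ => x + s • (x - z)) 0 := by fun_prop
  have h1 : ∀ᶠ s in nhds (0 : ℝ), x + s • (x - z) ∈ polyhedron a t :=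
    hcont (by simpa using mem_interior_iff_mem_nhds.1 hint)
  obtain ⟨s, hs, hs1⟩ := ((h1.filter_mono nhdsWithin_le_nhds).and
    (self_mem_nhdsWithin (s := Set.Ioi (0 : ℝ)))).exists
  have h2 := hmax _ hs
  rw [map_add, map_smul, map_sub, smul_eq_mul] at h2
  have hs1' : 0 < s := hs1
  have h3 : f x - f z ≤ 0 := nonpos_of_mul_nonpos_right (by linarith : s * (f x - f z) ≤ 0) hs1'
  rw [hf]
  exact ⟨hz, fun y hy => by have := hmax y hy; linarith⟩

/-- Every face is contained in some polygon. -/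
theorem exists_tile_of_face {F : Set Space} (hne : F.Nonempty) (hF : F ≠ polyhedron a t)
    (hE : IsExposed ℝ (polyhedron a t) F) : ∃ d n, ∀ x ∈ F, faceForm a d n x = 1 := by
  let T : Space → Set ((ℤ × ℤ) × Tile) := fun x => {p | faceForm a p.1 p.2 x = 1}
  have hfin : ∀ x ∈ F, (T x).Finite := fun x hx =>
    (ht.finite_faceForm_le (hE.subset hx).1 1).subset fun p hp => le_of_eq hp
  -- A point of F with the fewest polygon planes through it. A midpoint with another point y of F
  -- lies only on planes containing both, so by minimality y lies on every plane through x.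
  obtain ⟨x, hx, hmin⟩ := (InvImage.wf (fun x => (T x).ncard) Nat.lt_wfRel.wf).has_min F hne
  obtain ⟨d, n, h⟩ := ht.exists_faceForm_eq_one_of_mem_face hF hE hx
  refine ⟨d, n, fun y hy => ?_⟩
  by_contra hy1
  have hm : (1 / 2 : ℝ) • x + (1 / 2 : ℝ) • y ∈ F :=
    (hE.convex (convex_polyhedron a t)) hx hy (by norm_num) (by norm_num) (by norm_num)
  refine hmin _ hm (Set.ncard_lt_ncard ?_ (hfin x hx))
  have key : ∀ d' n', faceForm a d' n' ((1 / 2 : ℝ) • x + (1 / 2 : ℝ) • y) = 1 →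
      faceForm a d' n' x = 1 ∧ faceForm a d' n' y = 1 := by
    intro d' n' h'
    rw [map_add, map_smul, map_smul, smul_eq_mul, smul_eq_mul] at h'
    have h1 := (hE.subset hx).2 d' n'
    have h2 := (hE.subset hy).2 d' n'
    constructor <;> linarith
  refine ⟨fun p hp => (key p.1 p.2 hp).1, fun hsub => hy1 ?_⟩
  exact (key d n (hsub (show ((d, n) : (ℤ × ℤ) × Tile) ∈ T x from h))).2

omit ht in
theorem eq_of_pos_combination {α β γ δ u v p q m : ℝ} (h : α * u + β * v = γ * p + δ * q)
    (hs : α + β = γ + δ) (hγ : 0 < γ) (hδ : 0 < δ) (hu : u = m) (hv : v = m) (hp : p ≤ m)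
    (hq : q ≤ m) : p = m ∧ q = m := by
  rw [hu, hv] at h
  have h1 : γ * (m - p) + δ * (m - q) = 0 := by linear_combination h - m * hs
  have h2 := mul_nonneg hγ.le (sub_nonneg.2 hp)
  have h3 := mul_nonneg hδ.le (sub_nonneg.2 hq)
  have h4 : γ * (m - p) = 0 := by linarith
  have h5 : δ * (m - q) = 0 := by linarith
  rw [mul_eq_zero] at h4 h5
  exact ⟨by rcases h4 with h | h <;> linarith, by rcases h5 with h | h <;> linarith⟩

omit ht in
/-- A functional maximal at two non-adjacent vertices of the pentagon is constant on it. -/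
theorem pentagon_max (f : Space →L[ℝ] ℝ) {m : ℝ} (hm : ∀ l, f (pt a l) ≤ m)
    (h : (f (pt a .B) = m ∧ f (pt a .F) = m) ∨ (f (pt a .B) = m ∧ f (pt a .D) = m) ∨
      (f (pt a .E) = m ∧ f (pt a .D) = m) ∨ (f (pt a .E) = m ∧ f (pt a .G) = m) ∨
      (f (pt a .F) = m ∧ f (pt a .G) = m)) :
    f (pt a .B) = m ∧ f (pt a .E) = m ∧ f (pt a .F) = m ∧ f (pt a .D) = m ∧ f (pt a .G) = m := by
  have ha : (0 : ℝ) ≤ a := Nat.cast_nonneg a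
  -- The five relations come from the crossing points of the pairs of intersecting diagonals.
  -- Maximality at both ends of one diagonal passes to both ends of the other.
  have r1 : (a ^ 2 + 2 * a + 1) * f (pt a .B) + (a + 2) * f (pt a .F) =
      (a ^ 2 + 3 * a + 2) * f (pt a .E) + 1 * f (pt a .D) := by
    rw [eq_lin f]; simp [lin_apply, pt, coords]; ring
  have r2 : (2 * a ^ 2 + 3 * a + 2) * f (pt a .B) + (2 * a + 2) * f (pt a .F) =
      (2 * a ^ 2 + 5 * a + 3) * f (pt a .E) + 1 * f (pt a .G) := by
    rw [eq_lin f]; simp [lin_apply, pt, coords]; ring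
  have r3 : (a ^ 2 + 2 * a + 2) * f (pt a .B) + (2 * a + 2) * f (pt a .D) =
      (a ^ 2 + 3 * a + 2) * f (pt a .E) + (a + 2) * f (pt a .G) := by
    rw [eq_lin f]; simp [lin_apply, pt, coords]; ring
  have r4 : (a + 1) * f (pt a .B) + (2 * a ^ 2 + 5 * a + 3) * f (pt a .D) =
      (a ^ 2 + 3 * a + 2) * f (pt a .F) + (a ^ 2 + 3 * a + 2) * f (pt a .G) := by
    rw [eq_lin f]; simp [lin_apply, pt, coords]; ring
  have r5 : (a + 1) * f (pt a .E) + (2 * a ^ 2 + 3 * a + 2) * f (pt a .D) =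
      (a ^ 2 + 2 * a + 2) * f (pt a .F) + (a ^ 2 + 2 * a + 1) * f (pt a .G) := by
    rw [eq_lin f]; simp [lin_apply, pt, coords]; ring
  have hB := hm .B
  have hD := hm .D
  have hE := hm .E
  have hF := hm .F
  have hG := hm .G
  rcases h with ⟨h, h'⟩ | ⟨h, h'⟩ | ⟨h, h'⟩ | ⟨h, h'⟩ | ⟨h, h'⟩
  · obtain ⟨e, e'⟩ := eq_of_pos_combination r1 (by ring) (by positivity) one_pos h h' hE hD
    obtain ⟨-, e''⟩ := eq_of_pos_combination r2 (by ring) (by positivity) one_pos h h' hE hG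
    exact ⟨h, e, h', e', e''⟩
  · obtain ⟨e, e'⟩ := eq_of_pos_combination r3 (by ring) (by positivity) (by positivity) h h' hE hG
    obtain ⟨e'', -⟩ := eq_of_pos_combination r4 (by ring) (by positivity) (by positivity) h h' hF hG
    exact ⟨h, e, e'', h', e'⟩
  · obtain ⟨e, e'⟩ := eq_of_pos_combination r1.symm (by ring) (by positivity) (by positivity)
      h h' hB hF
    obtain ⟨-, e''⟩ := eq_of_pos_combination r5 (by ring) (by positivity) (by positivity) h h' hF hG
    exact ⟨e, h, e', h', e''⟩
  · obtain ⟨e, e'⟩ := eq_of_pos_combination r2.symm (by ring) (by positivity) (by positivity)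
      h h' hB hF
    obtain ⟨-, e''⟩ := eq_of_pos_combination r3.symm (by ring) (by positivity) (by positivity)
      h h' hB hD
    exact ⟨e, h, e', e'', h'⟩
  · obtain ⟨e, e'⟩ := eq_of_pos_combination r4.symm (by ring) (by positivity) (by positivity)
      h h' hB hD
    obtain ⟨e'', -⟩ := eq_of_pos_combination r5.symm (by ring) (by positivity) (by positivity)
      h h' hE hD
    exact ⟨e, e'', h, e', h'⟩

/-- Every face is a translate of a cell. -/
theorem exists_cell_of_face {F : Set Space} (hF : F ∈ sailFaces (opM a) (pt a .B)) :
    ∃ d k, act (per a d) '' cell a (cellList k : Set Label) = F := by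
  classical
  obtain ⟨d, n, hd⟩ : ∃ d n, ∀ x ∈ F, faceForm a d n x = 1 := by
    have := hF
    rw [sailFaces, ht.hull_eq] at this
    exact ht.exists_tile_of_face this.1 this.2.1 this.2.2
  have hF' := act_image_mem_sailFaces (ht.act_per_image_hull d) hF
  set F' := act (per a d) '' F with hF'def
  have hd' : ∀ x ∈ F', faceForm a 0 n x = 1 := by
    rintro _ ⟨x, hx, rfl⟩
    rw [faceForm_act, zero_add]
    exact hd x hx
  rw [sailFaces, ht.hull_eq] at hF'
  obtain ⟨hne, -, hE⟩ := hF'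
  obtain ⟨f, hf⟩ := hE hne
  obtain ⟨x₀, hx₀⟩ := hne
  set m := f x₀ with hm
  have hmax : ∀ y ∈ polyhedron a t, f y ≤ m := by
    have := hx₀
    rw [hf] at this
    exact this.2
  have hmem : ∀ y, y ∈ F' ↔ y ∈ polyhedron a t ∧ f y = m := by
    intro y
    constructor
    · intro hy
      have hyH := hE.subset hy
      rw [hf] at hy
      exact ⟨hyH, le_antisymm (hmax y hyH) (hy.2 x₀ (hE.subset hx₀))⟩
    · rintro ⟨hy, e⟩
      rw [hf]
      exact ⟨hy, fun z hz => e ▸ hmax z hz⟩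
  -- The vertices of the polygon at which the supporting functional is maximal; they span the
  -- translated face.
  set c := (tileCell n).filter fun l => f (pt a l) = m with hc
  have hcell : F' = cell a (c : Set Label) := by
    ext x
    constructor
    · intro hx
      have hxH := hE.subset hx
      obtain ⟨τ, hτ, w, hw, hs, e⟩ := exists_weight_of_eq_one hxH (hd' x hx)
      rw [act_per_zero] at e
      refine (mem_cell_iff a _ x).2 ⟨w, hw.nonneg, fun l hl => ?_, hs, e⟩
      by_contra hwl
      apply hl
      have hl' : l ∈ triCell τ := by
        by_contra h
        exact hwl (hw.supp l h)
      refine Finset.mem_coe.2 (Finset.mem_filter.2 ⟨hτ ▸ triCell_subset τ hl', ?_⟩)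
      exact eq_max_of_weight hw.nonneg hs (fun l => hmax _ (ht.pt_mem_polyhedron l))
        (e ▸ ((hmem x).1 hx).2) hwl
    · intro hx
      refine (hmem x).2 ⟨ht.cell_subset_polyhedron _ hx, ?_⟩
      obtain ⟨w, -, h2, h3, rfl⟩ := (mem_cell_iff a _ x).1 hx
      rw [map_sum]
      calc ∑ l, f (w l • pt a l) = ∑ l, w l * m := by
            refine Finset.sum_congr rfl fun l _ => ?_
            rw [map_smul, smul_eq_mul]
            by_cases hl : l ∈ (c : Set Label)
            · rw [(Finset.mem_filter.1 hl).2]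
            · rw [h2 l hl, zero_mul, zero_mul]
        _ = m := by rw [← Finset.sum_mul, h3, one_mul]
  have hcne : c.Nonempty := by
    rw [Finset.nonempty_iff_ne_empty]
    intro h0
    rw [hcell, h0] at hx₀
    simp [cell] at hx₀
  obtain ⟨k, d', -, hs⟩ := exists_shifts n c (Finset.mem_powerset.2 (Finset.filter_subset _ _)) hcne
    (by
      rintro rfl h
      have hval : ∀ l, l ∈ c → f (pt a l) = m := fun l hl => (Finset.mem_filter.1 hl).2
      obtain ⟨h1, h2, h3, h4, h5⟩ := pentagon_max f
        (fun l => hmax _ (ht.pt_mem_polyhedron l))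
        (h.imp (fun h => ⟨hval _ h.1, hval _ h.2⟩) <| Or.imp (fun h => ⟨hval _ h.1, hval _ h.2⟩) <|
          Or.imp (fun h => ⟨hval _ h.1, hval _ h.2⟩) <| Or.imp (fun h => ⟨hval _ h.1, hval _ h.2⟩)
            fun h => ⟨hval _ h.1, hval _ h.2⟩)
      rw [hc, Finset.filter_eq_self]
      intro l hl
      cases l <;> first | assumption | (exfalso; revert hl; decide))
  refine ⟨-d + d', k, ?_⟩
  have e1 : act (per a d') '' cell a (cellList k : Set Label) = F' := by
    rw [hcell, image_act_cell, (ht.shifts_iff _ _ _).1 hs]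
    rfl
  have e2 : act (per a (-d + d')) = act (per a (-d)) ∘ act (per a d') :=
    funext fun x => act_per_add a _ _ x
  rw [e2, Set.image_comp, e1, hF'def, ← Set.image_comp]
  have e3 : act (per a (-d)) ∘ act (per a d) = id := funext fun x => act_per_neg_act a d x
  rw [e3, Set.image_id]

/-- A cell determines its vertices as extreme points, so equality of translated cells becomes a
`Shifts` relation, settled by the finite check. -/
theorem cell_unique {d d' : ℤ × ℤ} {k k' : Fin 14}
    (h : act (per a d) '' cell a (cellList k : Set Label) =
      act (per a d') '' cell a (cellList k' : Set Label)) : d = d' ∧ k = k' := by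
  have e0 : act (per a (-d' + d)) = act (per a (-d')) ∘ act (per a d) :=
    funext fun x => act_per_add a _ _ x
  have e3 : act (per a (-d')) ∘ act (per a d') = id := funext fun x => act_per_neg_act a d' x
  have e1 : act (per a (-d' + d)) '' cell a (cellList k : Set Label) =
      cell a (cellList k' : Set Label) := by
    rw [e0, Set.image_comp, h, ← Set.image_comp, e3, Set.image_id]
  have e2 : act (per a (-d' + d)) '' (pt a '' (cellList k : Set Label)) =
      pt a '' (cellList k' : Set Label) := by
    rw [← ht.extremePoints_cell, ← ht.extremePoints_cell, ← e1]
    have hLE : act (per a (-d' + d)) = ((LinearEquiv.ofInjectiveEndo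
        (actL (per a (-d' + d))).toLinearMap (fun x y hxy => act_injective (per a (-d' + d)) (by
          rw [← actL_apply, ← actL_apply]; exact hxy))) : Space → Space) :=
      funext fun x => (actL_apply _ x).symm
    rw [hLE]
    exact image_extremePoints _ _
  obtain ⟨hk, hd⟩ := ((ht.shifts_iff _ _ _).2 e2).unique
  exact ⟨by rw [neg_add_eq_zero] at hd; exact hd.symm, hk⟩

/-- The period group is generated by the two operators. -/
theorem mem_periodGroup_iff (g : SL3) :
    g ∈ periodGroup (opM a) (pt a .B) ↔ ∃ d, g = per a d := by
  refine ⟨?_, by rintro ⟨d, rfl⟩; exact ht.per_mem_periodGroup d⟩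
  rintro ⟨hc, hs⟩
  have hc' : Commute g (opM a) := hc
  -- The eigenvalues of g are the eigencoordinates of g B. They are positive since g B lies on the
  -- sail, so g preserves the cone, its integer points and their hull.
  have hcone : ∀ g : SL3, Commute g (opM a) → act g '' sail (opM a) (pt a .B) =
      sail (opM a) (pt a .B) → ∀ x ∈ polyhedron a t, act g x ∈ polyhedron a t := by
    intro g hg hgs x hx
    have hB : pt a .B ∈ sail (opM a) (pt a .B) :=
      (ht.mem_sail_iff _).2 ⟨ht.pt_mem_polyhedron .B, 0, .abg, by
        rw [faceForm_zero, tileForm_pt a .abg (by decide)]⟩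
    have hgB : act g (pt a .B) ∈ sail (opM a) (pt a .B) := hgs ▸ ⟨_, hB, rfl⟩
    have hgB' := ((ht.mem_sail_iff _).1 hgB).1.1
    have hmap : ∀ y ∈ cone a t, act g y ∈ cone a t := fun y hy k => by
      rw [ht.ell_act hg]
      exact mul_pos (hgB' k) (hy k)
    rw [← ht.convexHull_eq_polyhedron] at hx ⊢
    have : act g x ∈ act g '' convexHull ℝ {x | x ∈ cone a t ∧ IsIntegerPoint x} := ⟨x, hx, rfl⟩
    have e : act g = (actL g).toLinearMap := funext fun x => (actL_apply g x).symm
    rw [e, LinearMap.image_convexHull, ← e] at this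
    refine convexHull_mono ?_ this
    rintro _ ⟨y, ⟨hy, hi⟩, rfl⟩
    exact ⟨hmap y hy, hi.act g⟩
  have hg1 := hcone g hc' hs
  have hinv : g⁻¹ ∈ periodGroup (opM a) (pt a .B) :=
    Subgroup.inv_mem _ (show g ∈ periodGroup (opM a) (pt a .B) from ⟨hc, hs⟩)
  have hg2 := hcone g⁻¹ hinv.1 hinv.2
  have hH : act g '' hull (opM a) (pt a .B) = hull (opM a) (pt a .B) := by
    rw [ht.hull_eq]
    apply Set.Subset.antisymm
    · rintro _ ⟨x, hx, rfl⟩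
      exact hg1 x hx
    · exact fun x hx => ⟨_, hg2 x hx, act_act_inv g x⟩
  have hface := act_image_mem_sailFaces hH (ht.pt_mem_sailFaces .B)
  obtain ⟨d, k, e⟩ := ht.exists_cell_of_face hface
  obtain ⟨l, hl⟩ : ∃ l, l ∈ cellList k := by
    clear e; revert k; decide
  have hl' : act (per a d) (pt a l) ∈ act g '' {pt a .B} :=
    e ▸ ⟨_, pt_mem_cell a (c := (cellList k : Set Label)) hl, rfl⟩
  simp only [Set.image_singleton, Set.mem_singleton_iff] at hl'
  -- The eigenvalues of g and g⁻¹ are mutually inverse, and both products are integers. So the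
  -- vertex g B has unit norm, which only the orbit of B allows.
  have hN : (normZ a (coords a (rep l)) : ℝ) * normZ a ((g⁻¹).1 *ᵥ coords a .B) = 1 := by
    rw [← ht.norm_pt l, ← ht.prod_ell_intPt, ← act_intPt, ← pt_eq_intPt]
    have h1 : ∀ k, ell a (t k) (act g⁻¹ (pt a .B)) * ell a (t k) (act g (pt a .B)) = 1 := by
      intro k
      have := ht.ell_act hinv.1 k (act g (pt a .B))
      rw [act_inv_act, ell_base] at this
      exact this.symm
    have h2 : ∀ k, ell a (t k) (act g (pt a .B)) =
        ell a (t k) (pt a .C) ^ d.1 * (t k ^ 2) ^ d.2 * ell a (t k) (pt a l) := fun k => by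
      rw [← hl', ht.ell_per]
    have h3 := ht.prod_mult d
    have g0 := h1 0
    have g1 := h1 1
    have g2 := h1 2
    rw [h2] at g0 g1 g2
    generalize ell a (t 0) (pt a .C) ^ d.1 * (t 0 ^ 2) ^ d.2 = m0 at *
    generalize ell a (t 1) (pt a .C) ^ d.1 * (t 1 ^ 2) ^ d.2 = m1 at *
    generalize ell a (t 2) (pt a .C) ^ d.1 * (t 2 ^ 2) ^ d.2 = m2 at *
    generalize ell a (t 0) (pt a l) = p0 at *
    generalize ell a (t 1) (pt a l) = p1 at *
    generalize ell a (t 2) (pt a l) = p2 at *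
    generalize ell a (t 0) (act g⁻¹ (pt a .B)) = q0 at *
    generalize ell a (t 1) (act g⁻¹ (pt a .B)) = q1 at *
    generalize ell a (t 2) (act g⁻¹ (pt a .B)) = q2 at *
    calc p0 * p1 * p2 * (q0 * q1 * q2) = (m0 * m1 * m2) * (p0 * p1 * p2 * (q0 * q1 * q2)) := by
          rw [h3, one_mul]
      _ = (q0 * (m0 * p0)) * (q1 * (m1 * p1)) * (q2 * (m2 * p2)) := by ring
      _ = 1 := by rw [g0, g1, g2]; norm_num
  have hN' : normZ a (coords a (rep l)) * normZ a ((g⁻¹).1 *ᵥ coords a .B) = 1 := by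
    exact_mod_cast hN
  have hrep : rep l = .B := by
    rcases Int.eq_one_or_neg_one_of_mul_eq_one hN' with h | h
    · have h1 : normZ a (coords a (rep .B)) = 1 := normZ_rep a .B
      exact rep_injective_of_norm (h.trans h1.symm)
    · exfalso
      have ha : (0 : ℤ) ≤ a := Int.natCast_nonneg a
      rw [normZ_rep] at h
      clear hl
      cases l <;> simp only [rep] at h <;> nlinarith
  refine ⟨d + shift l, ht.eq_of_act_base hc' (commute_per_opM a _) ?_⟩
  rw [← hl', pt_eq_act a l, hrep, act_per_add]

end Roots
end SailTorus

namespace SailTorus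

/-! ### Dimensions of the cells -/

theorem faceDim_cell (a : ℕ) (c : Set Label) :
    faceDim (cell a c) = Module.finrank ℝ (vectorSpan ℝ (pt a '' c)) := by
  rw [faceDim, cell, ← direction_affineSpan, affineSpan_convexHull, direction_affineSpan]

theorem faceDim_singleton (a : ℕ) (l : Label) : faceDim (cell a {l}) = 0 := by
  simp [faceDim_cell]

theorem faceDim_pair (a : ℕ) {l l' : Label} (h : pt a l ≠ pt a l') :
    faceDim (cell a {l, l'}) = 1 := by
  have h1 := (affineIndependent_of_ne ℝ h).finrank_vectorSpan (n := 1) (by simp)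
  rw [faceDim_cell, Set.image_pair]
  rwa [show Set.range ![pt a l, pt a l'] = {pt a l, pt a l'} by
    ext x
    simp only [Set.mem_range, Set.mem_insert_iff, Set.mem_singleton_iff, Fin.exists_fin_two]
    simp [eq_comm]] at h1

theorem two_le_finrank {S : Submodule ℝ Space} {u v : Space} (hu : u ∈ S) (hv : v ∈ S)
    (h : u 0 * v 1 - u 1 * v 0 ≠ 0) : 2 ≤ Module.finrank ℝ S := by
  have hli : LinearIndependent ℝ ![u, v] := by
    rw [LinearIndependent.pair_iff]
    intro s t e
    have e0 := congrFun e 0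
    have e1 := congrFun e 1
    simp only [Pi.add_apply, Pi.smul_apply, smul_eq_mul, Pi.zero_apply] at e0 e1
    have hs : s * (u 0 * v 1 - u 1 * v 0) = 0 := by linear_combination v 1 * e0 - v 0 * e1
    have ht : t * (u 0 * v 1 - u 1 * v 0) = 0 := by linear_combination u 0 * e1 - u 1 * e0
    exact ⟨(mul_eq_zero.1 hs).resolve_right h, (mul_eq_zero.1 ht).resolve_right h⟩
  have h1 := finrank_span_eq_card hli
  have h2 : Submodule.span ℝ (Set.range ![u, v]) ≤ S := by
    rw [Submodule.span_le]
    rintro _ ⟨i, rfl⟩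
    fin_cases i
    · exact hu
    · exact hv
  have h3 := Submodule.finrank_mono h2
  rw [h1] at h3
  simpa using h3

/-- Differences of vertices lie in the kernel of a nonzero form, which gives the upper bound; a
nonzero 2 × 2 minor gives the lower one. -/
theorem faceDim_tile {a : ℕ} {c : Set Label} {n : Tile} (hc : ∀ l ∈ c, l ∈ tileCell n)
    {l₀ l₁ l₂ : Label} (h0 : l₀ ∈ c) (h1 : l₁ ∈ c) (h2 : l₂ ∈ c)
    (h : (pt a l₁ - pt a l₀) 0 * (pt a l₂ - pt a l₀) 1 -
      (pt a l₁ - pt a l₀) 1 * (pt a l₂ - pt a l₀) 0 ≠ 0) : faceDim (cell a c) = 2 := by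
  rw [faceDim_cell]
  apply le_antisymm
  · have hne : vectorSpan ℝ (pt a '' c) ≠ ⊤ := by
      intro ht
      have hker : vectorSpan ℝ (pt a '' c) ≤ LinearMap.ker (tileForm a n).toLinearMap := by
        rw [vectorSpan, Submodule.span_le]
        rintro _ ⟨_, ⟨l, hl, rfl⟩, _, ⟨l', hl', rfl⟩, rfl⟩
        simp [tileForm_pt a n (hc l hl), tileForm_pt a n (hc l' hl')]
      have := hker (ht ▸ Submodule.mem_top : pt a l₀ ∈ vectorSpan ℝ (pt a '' c))
      simp [tileForm_pt a n (hc l₀ h0)] at this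
    have := Submodule.finrank_lt hne
    simp at this
    omega
  · exact two_le_finrank (vsub_mem_vectorSpan ℝ ⟨l₁, h1, rfl⟩ ⟨l₀, h0, rfl⟩)
      (vsub_mem_vectorSpan ℝ ⟨l₂, h2, rfl⟩ ⟨l₀, h0, rfl⟩) h

theorem faceDim_vertexCells (a : ℕ) : ∀ c ∈ vertexCells, faceDim (cell a c) = 0 := by
  rintro _ (rfl | rfl | rfl) <;> exact faceDim_singleton a _

theorem Roots.faceDim_edgeCells {a : ℕ} {t : Fin 3 → ℝ} (ht : Roots a t) :
    ∀ c ∈ edgeCells, faceDim (cell a c) = 1 := by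
  have key : ∀ l l' : Label, l ≠ l' → faceDim (cell a {l, l'}) = 1 := fun l l' h =>
    faceDim_pair a (ht.pt_injective.ne h)
  rintro _ (rfl | rfl | rfl | rfl | rfl | rfl | rfl) <;> exact key _ _ (by decide)

theorem faceDim_polygonCells (a : ℕ) : ∀ c ∈ polygonCells, faceDim (cell a c) = 2 := by
  have ha : (0 : ℝ) ≤ a := Nat.cast_nonneg a
  rintro _ (rfl | rfl | rfl | rfl)
  · refine faceDim_tile (n := .abg) (l₀ := .B) (l₁ := .A) (l₂ := .G) ?_ (by simp) (by simp)
      (by simp) ?_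
    · simp [tileCell]
    · apply ne_of_lt
      simp [pt, coords]
      nlinarith
  · refine faceDim_tile (n := .pent) (l₀ := .B) (l₁ := .E) (l₂ := .F) ?_ (by simp [pentagon])
      (by simp [pentagon]) (by simp [pentagon]) ?_
    · simp [pentagon, tileCell]
    · apply ne_of_gt
      simp [pt, coords]
      nlinarith
  · refine faceDim_tile (n := .efc) (l₀ := .E) (l₁ := .F) (l₂ := .C) ?_ (by simp)
      (by simp) (by simp) ?_
    · simp [tileCell]
    · apply ne_of_lt
      simp [pt, coords]
      nlinarith
  · refine faceDim_tile (n := .cdf) (l₀ := .F) (l₁ := .C) (l₂ := .D) ?_ (by simp)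
      (by simp) (by simp) ?_
    · simp [tileCell]
    · apply ne_of_gt
      simp [pt, coords]
      nlinarith

/-! ### Integer points -/

/-- A coordinate of v equal to ±1 forces the parameter of an integer point to be an integer, so
these points are p + kv with 0 < k < n + 1. -/
theorem encard_openSegment_inter (p v : Fin 3 → ℤ) (n : ℕ) (i : Fin 3) (hi : v i * v i = 1) :
    (openSegment ℝ (intPt p) (intPt (p + ((n : ℤ) + 1) • v)) ∩
      {x | IsIntegerPoint x}).encard = n := by
  have hn : (0 : ℝ) < n + 1 := by positivity
  have hi' : (v i * v i : ℝ) = 1 := by exact_mod_cast hi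
  have e : openSegment ℝ (intPt p) (intPt (p + ((n : ℤ) + 1) • v)) ∩ {x | IsIntegerPoint x} =
      (fun k : ℤ => intPt (p + k • v)) '' (Finset.Ioo (0 : ℤ) (n + 1) : Finset ℤ) := by
    ext x
    constructor
    · rintro ⟨hx, hxi⟩
      rw [openSegment_eq_image] at hx
      obtain ⟨θ, ⟨h0, h1⟩, rfl⟩ := hx
      obtain ⟨k, hk⟩ := hxi i
      simp [intPt] at hk
      have hθ : θ * (n + 1) = ((v i * (k - p i) : ℤ) : ℝ) := by
        push_cast
        rw [← hk]
        linear_combination -(θ * (n + 1)) * hi'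
      refine ⟨v i * (k - p i), ?_, ?_⟩
      · rw [Finset.coe_Ioo]
        constructor
        · have : (0 : ℝ) < ((v i * (k - p i) : ℤ) : ℝ) := hθ ▸ mul_pos h0 hn
          exact_mod_cast this
        · have : ((v i * (k - p i) : ℤ) : ℝ) < n + 1 := by
            rw [← hθ]
            exact mul_lt_of_lt_one_left hn h1
          exact_mod_cast this
      · ext j
        simp only [intPt, Pi.add_apply, Pi.smul_apply, smul_eq_mul]
        rw [Int.cast_add, Int.cast_mul, ← hθ]
        push_cast
        ring
    · rintro ⟨k, hk, rfl⟩
      rw [Finset.coe_Ioo] at hk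
      have h0 : (0 : ℝ) < k := by exact_mod_cast hk.1
      have h1 : (k : ℝ) < n + 1 := by exact_mod_cast hk.2
      refine ⟨?_, fun j => ⟨_, rfl⟩⟩
      rw [openSegment_eq_image]
      refine ⟨k / (n + 1), ⟨div_pos h0 hn, (div_lt_one hn).2 h1⟩, ?_⟩
      ext j
      simp only [intPt, Pi.add_apply, Pi.smul_apply, smul_eq_mul]
      push_cast
      field_simp
      ring
  rw [e, Set.InjOn.encard_image, Set.encard_coe_eq_coe_finsetCard, Int.card_Ioo]
  · congr 1
    omega
  · intro k _ k' _ h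
    have := congrFun (intPt_injective h) i
    simp only [Pi.add_apply, Pi.smul_apply, smul_eq_mul] at this
    have h2 : (k - k') * (v i * v i) = 0 := by linear_combination v i * this
    rw [hi] at h2
    omega

theorem encard_openSegment_BG (a : ℕ) :
    (openSegment ℝ (pt a .B) (pt a .G) ∩ {x | IsIntegerPoint x}).encard = a := by
  have e : coords a .G = coords a .B + ((a : ℤ) + 1) • ![(0 : ℤ), -1, 2 * a + 3] := by
    ext i
    fin_cases i <;> simp [coords] <;> ring
  rw [pt_eq_intPt, pt_eq_intPt, e]
  exact encard_openSegment_inter (coords a .B) ![0, -1, 2 * a + 3] a 1 (by simp)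

theorem encard_openSegment_DF (a : ℕ) :
    (openSegment ℝ (pt a .D) (pt a .F) ∩ {x | IsIntegerPoint x}).encard = a := by
  have e : coords a .F = coords a .D + ((a : ℤ) + 1) • ![(-1 : ℤ), 1, -((a : ℤ) + 2)] := by
    ext i
    fin_cases i <;> simp [coords] <;> ring
  rw [pt_eq_intPt, pt_eq_intPt, e]
  exact encard_openSegment_inter (coords a .D) ![-1, 1, -(a + 2)] a 1 (by simp)

theorem exists_extend_of_mem_intrinsicInterior {s : Set Space} {x y : Space}
    (hx : x ∈ intrinsicInterior ℝ s) (hy : y ∈ s) : ∃ ε : ℝ, 0 < ε ∧ x + ε • (x - y) ∈ s := by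
  obtain ⟨z, hz, rfl⟩ := mem_intrinsicInterior.1 hx
  have hmem : ∀ ε : ℝ, (z : Space) + ε • ((z : Space) - y) ∈ affineSpan ℝ s := fun ε => by
    have := AffineMap.lineMap_mem (-ε) z.2 (subset_affineSpan ℝ s hy)
    convert this using 1
    rw [AffineMap.lineMap_apply, vsub_eq_sub, vadd_eq_add, add_comm]
    congr 1
    rw [neg_smul, ← smul_neg, neg_sub]
  have hc : Continuous fun ε : ℝ => (⟨_, hmem ε⟩ : affineSpan ℝ s) := by
    apply Continuous.subtype_mk
    fun_prop
  have h1 : ∀ᶠ ε in nhds (0 : ℝ), (⟨_, hmem ε⟩ : affineSpan ℝ s) ∈ ((↑) ⁻¹' s : Set (affineSpan ℝ s)) := by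
    have e : (⟨(z : Space) + (0 : ℝ) • ((z : Space) - y), hmem 0⟩ : affineSpan ℝ s) = z :=
      Subtype.ext (by simp)
    have h := hc.tendsto 0
    rw [e] at h
    exact h (mem_interior_iff_mem_nhds.1 hz)
  obtain ⟨ε, h, hε⟩ := ((h1.filter_mono nhdsWithin_le_nhds).and
    (self_mem_nhdsWithin (s := Set.Ioi (0 : ℝ)))).exists
  exact ⟨ε, hε, h⟩

/-- The affine span of s lies in the plane f = 1, so a neighbourhood within that plane is a
neighbourhood in the span. -/
theorem mem_intrinsicInterior_of_isOpen {s U : Set Space} {f : Space →L[ℝ] ℝ}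
    (hf : ∀ x ∈ s, f x = 1) (hU : IsOpen U) (h : ∀ x ∈ U, f x = 1 → x ∈ s) {x : Space}
    (hxU : x ∈ U) (hx : f x = 1) : x ∈ intrinsicInterior ℝ s := by
  have hspan : ∀ y ∈ affineSpan ℝ s, f y = 1 := by
    intro y hy
    have hxs := h x hxU hx
    have h1 : y - x ∈ vectorSpan ℝ s := by
      rw [← direction_affineSpan]
      exact AffineSubspace.vsub_mem_direction hy (subset_affineSpan ℝ s hxs)
    have hker : vectorSpan ℝ s ≤ LinearMap.ker f.toLinearMap := by
      rw [vectorSpan, Submodule.span_le]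
      rintro _ ⟨u, hu, v, hv, rfl⟩
      simp [hf u hu, hf v hv]
    have h2 := hker h1
    simp only [LinearMap.mem_ker, ContinuousLinearMap.coe_coe, map_sub, hx] at h2
    linarith
  refine mem_intrinsicInterior.2 ⟨⟨x, subset_affineSpan ℝ s (h x hxU hx)⟩, ?_, rfl⟩
  refine mem_interior.2 ⟨Subtype.val ⁻¹' U, fun y hy => h y hy (hspan y y.2), ?_, hxU⟩
  exact hU.preimage continuous_subtype_val

/-- The forms vanishing on the sides of the pentagon. -/
noncomputable def sideForm (a : ℕ) : Fin 5 → (Space →L[ℝ] ℝ) :=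
  ![lin (-1) (-2) 0, lin 1 2 1, lin (a ^ 2 + 3 * a + 3) (2 * a ^ 2 + 7 * a + 7) (a + 2),
    lin (a ^ 3 + 4 * a ^ 2 + 6 * a + 3) (2 * a ^ 3 + 9 * a ^ 2 + 14 * a + 8) (a ^ 2 + 3 * a + 2),
    lin (-1) 0 0]

theorem sideForm_pt_nonneg (a : ℕ) (k : Fin 5) {l : Label} (hl : l ∈ pentagon) :
    0 ≤ sideForm a k (pt a l) := by
  have ha : (0 : ℝ) ≤ a := Nat.cast_nonneg a
  fin_cases k <;> cases l <;> simp [pentagon] at hl <;>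
    simp [sideForm, lin_apply, pt, coords] <;> nlinarith [mul_nonneg ha ha]

theorem exists_sideForm_pt_pos (a : ℕ) (k : Fin 5) : ∃ l ∈ pentagon, 0 < sideForm a k (pt a l) := by
  have ha : (0 : ℝ) ≤ a := Nat.cast_nonneg a
  fin_cases k
  · exact ⟨.G, by simp [pentagon], by simp [sideForm, lin_apply, pt, coords]; nlinarith⟩
  · exact ⟨.B, by simp [pentagon], by simp [sideForm, lin_apply, pt, coords]⟩
  · exact ⟨.B, by simp [pentagon], by simp [sideForm, lin_apply, pt, coords]; nlinarith⟩
  · exact ⟨.B, by simp [pentagon], by simp [sideForm, lin_apply, pt, coords]; nlinarith⟩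
  · exact ⟨.E, by simp [pentagon], by simp [sideForm, lin_apply, pt, coords]⟩

theorem tileForm_eq_one_of_mem_cell_pentagon {a : ℕ} {x : Space} (hx : x ∈ cell a pentagon) :
    tileForm a .pent x = 1 :=
  form_eq_one_of_mem_cell (fun l hl => tileForm_pt a .pent (by
    simpa [pentagon, tileCell] using hl)) hx

theorem mem_cell_pentagon_iff {a : ℕ} {x : Space} : x ∈ cell a pentagon ↔
    tileForm a .pent x = 1 ∧ ∀ k, 0 ≤ sideForm a k x := by
  constructor
  · intro hx
    refine ⟨tileForm_eq_one_of_mem_cell_pentagon hx, fun k => ?_⟩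
    obtain ⟨w, h1, h2, h3, rfl⟩ := (mem_cell_iff a _ x).1 hx
    rw [map_sum]
    refine Finset.sum_nonneg fun l _ => ?_
    rw [map_smul, smul_eq_mul]
    by_cases hl : l ∈ pentagon
    · exact mul_nonneg (h1 l) (sideForm_pt_nonneg a k hl)
    · rw [h2 l hl, zero_mul]
  · rintro ⟨h1, hk⟩
    obtain ⟨τ, hτ, w, hw, e⟩ := exists_weight_pentagon (a := a) (y := x) (hk 0) (hk 1) (hk 2)
      (hk 3) (by simpa [sideForm, lin_apply] using hk 4)
    refine (mem_cell_iff a _ x).2 ⟨w, hw.nonneg, fun l hl => hw.supp l fun h => hl ?_, ?_, e⟩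
    · have := triCell_subset τ h
      rw [hτ] at this
      simpa [pentagon, tileCell] using this
    · rw [← tileForm_sum (a := a) hw, hτ, ← e, h1]

/-- If a side form vanished at a relative interior point, moving away from a vertex where the form
is positive would make it negative inside the pentagon. -/
theorem mem_intrinsicInterior_pentagon_iff {a : ℕ} {x : Space} :
    x ∈ intrinsicInterior ℝ (cell a pentagon) ↔
      tileForm a .pent x = 1 ∧ ∀ k, 0 < sideForm a k x := by
  constructor
  · intro hx
    have hx' := mem_cell_pentagon_iff.1 (intrinsicInterior_subset hx)
    refine ⟨hx'.1, fun k => ?_⟩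
    obtain ⟨l, hl, hpos⟩ := exists_sideForm_pt_pos a k
    obtain ⟨ε, hε, h⟩ := exists_extend_of_mem_intrinsicInterior hx (pt_mem_cell a hl)
    have h2 := (mem_cell_pentagon_iff.1 h).2 k
    rw [map_add, map_smul, map_sub, smul_eq_mul] at h2
    by_contra hc
    have h3 : sideForm a k x = 0 := le_antisymm (not_lt.1 hc) (hx'.2 k)
    rw [h3] at h2
    nlinarith [mul_pos hε hpos]
  · rintro ⟨h1, hk⟩
    refine mem_intrinsicInterior_of_isOpen (f := tileForm a .pent) (U := {y | ∀ k, 0 < sideForm a k y})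
      (fun y hy => tileForm_eq_one_of_mem_cell_pentagon hy) ?_
      (fun y hy hy1 => mem_cell_pentagon_iff.2 ⟨hy1, fun k => (hy k).le⟩) hk h1
    rw [Set.setOf_forall]
    exact isOpen_iInter_of_finite fun k => isOpen_lt continuous_const (sideForm a k).continuous

/-- Integer points of the plane of the pentagon. -/
def pentPt (a : ℕ) (i j : ℤ) : Space := ![-j, -i + j, (2 * a + 3) * i - (a + 2) * j + 1]

/-- In the lattice coordinates i, j of the plane, the sides BE, FD and GB already give the stated
range; for integers the inequalities of EF and DG then follow. -/
theorem pentPt_mem_iff (a : ℕ) (i j : ℤ) : pentPt a i j ∈ intrinsicInterior ℝ (cell a pentagon) ↔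
    1 ≤ i ∧ i ≤ a + 1 ∧ 1 ≤ j ∧ j ≤ 2 * i - 1 := by
  have e0 : sideForm a 0 (pentPt a i j) = ((2 * i - j : ℤ) : ℝ) := by
    simp [sideForm, lin_apply, pentPt]; ring
  have e1 : sideForm a 1 (pentPt a i j) = (((2 * a + 1) * i - (a + 1) * j + 1 : ℤ) : ℝ) := by
    simp [sideForm, lin_apply, pentPt]; ring
  have e2 : sideForm a 2 (pentPt a i j) = ((a + 2 - i : ℤ) : ℝ) := by
    simp [sideForm, lin_apply, pentPt]; ring
  have e3 : sideForm a 3 (pentPt a i j) = (((a + 1) * (a + 2) - (a + 2) * i + j : ℤ) : ℝ) := by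
    simp [sideForm, lin_apply, pentPt]; ring
  have e4 : sideForm a 4 (pentPt a i j) = (j : ℝ) := by
    simp [sideForm, lin_apply, pentPt]
  have ef : tileForm a .pent (pentPt a i j) = 1 := by
    simp [tileForm, lin_apply, pentPt]; ring
  rw [mem_intrinsicInterior_pentagon_iff]
  constructor
  · rintro ⟨-, h⟩
    have h0 := h 0
    have h2 := h 2
    have h4 := h 4
    rw [e0, Int.cast_pos] at h0
    rw [e2, Int.cast_pos] at h2
    rw [e4, Int.cast_pos] at h4
    omega
  · rintro ⟨h1, h2, h3, h4⟩
    refine ⟨ef, fun k => ?_⟩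
    have ha : (0 : ℤ) ≤ a := Int.natCast_nonneg a
    fin_cases k <;> simp only [Fin.zero_eta, Fin.mk_one, Fin.reduceFinMk]
    · rw [e0, Int.cast_pos]; omega
    · rw [e1, Int.cast_pos]; nlinarith
    · rw [e2, Int.cast_pos]; omega
    · rw [e3, Int.cast_pos]; nlinarith
    · rw [e4, Int.cast_pos]; omega

theorem intrinsicInterior_pentagon_inter (a : ℕ) :
    intrinsicInterior ℝ (cell a pentagon) ∩ {x | IsIntegerPoint x} =
      {x | ∃ i j : ℤ, 1 ≤ i ∧ i ≤ a + 1 ∧ 1 ≤ j ∧ j ≤ 2 * i - 1 ∧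
        x = ![(-j : ℝ), -i + j, (2 * a + 3) * i - (a + 2) * j + 1]} := by
  ext x
  constructor
  · rintro ⟨hx, hi⟩
    obtain ⟨z, rfl⟩ := (isIntegerPoint_iff x).1 hi
    have h1 := (mem_intrinsicInterior_pentagon_iff.1 hx).1
    have e : intPt z = pentPt a (-z 0 - z 1) (-z 0) := by
      simp [tileForm, lin_apply, intPt] at h1
      ext k
      fin_cases k <;> simp [intPt, pentPt]
      linear_combination h1
    rw [e] at hx ⊢
    obtain ⟨h1, h2, h3, h4⟩ := (pentPt_mem_iff a _ _).1 hx
    exact ⟨_, _, h1, h2, h3, h4, rfl⟩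
  · rintro ⟨i, j, h1, h2, h3, h4, rfl⟩
    refine ⟨(pentPt_mem_iff a i j).2 ⟨h1, h2, h3, h4⟩, fun k => ?_⟩
    fin_cases k
    · exact ⟨-j, by simp⟩
    · exact ⟨-i + j, by simp⟩
    · exact ⟨(2 * a + 3) * i - (a + 2) * j + 1, by simp⟩

theorem encard_intrinsicInterior_pentagon_inter (a : ℕ) :
    (intrinsicInterior ℝ (cell a pentagon) ∩ {x | IsIntegerPoint x}).encard =
      ((a + 1) ^ 2 : ℕ) := by
  have e : intrinsicInterior ℝ (cell a pentagon) ∩ {x | IsIntegerPoint x} =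
      (fun q : (_ : ℕ) × ℕ => pentPt a (q.1 + 1) (q.2 + 1)) ''
        ((Finset.range (a + 1)).sigma fun i => Finset.range (2 * i + 1) : Finset ((_ : ℕ) × ℕ)) := by
    rw [intrinsicInterior_pentagon_inter]
    ext x
    simp only [Set.mem_setOf_eq, Set.mem_image, Finset.mem_coe, Finset.mem_sigma, Finset.mem_range]
    constructor
    · rintro ⟨i, j, h1, h2, h3, h4, rfl⟩
      refine ⟨⟨(i - 1).toNat, (j - 1).toNat⟩, ⟨by simp only; omega, by simp only; omega⟩, ?_⟩
      rw [Int.toNat_of_nonneg (by omega), Int.toNat_of_nonneg (by omega), sub_add_cancel,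
        sub_add_cancel]
      rfl
    · rintro ⟨⟨i, j⟩, ⟨h1, h2⟩, rfl⟩
      simp only at h1 h2
      exact ⟨i + 1, j + 1, by omega, by omega, by omega, by omega, rfl⟩
  rw [e, Set.InjOn.encard_image, Set.encard_coe_eq_coe_finsetCard, Finset.card_sigma]
  · congr 1
    simp only [Finset.card_range]
    -- Row i contributes 2i - 1 points, and the first n odd numbers sum to n².
    generalize a + 1 = n
    induction n with
    | zero => rfl
    | succ n ih => rw [Finset.sum_range_succ, ih]; ring
  · rintro ⟨i, j⟩ _ ⟨i', j'⟩ _ h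
    have h0 := congrFun h 0
    have h1 := congrFun h 1
    simp [pentPt] at h0 h1
    subst h0
    simpa using h1

end SailTorus

namespace SailTorus

instance : DecidableEq Tri := fun x y => by
  cases x <;> cases y <;> first | exact isTrue rfl | exact isFalse (by intro h; cases h)

instance : Fintype Tri := ⟨{.abg, .gbe, .gef, .gfd, .efc, .cdf}, fun x => by cases x <;> decide⟩

/-! ### Uniqueness of weights on the sail -/

theorem lin_sum (a : ℕ) (u : Label → ℝ) (p q r : ℝ) : lin p q r (∑ l, u l • pt a l) =
    u .A * (p - q * (2 * a + 3) + r * (4 * a ^ 2 + 11 * a + 10)) + u .B * r +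
    u .C * (-p * (4 * a + 11) + q * (2 * a + 5) - r * (a + 2)) +
    u .D * (-p * (a + 2) + r * (a ^ 2 + 3 * a + 3)) + u .E * (-2 * p + q) +
    u .F * (-p * (2 * a + 3) + q * (a + 1) + r) +
    u .G * (-q * (a + 1) + r * (2 * a ^ 2 + 5 * a + 4)) := by
  rw [map_sum, sum_label]
  simp [lin_apply, pt, coords]
  ring

/-- The vertices of a triangle are linearly independent: the form of each side vanishes at its two
ends and isolates the weight of the opposite vertex. -/
theorem eq_zero_of_sum_eq_zero {a : ℕ} {τ : Tri} {u : Label → ℝ}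
    (hu : ∀ l, l ∉ triCell τ → u l = 0) (h : ∑ l, u l • pt a l = 0) : u = 0 := by
  have e := fun p q r => lin_sum a u p q r
  simp only [h, map_zero] at e
  have ha : (0 : ℝ) ≤ a := Nat.cast_nonneg a
  have h1 : (a : ℝ) + 1 ≠ 0 := by positivity
  have h3 : (a : ℝ) + 3 ≠ 0 := by positivity
  have h4 : (2 * a ^ 2 + 3 * a + 2 : ℝ) ≠ 0 := by positivity
  have z : ∀ {x c : ℝ}, c ≠ 0 → c * x = 0 → x = 0 := fun hc h => (mul_eq_zero.1 h).resolve_left hc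
  have f : ∀ {l : Label}, l ∉ triCell τ → u l = 0 := fun {l} h => hu l h
  funext l
  show u l = 0
  cases τ
  · have sC : u .C = 0 := f (by decide)
    have sD : u .D = 0 := f (by decide)
    have sE : u .E = 0 := f (by decide)
    have sF : u .F = 0 := f (by decide)
    simp only [sC, sD, sE, sF, zero_mul, add_zero] at e
    cases l
    · linear_combination -e 1 0 0
    · exact z h1 (by linear_combination -e (a ^ 2 + 2 * a + 2) (2 * a ^ 2 + 5 * a + 4) (a + 1))
    · exact sC
    · exact sD
    · exact sE
    · exact sF
    · exact z h1 (by linear_combination -e (-(2 * a + 3)) (-1) 0)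
  · have sA : u .A = 0 := f (by decide)
    have sC : u .C = 0 := f (by decide)
    have sD : u .D = 0 := f (by decide)
    have sF : u .F = 0 := f (by decide)
    simp only [sA, sC, sD, sF, zero_mul, add_zero, zero_add] at e
    cases l
    · exact sA
    · exact z h1 (by
        linear_combination -(1 / 2) * e (2 * a ^ 2 + 5 * a + 4)
          (4 * a ^ 2 + 10 * a + 8) (2 * a + 2))
    · exact sC
    · exact sD
    · linear_combination (1 / 2) * e 1 0 0
    · exact sF
    · exact z h1 (by linear_combination (1 / 2) * e 1 2 0)
  · have sA : u .A = 0 := f (by decide)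
    have sB : u .B = 0 := f (by decide)
    have sC : u .C = 0 := f (by decide)
    have sD : u .D = 0 := f (by decide)
    simp only [sA, sB, sC, sD, zero_mul, add_zero, zero_add] at e
    cases l
    · exact sA
    · exact sB
    · exact sC
    · exact sD
    · exact z h4 (by
        linear_combination -e (2 * a ^ 3 + 7 * a ^ 2 + 10 * a + 5)
          (4 * a ^ 3 + 16 * a ^ 2 + 23 * a + 12) (2 * a ^ 2 + 5 * a + 3))
    · exact z h4 (by
        linear_combination e (2 * a ^ 2 + 5 * a + 4)
          (4 * a ^ 2 + 10 * a + 8) (2 * a + 2))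
    · exact z h4 (by linear_combination -e 1 2 1)
  · have sA : u .A = 0 := f (by decide)
    have sB : u .B = 0 := f (by decide)
    have sC : u .C = 0 := f (by decide)
    have sE : u .E = 0 := f (by decide)
    simp only [sA, sB, sC, sE, zero_mul, add_zero, zero_add] at e
    cases l
    · exact sA
    · exact sB
    · exact sC
    · exact z h1 (by
        linear_combination e (2 * a ^ 3 + 7 * a ^ 2 + 10 * a + 5)
          (4 * a ^ 3 + 16 * a ^ 2 + 23 * a + 12) (2 * a ^ 2 + 5 * a + 3))
    · exact sE
    · exact z h1 (by
        linear_combination -e (a ^ 3 + 4 * a ^ 2 + 6 * a + 3)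
          (2 * a ^ 3 + 9 * a ^ 2 + 14 * a + 8) (a ^ 2 + 3 * a + 2))
    · linear_combination -e (a ^ 2 + 3 * a + 3) (2 * a ^ 2 + 7 * a + 7) (a + 2)
  · have sA : u .A = 0 := f (by decide)
    have sB : u .B = 0 := f (by decide)
    have sD : u .D = 0 := f (by decide)
    have sG : u .G = 0 := f (by decide)
    simp only [sA, sB, sD, sG, zero_mul, add_zero, zero_add] at e
    cases l
    · exact sA
    · exact sB
    · exact z h3 (by linear_combination e 1 2 1)
    · exact sD
    · exact z h3 (by linear_combination -e (a ^ 2 + 5 * a + 7) (2 * a ^ 2 + 11 * a + 17) (a + 4))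
    · exact z h3 (by linear_combination -e (-(a + 2)) (-(2 * a + 4)) 1)
    · exact sG
  · have sA : u .A = 0 := f (by decide)
    have sB : u .B = 0 := f (by decide)
    have sE : u .E = 0 := f (by decide)
    have sG : u .G = 0 := f (by decide)
    simp only [sA, sB, sE, sG, zero_mul, add_zero, zero_add] at e
    cases l
    · exact sA
    · exact sB
    · linear_combination (1 / 2) * e (a ^ 2 + 3 * a + 3) (2 * a ^ 2 + 7 * a + 7) (a + 2)
    · exact z h1 (by
        linear_combination (1 / 2) * e (a ^ 2 + 5 * a + 7)
          (2 * a ^ 2 + 11 * a + 17) (a + 4))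
    · exact sE
    · exact z h1 (by
        linear_combination -(1 / 2) * e (2 * a ^ 3 + 11 * a ^ 2 + 21 * a + 15)
          (4 * a ^ 3 + 24 * a ^ 2 + 49 * a + 37) (2 * a ^ 2 + 9 * a + 10))
    · exact sG

/-- Complementary nonnegative numbers are determined by their difference. -/
theorem eq_of_complementary {p q p' q' : ℝ} (hp : 0 ≤ p) (hq : 0 ≤ q) (hp' : 0 ≤ p') (hq' : 0 ≤ q')
    (h : p = 0 ∨ q = 0) (h' : p' = 0 ∨ q' = 0) (e : p - q = p' - q') : p = p' ∧ q = q' := by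
  rcases h with h | h <;> rcases h' with h' | h' <;> constructor <;> linarith

/-- The only difficulty is a point of the pentagon described by two different triangles. The
diagonals GE and GF give differences of complementary nonnegative quantities, which determine the
weights at B and D. What is left of w - w' lives on the middle triangle GEF. -/
theorem IsWeight.eq_of_sum_eq {a : ℕ} {τ τ' : Tri} {w w' : Label → ℝ} (hw : IsWeight τ w)
    (hw' : IsWeight τ' w') (hτ : triTile τ = triTile τ')
    (h : ∑ l, w l • pt a l = ∑ l, w' l • pt a l) : w = w' := by
  have hu : ∑ l, (w - w') l • pt a l = 0 := by
    simp only [Pi.sub_apply, sub_smul, Finset.sum_sub_distrib, h, sub_self]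
  suffices hs : ∃ τ'', ∀ l, l ∉ triCell τ'' → (w - w') l = 0 by
    obtain ⟨τ'', hs⟩ := hs
    exact sub_eq_zero.1 (eq_zero_of_sum_eq_zero hs hu)
  by_cases hp : triTile τ = .pent
  · refine ⟨.gef, ?_⟩
    have e : ∀ p q r, _ := fun p q r => (lin_sum a w p q r).symm.trans
      ((congrArg (lin p q r) h).trans (lin_sum a w' p q r))
    have key : ∀ {τ : Tri} {w : Label → ℝ}, IsWeight τ w → triTile τ = .pent →
        w .A = 0 ∧ w .C = 0 ∧ (w .B = 0 ∨ w .F = 0 ∧ w .D = 0) ∧ (w .D = 0 ∨ w .B = 0 ∧ w .E = 0) := by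
      intro τ w hw hp
      have f : ∀ {l : Label}, l ∉ triCell τ → w l = 0 := fun {l} h => hw.supp l h
      cases τ <;> simp [triTile] at hp
      · exact ⟨f (by decide), f (by decide), .inr ⟨f (by decide), f (by decide)⟩,
          .inl (f (by decide))⟩
      · exact ⟨f (by decide), f (by decide), .inl (f (by decide)), .inl (f (by decide))⟩
      · exact ⟨f (by decide), f (by decide), .inl (f (by decide)),
          .inr ⟨f (by decide), f (by decide)⟩⟩
    obtain ⟨hA, hC, hB, hD⟩ := key hw hp
    obtain ⟨hA', hC', hB', hD'⟩ := key hw' (hτ ▸ hp)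
    simp only [hA, hC, hA', hC', zero_mul, zero_add, add_zero] at e
    have n := hw.nonneg
    have n' := hw'.nonneg
    have nB := n .B
    have nD := n .D
    have nE := n .E
    have nF := n .F
    have nB' := n' .B
    have nD' := n' .D
    have nE' := n' .E
    have nF' := n' .F
    obtain ⟨eB, -⟩ := eq_of_complementary (p := (2 * a + 2) * w .B) (p' := (2 * a + 2) * w' .B)
      (q := (2 * a ^ 2 + 3 * a + 2) * w .F + (a ^ 2 + 2 * a + 2) * w .D)
      (q' := (2 * a ^ 2 + 3 * a + 2) * w' .F + (a ^ 2 + 2 * a + 2) * w' .D)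
      (by positivity) (by positivity) (by positivity) (by positivity)
      (hB.imp (fun h => by rw [h, mul_zero]) fun h => by rw [h.1, h.2]; ring)
      (hB'.imp (fun h => by rw [h, mul_zero]) fun h => by rw [h.1, h.2]; ring)
      (by linear_combination e (2 * a ^ 2 + 5 * a + 4) (4 * a ^ 2 + 10 * a + 8) (2 * a + 2))
    obtain ⟨eD, -⟩ := eq_of_complementary (p := (a + 1) * w .D) (p' := (a + 1) * w' .D)
      (q := (2 * a ^ 2 + 5 * a + 3) * w .B + (2 * a ^ 2 + 3 * a + 2) * w .E)
      (q' := (2 * a ^ 2 + 5 * a + 3) * w' .B + (2 * a ^ 2 + 3 * a + 2) * w' .E)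
      (by positivity) (by positivity) (by positivity) (by positivity)
      (hD.imp (fun h => by rw [h, mul_zero]) fun h => by rw [h.1, h.2]; ring)
      (hD'.imp (fun h => by rw [h, mul_zero]) fun h => by rw [h.1, h.2]; ring)
      (by
          linear_combination -e (2 * a ^ 3 + 7 * a ^ 2 + 10 * a + 5)
            (4 * a ^ 3 + 16 * a ^ 2 + 23 * a + 12) (2 * a ^ 2 + 5 * a + 3))
    have eB1 := mul_left_cancel₀ (by positivity) eB
    have eD1 := mul_left_cancel₀ (by positivity) eD
    intro l hl
    rw [Pi.sub_apply, sub_eq_zero]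
    cases l <;> first
      | exact hA.trans hA'.symm
      | exact hC.trans hC'.symm
      | exact eB1
      | exact eD1
      | exact absurd (by decide) hl
  · refine ⟨τ, fun l hl => ?_⟩
    have hττ : τ = τ' := by
      clear h hu hw hw' hl
      revert τ τ'
      decide
    rw [Pi.sub_apply, hw.supp l hl, hw'.supp l (hττ ▸ hl), sub_zero]

/-! ### Transport of weights by periods -/

/-- Weights of total mass one on the vertices of some triangle. -/
def weights : Set (Label → ℝ) := {w | (∃ τ, IsWeight τ w) ∧ ∑ l, w l = 1}

/-- The period `d` moves the vertex `l` to the vertex `l'`. -/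
def Moves (d : ℤ × ℤ) (l l' : Label) : Prop := rep l = rep l' ∧ d + shift l = shift l'

instance (d : ℤ × ℤ) (l l' : Label) : Decidable (Moves d l l') :=
  inferInstanceAs (Decidable (_ ∧ _))

theorem eq_of_rep_shift : ∀ l l' : Label, rep l = rep l' → shift l = shift l' → l = l' := by
  decide

theorem Moves.left_unique {d : ℤ × ℤ} {l m l' : Label} (h : Moves d l l') (h' : Moves d m l') :
    l = m :=
  eq_of_rep_shift _ _ (h.1.trans h'.1.symm) (add_left_cancel (h.2.trans h'.2.symm))

theorem Moves.right_unique {d : ℤ × ℤ} {l l' m' : Label} (h : Moves d l l') (h' : Moves d l m') :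
    l' = m' :=
  eq_of_rep_shift _ _ (h.1.symm.trans h'.1) (h.2.symm.trans h'.2)

/-- The period `d` moves the weights `w` to the weights `w'`. -/
def Transfers (d : ℤ × ℤ) (w w' : Label → ℝ) : Prop :=
  ∀ l, w l ≠ 0 → ∃ l', Moves d l l' ∧ w' l' = w l

/-- A period moves labels injectively, so the hypotheses match the two supports bijectively and the
sum is reindexed. The target V is general because the lemma serves both for the sail and for the
plane model. -/
theorem Transfers.sum_smul_of_cover {V : Type*} [AddCommGroup V] [Module ℝ V] {d : ℤ × ℤ}
    {w w' : Label → ℝ} (h : Transfers d w w')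
    (hc : ∀ l', w' l' ≠ 0 → ∃ l, Moves d l l' ∧ w l ≠ 0)
    {φ ψ : Label → V} (hφ : ∀ l l', Moves d l l' → φ l = ψ l') :
    ∑ l, w l • φ l = ∑ l, w' l • ψ l := by
  classical
  choose σ hσ using h
  refine Finset.sum_bij_ne_zero (fun l _ hl => σ l fun h0 => hl (by rw [h0, zero_smul]))
    (fun _ _ _ => Finset.mem_univ _) ?_ ?_ ?_
  · intro l _ hl m _ hm e
    have h1 := (hσ l fun h0 => hl (by rw [h0, zero_smul])).1
    have h2 := (hσ m fun h0 => hm (by rw [h0, zero_smul])).1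
    rw [e] at h1
    exact h1.left_unique h2
  · intro l' _ hl'
    obtain ⟨l, hm, hl⟩ := hc l' fun h0 => hl' (by rw [h0, zero_smul])
    have e := (hσ l hl).1.right_unique hm
    refine ⟨l, Finset.mem_univ l, ?_, e⟩
    rw [hφ _ _ hm, ← (hσ l hl).2, e]
    exact hl'
  · intro l _ hl
    have h1 := hσ l fun h0 => hl (by rw [h0, zero_smul])
    exact congrArg₂ (· • ·) h1.2.symm (hφ _ _ h1.1)

/-- Conservation of mass: the labels reached already carry total weight 1, so no weight is left
elsewhere. -/
theorem Transfers.cover {d : ℤ × ℤ} {w w' : Label → ℝ} (h : Transfers d w w') (hw' : ∀ l, 0 ≤ w' l)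
    (hs : ∑ l, w l = 1) (hs' : ∑ l, w' l = 1) (l' : Label) (hl' : w' l' ≠ 0) :
    ∃ l, Moves d l l' ∧ w l ≠ 0 := by
  classical
  by_contra hc
  push Not at hc
  choose σ hσ using h
  have h1 : ∑ l, w l ≤ ∑ l ∈ Finset.univ.erase l', w' l := by
    set v : Label → ℝ := fun m => if ∃ l, Moves d l m ∧ w l ≠ 0 then w' m else 0 with hv
    have e : ∑ l, w l • (1 : ℝ) = ∑ l, v l • (1 : ℝ) := by
      refine Transfers.sum_smul_of_cover (d := d) (φ := fun _ => 1) (ψ := fun _ => 1) ?_ ?_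
        (fun _ _ _ => rfl)
      · intro l hl
        refine ⟨σ l hl, (hσ l hl).1, ?_⟩
        rw [hv]
        simp only
        rw [if_pos ⟨l, (hσ l hl).1, hl⟩, (hσ l hl).2]
      · intro m hm
        by_contra h0
        exact hm (if_neg h0)
    simp only [smul_eq_mul, mul_one] at e
    rw [e, ← Finset.add_sum_erase _ v (Finset.mem_univ l')]
    have : v l' = 0 := if_neg fun ⟨l, h, h'⟩ => h' (hc l h)
    rw [this, zero_add]
    refine Finset.sum_le_sum fun m _ => ?_
    rw [hv]
    simp only
    split_ifs
    · exact le_rfl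
    · exact hw' m
  have h2 := Finset.add_sum_erase _ w' (Finset.mem_univ l')
  have h3 := lt_of_le_of_ne (hw' l') hl'.symm
  linarith

theorem Transfers.sum_smul {V : Type*} [AddCommGroup V] [Module ℝ V] {d : ℤ × ℤ}
    {w w' : Label → ℝ} (h : Transfers d w w') (hw : w ∈ weights) (hw' : w' ∈ weights)
    {φ ψ : Label → V} (hφ : ∀ l l', Moves d l l' → φ l = ψ l') :
    ∑ l, w l • φ l = ∑ l, w' l • ψ l := by
  obtain ⟨τ', hτ'⟩ := hw'.1
  exact h.sum_smul_of_cover (h.cover hτ'.nonneg hw.2 hw'.2) hφ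

set_option synthInstance.maxHeartbeats 200000 in
set_option synthInstance.maxSize 1024 in
/-- Faces of triangles which are moved into a polygon are moved into a triangle. -/
theorem exists_tri_of_moves : ∀ τ : Tri, ∀ c ∈ (triCell τ).powerset, ∀ n : Tile, ∀ l ∈ c,
    ∀ l' ∈ tileCell n, (∀ m ∈ c, ∃ m' ∈ tileCell n, Moves (shift l' - shift l) m m') →
      ∃ τ', triTile τ' = n ∧ ∀ m ∈ c, ∀ m', Moves (shift l' - shift l) m m' → m' ∈ triCell τ' := by
  decide +kernel

/-- The form of the target polygon, pulled back by d, takes its minimum 1 at the source point, hence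
at each source vertex of positive weight. Such vertices move to extreme points of the target
polygon. The transported weights fit on one of its triangles, and uniqueness of weights identifies
them with w'. -/
theorem Roots.transfers_of_act_eq {a : ℕ} {t : Fin 3 → ℝ} (ht : Roots a t) {w w' : Label → ℝ}
    (hw : w ∈ weights) (hw' : w' ∈ weights) {d : ℤ × ℤ}
    (h : act (per a d) (∑ l, w l • pt a l) = ∑ l, w' l • pt a l) : Transfers d w w' := by
  classical
  obtain ⟨⟨τ, hτ⟩, hs⟩ := hw
  obtain ⟨⟨τ', hτ'⟩, hs'⟩ := hw'
  have hform : faceForm a d (triTile τ') (∑ l, w l • pt a l) = 1 := by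
    rw [faceForm_apply, h, tileForm_sum hτ', hs']
  have hmove : ∀ l, w l ≠ 0 → ∃ l' ∈ tileCell (triTile τ'), Moves d l l' := by
    intro l hl
    have h1 := Roots.eq_max_of_weight (f := -faceForm a d (triTile τ')) (m := -1) hτ.nonneg hs
      (v := pt a) (fun l => by
        have := (ht.pt_mem_polyhedron l).2 d (triTile τ')
        simpa using this) (congrArg Neg.neg hform) hl
    have h2 : faceForm a 0 (triTile τ') (act (per a d) (pt a l)) = 1 := by
      rw [faceForm_act, zero_add]
      simpa using h1
    have hmem := ht.act_mem_polyhedron d (ht.pt_mem_polyhedron l)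
    obtain ⟨τ₁, hτ₁, w₁, hw₁, hs₁, e⟩ := Roots.exists_weight_of_eq_one hmem h2
    rw [act_per_zero] at e
    have hcell : act (per a d) (pt a l) ∈ cell a (tileCell (triTile τ') : Set Label) :=
      (mem_cell_iff a _ _).2 ⟨w₁, hw₁.nonneg, fun m hm => hw₁.supp m fun hm' =>
        hm (hτ₁ ▸ triCell_subset τ₁ hm'), hs₁, e⟩
    have hext : act (per a d) (pt a l) ∈ (polyhedron a t).extremePoints ℝ := by
      have := Roots.act_image_mem_sailFaces (ht.act_per_image_hull d) (ht.pt_mem_sailFaces l)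
      rw [Set.image_singleton] at this
      have h3 := this.2.2
      rw [ht.hull_eq] at h3
      exact exposedPoints_subset_extremePoints (mem_exposedPoints_iff_exposed_singleton.2 h3)
    have := inter_extremePoints_subset_extremePoints_of_subset
      (ht.cell_subset_polyhedron (tileCell (triTile τ') : Set Label)) ⟨hcell, hext⟩
    rw [ht.extremePoints_cell] at this
    obtain ⟨l', hl', e'⟩ := this
    exact ⟨l', hl', (ht.act_pt_eq_iff d l l').1 e'.symm⟩
  set v : Label → ℝ := fun m => ∑ l, if Moves d l m then w l else 0 with hv
  have hvm : ∀ {l m}, Moves d l m → v m = w l := by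
    intro l m hm
    rw [hv]
    simp only
    rw [Finset.sum_eq_single l, if_pos hm]
    · intro l₁ _ hne
      exact if_neg fun h => hne (h.left_unique hm)
    · exact fun h => absurd (Finset.mem_univ l) h
  have hcov : ∀ m, v m ≠ 0 → ∃ l, Moves d l m ∧ w l ≠ 0 := by
    intro m hm
    obtain ⟨l, -, hl⟩ := Finset.exists_ne_zero_of_sum_ne_zero hm
    by_cases h : Moves d l m
    · exact ⟨l, h, by simpa [h] using hl⟩
    · simp [h] at hl
  have hT : Transfers d w v := fun l hl => by
    obtain ⟨l', -, h⟩ := hmove l hl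
    exact ⟨l', h, hvm h⟩
  have hsum : ∑ l, v l • pt a l = ∑ l, w' l • pt a l := by
    rw [← h, act_sum]
    exact (hT.sum_smul_of_cover hcov fun l l' hm => (ht.act_pt_eq_iff d l l').2 hm).symm
  obtain ⟨τ₂, hτ₂, hv₂⟩ : ∃ τ₂, triTile τ₂ = triTile τ' ∧ IsWeight τ₂ v := by
    obtain ⟨l, -, hl⟩ := Finset.exists_ne_zero_of_sum_ne_zero (hs.trans_ne one_ne_zero)
    obtain ⟨l', hl', hm⟩ := hmove l hl
    have hd : d = shift l' - shift l := eq_sub_of_add_eq hm.2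
    obtain ⟨τ₂, hτ₂, h2⟩ := exists_tri_of_moves τ (Finset.univ.filter fun l => w l ≠ 0)
      (Finset.mem_powerset.2 fun m hm => by
        by_contra hc
        exact (Finset.mem_filter.1 hm).2 (hτ.supp m hc)) (triTile τ') l
      (Finset.mem_filter.2 ⟨Finset.mem_univ l, hl⟩) l' hl'
      (fun m hm => hd ▸ hmove m (Finset.mem_filter.1 hm).2)
    refine ⟨τ₂, hτ₂, fun m => ?_, fun m hm => ?_⟩
    · exact Finset.sum_nonneg fun l _ => by
        split_ifs
        · exact hτ.nonneg l
        · exact le_rfl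
    · by_contra h0
      obtain ⟨l₁, hm₁, hw₁⟩ := hcov m h0
      exact hm (h2 l₁ (Finset.mem_filter.2 ⟨Finset.mem_univ l₁, hw₁⟩) m (hd ▸ hm₁))
  rwa [hv₂.eq_of_sum_eq hτ' hτ₂ hsum] at hT

end SailTorus

namespace SailTorus

/-! ### The model decomposition of the plane -/

theorem model_fst (w : Label → ℝ) : (∑ l, w l • modelPt l).1 =
    w .C + w .D + (w .E + w .G) / 4 + 3 / 4 * w .F := by
  rw [Prod.fst_sum, sum_label]
  simp [modelPt]
  ring

theorem model_snd (w : Label → ℝ) : (∑ l, w l • modelPt l).2 =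
    w .B + w .C + 5 / 4 * w .E + 3 / 4 * w .F + w .G / 4 := by
  rw [Prod.snd_sum, sum_label]
  simp [modelPt]
  ring

theorem modelPt_eq (l : Label) :
    modelPt l = modelPt (rep l) + (((shift l).1 : ℝ), ((shift l).2 : ℝ)) := by
  cases l <;> simp [modelPt, rep, shift] <;> norm_num

theorem Moves.modelPt_add {d : ℤ × ℤ} {l l' : Label} (h : Moves d l l') :
    modelPt l + ((d.1 : ℝ), (d.2 : ℝ)) = modelPt l' := by
  rw [modelPt_eq l, modelPt_eq l', h.1, ← h.2, add_assoc]
  congr 1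
  simp [add_comm]

theorem nonneg_of_mem_weights {w : Label → ℝ} (hw : w ∈ weights) (l : Label) : 0 ≤ w l := by
  obtain ⟨⟨τ, hτ⟩, -⟩ := hw
  exact hτ.nonneg l

theorem sum_of_mem_weights {w : Label → ℝ} (hw : w ∈ weights) :
    w .A + w .B + w .C + w .D + w .E + w .F + w .G = 1 := by
  rw [← sum_label, hw.2]

/-- The triangles lie to the left or to the right of the line through `E` and `G`. -/
theorem left_or_right {w : Label → ℝ} (hw : w ∈ weights) :
    (w .C = 0 ∧ w .D = 0 ∧ w .F = 0 ∧ (w .A = 0 ∨ w .E = 0)) ∨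
      (w .A = 0 ∧ w .B = 0 ∧ (w .D = 0 ∨ w .E = 0) ∧ (w .C = 0 ∨ w .G = 0)) := by
  obtain ⟨⟨τ, hτ⟩, -⟩ := hw
  have f : ∀ {l : Label}, l ∉ triCell τ → w l = 0 := fun {l} h => hτ.supp l h
  cases τ
  · exact .inl ⟨f (by decide), f (by decide), f (by decide), .inr (f (by decide))⟩
  · exact .inl ⟨f (by decide), f (by decide), f (by decide), .inl (f (by decide))⟩
  · exact .inr ⟨f (by decide), f (by decide), .inl (f (by decide)), .inl (f (by decide))⟩
  · exact .inr ⟨f (by decide), f (by decide), .inr (f (by decide)), .inl (f (by decide))⟩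
  · exact .inr ⟨f (by decide), f (by decide), .inl (f (by decide)), .inr (f (by decide))⟩
  · exact .inr ⟨f (by decide), f (by decide), .inr (f (by decide)), .inr (f (by decide))⟩

/-- A point of the plane model determines its weights. -/
theorem eq_of_model_eq {w w' : Label → ℝ} (hw : w ∈ weights) (hw' : w' ∈ weights)
    (h1 : (∑ l, w l • modelPt l).1 = (∑ l, w' l • modelPt l).1)
    (h2 : (∑ l, w l • modelPt l).2 = (∑ l, w' l • modelPt l).2) : w = w' := by
  rw [model_fst, model_fst] at h1
  rw [model_snd, model_snd] at h2
  have s := sum_of_mem_weights hw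
  have s' := sum_of_mem_weights hw'
  have n := nonneg_of_mem_weights hw
  have n' := nonneg_of_mem_weights hw'
  have nA := n .A
  have nB := n .B
  have nC := n .C
  have nD := n .D
  have nE := n .E
  have nF := n .F
  have nG := n .G
  have nA' := n' .A
  have nB' := n' .B
  have nC' := n' .C
  have nD' := n' .D
  have nE' := n' .E
  have nF' := n' .F
  have nG' := n' .G
  -- On each side of the line through E and G one diagonal ambiguity at a time is resolved by
  -- complementary weights; in the mixed cases both points lie on that line.
  rcases left_or_right hw with ⟨c1, c2, c3, c4⟩ | ⟨c1, c2, c3, c4⟩ <;>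
    rcases left_or_right hw' with ⟨c1', c2', c3', c4'⟩ | ⟨c1', c2', c3', c4'⟩
  · obtain ⟨eA, eE⟩ := eq_of_complementary nA nE nA' nE' c4 c4' (by linarith)
    funext l
    cases l <;> linarith
  · funext l
    cases l <;> linarith
  · funext l
    cases l <;> linarith
  · obtain ⟨eD, eE⟩ := eq_of_complementary nD nE nD' nE' c3 c3' (by linarith)
    obtain ⟨eC, eG⟩ := eq_of_complementary (p := w .C / 4) (q := w .G / 2) (p' := w' .C / 4)
      (q' := w' .G / 2) (by positivity) (by positivity) (by positivity) (by positivity)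
      (c4.imp (fun h => by rw [h, zero_div]) fun h => by rw [h, zero_div])
      (c4'.imp (fun h => by rw [h, zero_div]) fun h => by rw [h, zero_div]) (by linarith)
    funext l
    cases l <;> linarith

/-- The hexagon has width exactly 1, so w lives on AB and w' on DC. A vertical offset j = ±1 can
only join opposite ends of these sides. -/
theorem transfers_right {w w' : Label → ℝ} (hw : w ∈ weights) (hw' : w' ∈ weights) {j : ℤ}
    (h1 : (∑ l, w l • modelPt l).1 + 1 = (∑ l, w' l • modelPt l).1)
    (h2 : (∑ l, w l • modelPt l).2 + j = (∑ l, w' l • modelPt l).2) : Transfers (1, j) w w' := by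
  rw [model_fst, model_fst] at h1
  rw [model_snd, model_snd] at h2
  have s := sum_of_mem_weights hw
  have s' := sum_of_mem_weights hw'
  have n := nonneg_of_mem_weights hw
  have n' := nonneg_of_mem_weights hw'
  have nA := n .A
  have nB := n .B
  have nC := n .C
  have nD := n .D
  have nE := n .E
  have nF := n .F
  have nG := n .G
  have nA' := n' .A
  have nB' := n' .B
  have nC' := n' .C
  have nD' := n' .D
  have nE' := n' .E
  have nF' := n' .F
  have nG' := n' .G
  have zC : w .C = 0 := by linarith
  have zD : w .D = 0 := by linarith
  have zE : w .E = 0 := by linarith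
  have zF : w .F = 0 := by linarith
  have zG : w .G = 0 := by linarith
  have j1 : (-2 : ℝ) < j := by linarith
  have j2 : (j : ℝ) < 2 := by linarith
  have j1' : -2 < j := by exact_mod_cast j1
  have j2' : j < 2 := by exact_mod_cast j2
  obtain rfl | rfl | rfl : j = -1 ∨ j = 0 ∨ j = 1 := by omega
  · push_cast at h2
    intro l hl
    cases l
    · exact absurd (by linarith) hl
    · exact ⟨.D, by decide, by linarith⟩
    all_goals exact absurd (by assumption) hl
  · push_cast at h2
    intro l hl
    cases l
    · exact ⟨.D, by decide, by linarith⟩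
    · exact ⟨.C, by decide, by linarith⟩
    all_goals exact absurd (by assumption) hl
  · push_cast at h2
    intro l hl
    cases l
    · exact ⟨.C, by decide, by linarith⟩
    · exact absurd (by linarith) hl
    all_goals exact absurd (by assumption) hl

/-- Every vertical section of the hexagon has length 1, so w lies on the lower boundary AGD and w'
on the upper boundary BEC. -/
theorem transfers_up {w w' : Label → ℝ} (hw : w ∈ weights) (hw' : w' ∈ weights)
    (h1 : (∑ l, w l • modelPt l).1 = (∑ l, w' l • modelPt l).1)
    (h2 : (∑ l, w l • modelPt l).2 + 1 = (∑ l, w' l • modelPt l).2) : Transfers (0, 1) w w' := by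
  rw [model_fst, model_fst] at h1
  rw [model_snd, model_snd] at h2
  have s := sum_of_mem_weights hw
  have s' := sum_of_mem_weights hw'
  have n := nonneg_of_mem_weights hw
  have n' := nonneg_of_mem_weights hw'
  have nA := n .A
  have nB := n .B
  have nC := n .C
  have nD := n .D
  have nE := n .E
  have nF := n .F
  have nG := n .G
  have nA' := n' .A
  have nB' := n' .B
  have nC' := n' .C
  have nD' := n' .D
  have nE' := n' .E
  have nF' := n' .F
  have nG' := n' .G
  have key : w .B = 0 ∧ w .C = 0 ∧ w .E = 0 ∧ w .F = 0 ∧ w .A = w' .B ∧ w .D = w' .C ∧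
      w .G = w' .E := by
    rcases left_or_right hw with ⟨c1, c2, c3, -⟩ | ⟨c1, c2, -, -⟩ <;>
      rcases left_or_right hw' with ⟨c1', c2', c3', -⟩ | ⟨c1', c2', -, -⟩ <;>
      refine ⟨?_, ?_, ?_, ?_, ?_, ?_, ?_⟩ <;> linarith
  obtain ⟨zB, zC, zE, zF, eA, eD, eG⟩ := key
  intro l hl
  cases l
  · exact ⟨.B, by decide, eA.symm⟩
  · exact absurd zB hl
  · exact absurd zC hl
  · exact ⟨.C, by decide, eD.symm⟩
  · exact absurd zE hl
  · exact absurd zF hl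
  · exact ⟨.E, by decide, eG.symm⟩

/-- The size of the hexagon leaves only translations with entries -1, 0, 1. Leftward and downward
ones are obtained by exchanging the two points, hence the disjunction. -/
theorem exists_transfers_of_model {w w' : Label → ℝ} (hw : w ∈ weights) (hw' : w' ∈ weights)
    {d : ℤ × ℤ} (h1 : (∑ l, w l • modelPt l).1 + d.1 = (∑ l, w' l • modelPt l).1)
    (h2 : (∑ l, w l • modelPt l).2 + d.2 = (∑ l, w' l • modelPt l).2) :
    Transfers d w w' ∨ Transfers (-d) w' w := by
  obtain ⟨i, j⟩ := d
  simp only at h1 h2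
  have s := sum_of_mem_weights hw
  have s' := sum_of_mem_weights hw'
  have n := nonneg_of_mem_weights hw
  have n' := nonneg_of_mem_weights hw'
  have nA := n .A
  have nB := n .B
  have nC := n .C
  have nD := n .D
  have nE := n .E
  have nF := n .F
  have nG := n .G
  have nA' := n' .A
  have nB' := n' .B
  have nC' := n' .C
  have nD' := n' .D
  have nE' := n' .E
  have nF' := n' .F
  have nG' := n' .G
  have k1 := h1
  have k2 := h2
  rw [model_fst, model_fst] at k1
  rw [model_snd, model_snd] at k2
  have i1 : (-2 : ℝ) < i := by linarith
  have i2 : (i : ℝ) < 2 := by linarith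
  have i1' : -2 < i := by exact_mod_cast i1
  have i2' : i < 2 := by exact_mod_cast i2
  obtain rfl | rfl | rfl : i = -1 ∨ i = 0 ∨ i = 1 := by omega
  · right
    have := transfers_right hw' hw (j := -j) (by push_cast at h1; linarith)
      (by push_cast; linarith)
    simpa using this
  · push_cast at h1 k1
    have j1 : (-2 : ℝ) < j := by
      rcases left_or_right hw with ⟨c1, c2, c3, -⟩ | ⟨c1, c2, -, -⟩ <;>
      rcases left_or_right hw' with ⟨c1', c2', c3', -⟩ | ⟨c1', c2', -, -⟩ <;> linarith
    have j2 : (j : ℝ) < 2 := by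
      rcases left_or_right hw with ⟨c1, c2, c3, -⟩ | ⟨c1, c2, -, -⟩ <;>
      rcases left_or_right hw' with ⟨c1', c2', c3', -⟩ | ⟨c1', c2', -, -⟩ <;> linarith
    have j1' : -2 < j := by exact_mod_cast j1
    have j2' : j < 2 := by exact_mod_cast j2
    obtain rfl | rfl | rfl : j = -1 ∨ j = 0 ∨ j = 1 := by omega
    · right
      have := transfers_up hw' hw (by linarith) (by push_cast at h2; linarith)
      simpa using this
    · left
      rw [eq_of_model_eq hw hw' (by linarith) (by push_cast at h2; linarith)]
      exact fun l _ => ⟨l, ⟨rfl, by simp⟩, rfl⟩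
    · left
      exact transfers_up hw hw' (by linarith) (by push_cast at h2; linarith)
  · left
    exact transfers_right hw hw' (by push_cast at h1; linarith) h2

/-- The hexagon is covered by the triangles, and the pentagon by those of the pentagon. -/
theorem exists_weight_model {x y : ℝ} (hx0 : 0 ≤ x) (hx1 : x ≤ 1) (hu : y ≤ x + 1) (hu' : 3 * y ≤ 4 - x) (hl' : x ≤ 1 / 4 → x ≤ y)
    (hr' : 1 / 4 ≤ x → 1 - x ≤ 3 * y) :
    ∃ τ w, IsWeight τ w ∧ ∑ l, w l = 1 ∧ ∑ l, w l • modelPt l = (x, y) ∧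
      (1 ≤ 3 * x + y → x + y ≤ 3 / 2 → 3 * x + y ≤ 3 → triTile τ = .pent) := by
  have mk : ∀ (τ : Tri) (w : Label → ℝ), (∀ l, 0 ≤ w l) → (∀ l, l ∉ triCell τ → w l = 0) →
      w .A + w .B + w .C + w .D + w .E + w .F + w .G = 1 →
      w .C + w .D + (w .E + w .G) / 4 + 3 / 4 * w .F = x →
      w .B + w .C + 5 / 4 * w .E + 3 / 4 * w .F + w .G / 4 = y →
      (1 ≤ 3 * x + y → x + y ≤ 3 / 2 → 3 * x + y ≤ 3 → triTile τ = .pent) →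
      ∃ τ w, IsWeight τ w ∧ ∑ l, w l = 1 ∧ ∑ l, w l • modelPt l = (x, y) ∧
        (1 ≤ 3 * x + y → x + y ≤ 3 / 2 → 3 * x + y ≤ 3 → triTile τ = .pent) :=
    fun τ w h1 h2 h3 h4 h5 h6 => ⟨τ, w, ⟨h1, h2⟩, by rw [sum_label, h3],
      Prod.ext (by rw [model_fst, h4]) (by rw [model_snd, h5]), h6⟩
  rcases le_total x (1 / 4) with h | h
  · have h' := hl' h
    rcases lt_or_ge (3 * x + y) 1 with hd | hd
    · refine mk .abg (fun | .A => 1 - 3 * x - y | .B => y - x | .G => 4 * x | _ => 0) ?_ ?_ ?_ ?_ ?_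
        fun h1 => absurd h1 (not_le.2 hd)
      · intro l; cases l <;> simp only [le_refl] <;> linarith
      · intro l hl; cases l <;> simp [triCell] at hl ⊢
      all_goals simp only; ring
    · refine mk .gbe (fun | .B => 1 - 4 * x | .E => 3 * x + y - 1 | .G => x + 1 - y | _ => 0)
        ?_ ?_ ?_ ?_ ?_ fun _ _ _ => rfl
      · intro l; cases l <;> simp only [le_refl] <;> linarith
      · intro l hl; cases l <;> simp [triCell] at hl ⊢
      all_goals simp only; ring
  · have h' := hr' h
    rcases le_total x y with hd | hd
    · rcases le_or_gt (x + y) (3 / 2) with hd' | hd'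
      · refine mk .gef (fun | .E => y - x | .F => 2 * x - 1 / 2 | .G => 3 / 2 - x - y | _ => 0)
          ?_ ?_ ?_ ?_ ?_ fun _ _ _ => rfl
        · intro l; cases l <;> simp only [le_refl] <;> linarith
        · intro l hl; cases l <;> simp [triCell] at hl ⊢
        all_goals simp only; ring
      · refine mk .efc
          (fun | .C => 2 * x + 2 * y - 3 | .E => y - x | .F => 4 - x - 3 * y | _ => 0) ?_ ?_ ?_ ?_ ?_
          fun _ h1 => absurd h1 (not_le.2 hd')
        · intro l; cases l <;> simp only [le_refl] <;> linarith
        · intro l hl; cases l <;> simp [triCell] at hl ⊢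
        all_goals simp only; ring
    · rcases le_or_gt (3 * x + y) 3 with hd' | hd'
      · refine mk .gfd (fun
          | .D => x - y
          | .F => (3 * y + x - 1) / 2
          | .G => (3 - 3 * x - y) / 2
          | _ => 0) ?_ ?_ ?_ ?_ ?_ fun _ _ _ => rfl
        · intro l; cases l <;> simp only [le_refl] <;> linarith
        · intro l hl; cases l <;> simp [triCell] at hl ⊢
        all_goals simp only; ring
      · refine mk .cdf (fun | .C => y + 3 * x - 3 | .D => x - y | .F => 4 - 4 * x | _ => 0)
          ?_ ?_ ?_ ?_ ?_ fun _ _ h1 => absurd h1 (not_le.2 hd')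
        · intro l; cases l <;> simp only [le_refl] <;> linarith
        · intro l hl; cases l <;> simp [triCell] at hl ⊢
        all_goals simp only; ring

/-- The projection of the plane to the torus. -/
noncomputable def toTorus (x : ℝ × ℝ) : Torus := (x.1, x.2)

theorem toTorus_eq_iff (x y : ℝ × ℝ) : toTorus x = toTorus y ↔
    ∃ d : ℤ × ℤ, x.1 + d.1 = y.1 ∧ x.2 + d.2 = y.2 := by
  have key : ∀ u v : ℝ, (u : AddCircle (1 : ℝ)) = v ↔ ∃ n : ℤ, u + n = v := by
    intro u v
    rw [eq_comm, ← sub_eq_zero, ← AddCircle.coe_sub, AddCircle.coe_eq_zero_iff]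
    refine exists_congr fun n => ?_
    rw [zsmul_one, eq_sub_iff_add_eq, add_comm]
  rw [toTorus, toTorus, Prod.mk.injEq, key, key]
  constructor
  · rintro ⟨⟨i, hi⟩, j, hj⟩
    exact ⟨(i, j), hi, hj⟩
  · rintro ⟨d, h1, h2⟩
    exact ⟨⟨_, h1⟩, _, h2⟩

/-- The map from weights to the torus. -/
noncomputable def weightsToTorus (w : weights) : Torus := toTorus (∑ l, w.1 l • modelPt l)

theorem continuous_weightsToTorus : Continuous weightsToTorus := by
  have h1 : Continuous fun w : weights => ∑ l, w.1 l • modelPt l := by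
    refine continuous_finsetSum _ fun l _ => ?_
    have : Continuous fun w : weights => w.1 l := (continuous_apply l).comp continuous_subtype_val
    exact this.smul continuous_const
  exact ((AddCircle.continuous_mk' 1).comp h1.fst).prodMk ((AddCircle.continuous_mk' 1).comp h1.snd)

/-- The lower boundary of the hexagon is the graph of m = min(x, (1 - x)/3) and the upper one that
of m + 1. Reducing x modulo 1, and then y - m modulo 1, brings any point into the hexagon. -/
theorem surjective_weightsToTorus : Function.Surjective weightsToTorus := by
  rintro ⟨θ₁, θ₂⟩
  obtain ⟨x, rfl⟩ := QuotientAddGroup.mk_surjective θ₁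
  obtain ⟨y, rfl⟩ := QuotientAddGroup.mk_surjective θ₂
  set x' := Int.fract x with hx'
  set m := min x' ((1 - x') / 3) with hm
  set y' := m + Int.fract (y - m) with hy'
  have hx0 := Int.fract_nonneg x
  have hx1 := (Int.fract_lt_one x).le
  have hy0 := Int.fract_nonneg (y - m)
  have hy1 := (Int.fract_lt_one (y - m)).le
  have m1 : m ≤ x' := min_le_left _ _
  have m2 : m ≤ (1 - x') / 3 := min_le_right _ _
  have k1 : x' ≤ 1 / 4 → x' ≤ y' := fun h => by
    have : m = x' := min_eq_left (by linarith)
    linarith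
  have k2 : 1 / 4 ≤ x' → 1 - x' ≤ 3 * y' := fun h => by
    have : m = (1 - x') / 3 := min_eq_right (by linarith)
    linarith
  obtain ⟨τ, w, hw, hs, e, -⟩ := exists_weight_model (x := x') (y := y') hx0 hx1 (by linarith) (by linarith) k1 k2
  refine ⟨⟨w, ⟨τ, hw⟩, hs⟩, ?_⟩
  rw [weightsToTorus]
  simp only
  rw [e]
  refine (toTorus_eq_iff (x', y') (x, y)).2 ⟨(⌊x⌋, ⌊y - m⌋), ?_, ?_⟩
  · exact Int.fract_add_floor x
  · have := Int.fract_add_floor (y - m)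
    simp only [hy']
    linarith

theorem isCompact_weights : IsCompact weights := by
  have e : weights = ⋃ τ : Tri, {w | IsWeight τ w} ∩ {w | ∑ l, w l = 1} := by
    ext w
    simp [weights]
  rw [e]
  refine isCompact_iUnion fun τ => (isCompact_stdSimplex ℝ Label).of_isClosed_subset ?_
    fun w hw => ⟨hw.1.nonneg, hw.2⟩
  have e' : {w | IsWeight τ w} = (⋂ l, {w : Label → ℝ | 0 ≤ w l}) ∩
      ⋂ l, ⋂ (_ : l ∉ triCell τ), {w : Label → ℝ | w l = 0} := by
    ext w
    simp only [Set.mem_setOf_eq, Set.mem_inter_iff, Set.mem_iInter]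
    exact ⟨fun h => ⟨h.nonneg, h.supp⟩, fun h => ⟨h.1, h.2⟩⟩
  rw [e']
  refine ((isClosed_iInter fun l => ?_).inter (isClosed_iInter fun l => isClosed_iInter fun _ => ?_)).inter ?_
  · exact isClosed_le continuous_const (continuous_apply l)
  · exact isClosed_eq (continuous_apply l) continuous_const
  · exact isClosed_eq (continuous_finsetSum _ fun l _ => continuous_apply l) continuous_const

/-- Only the pentagon needs its triangulation to express points by `weights`; all other cells fit in
a single triangle. -/
theorem cellList_eq_or_subset :
    ∀ k, cellList k = tileCell .pent ∨ ∃ τ, cellList k ⊆ triCell τ := by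
  decide

/-- Points of a plane cell come from weights on its vertices. -/
theorem exists_weight_of_mem_modelCell {c : Set Label} (hc : c ∈ cells) {z : ℝ × ℝ}
    (hz : z ∈ convexHull ℝ (modelPt '' c)) :
    ∃ w ∈ weights, (∀ l, l ∉ c → w l = 0) ∧ z = ∑ l, w l • modelPt l := by
  obtain ⟨w, h1, h2, h3, rfl⟩ := (mem_convexHull_image_iff _ _ _).1 hz
  obtain ⟨k, rfl⟩ := (mem_cells_iff c).1 hc
  rcases cellList_eq_or_subset k with h | ⟨τ, hτ⟩
  · rw [h] at h2
    have zA : w .A = 0 := h2 .A (by decide)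
    have zC : w .C = 0 := h2 .C (by decide)
    have s := h3
    rw [sum_label] at s
    have e1 := model_fst w
    have e2 := model_snd w
    have nB := h1 .B
    have nD := h1 .D
    have nE := h1 .E
    have nF := h1 .F
    have nG := h1 .G
    obtain ⟨τ, w', hw', hs, e, hp⟩ := exists_weight_model (x := (∑ l, w l • modelPt l).1)
      (y := (∑ l, w l • modelPt l).2) (by linarith) (by linarith)
      (by linarith) (by linarith) (fun h => by linarith) (fun h => by linarith)
    have hp' := hp (by linarith) (by linarith) (by linarith)
    refine ⟨w', ⟨⟨τ, hw'⟩, hs⟩, fun l hl => hw'.supp l fun hl' => hl ?_, e.symm⟩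
    rw [h]
    exact hp' ▸ triCell_subset τ hl'
  · exact ⟨w, ⟨⟨τ, h1, fun l hl => h2 l fun hl' => hl (hτ hl')⟩, h3⟩, h2, rfl⟩

/-- Points of a cell come from weights on its vertices. -/
theorem exists_weight_of_mem_cell {a : ℕ} {c : Set Label} (hc : c ∈ cells) {x : Space}
    (hx : x ∈ cell a c) :
    ∃ w ∈ weights, (∀ l, l ∉ c → w l = 0) ∧ x = ∑ l, w l • pt a l := by
  obtain ⟨k, rfl⟩ := (mem_cells_iff c).1 hc
  rcases cellList_eq_or_subset k with h | ⟨τ, hτ⟩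
  · rw [h] at hx ⊢
    have hp : (tileCell .pent : Set Label) = pentagon := by
      ext l; simp [tileCell, pentagon]
    have hk := mem_cell_pentagon_iff.1 (hp ▸ hx)
    obtain ⟨τ, hτ, w, hw, e⟩ := exists_weight_pentagon (a := a) (y := x) (hk.2 0) (hk.2 1) (hk.2 2)
      (hk.2 3) (by simpa [sideForm, lin_apply] using hk.2 4)
    refine ⟨w, ⟨⟨τ, hw⟩, ?_⟩, fun l hl => hw.supp l fun hl' => hl ?_, e⟩
    · rw [← tileForm_sum (a := a) hw, hτ, ← e, hk.1]
    · exact hτ ▸ triCell_subset τ hl'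
  · obtain ⟨w, h1, h2, h3, rfl⟩ := (mem_cell_iff a _ _).1 hx
    exact ⟨w, ⟨⟨τ, h1, fun l hl => h2 l fun hl' => hl (hτ hl')⟩, h3⟩, h2, rfl⟩

end SailTorus

namespace SailTorus

/-! ### The homeomorphism -/

/-- Two Hausdorff quotients of a compact space with the same fibres are homeomorphic. -/
theorem exists_homeomorph_of_fibres {K X Y : Type*} [TopologicalSpace K] [TopologicalSpace X]
    [TopologicalSpace Y] [CompactSpace K] [T2Space X] [T2Space Y] {p : K → X} {q : K → Y}
    (hp : Continuous p) (hq : Continuous q) (hp' : Function.Surjective p)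
    (hq' : Function.Surjective q) (h : ∀ u v, p u = p v ↔ q u = q v) :
    ∃ f : X ≃ₜ Y, ∀ u, f (p u) = q u := by
  have : CompactSpace X := hp'.compactSpace hp
  have hquot : Topology.IsQuotientMap p := Topology.IsQuotientMap.of_surjective_continuous hp' hp
  have hf : ∀ u, q (Function.surjInv hp' (p u)) = q u := fun u =>
    (h _ _).1 (Function.surjInv_eq hp' (p u))
  let e : X ≃ Y := Equiv.ofBijective (fun x => q (Function.surjInv hp' x)) <| by
    constructor
    · intro x y hxy
      have := (h _ _).2 hxy
      rwa [Function.surjInv_eq hp', Function.surjInv_eq hp'] at this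
    · intro y
      obtain ⟨u, rfl⟩ := hq' y
      exact ⟨p u, hf u⟩
  have hc : Continuous e := by
    rw [hquot.continuous_iff]
    exact hq.congr fun u => (hf u).symm
  exact ⟨hc.homeoOfEquivCompactToT2, hf⟩

namespace Roots

variable {a : ℕ} {t : Fin 3 → ℝ} (ht : Roots a t)
include ht

theorem sum_mem_sail {w : Label → ℝ} (hw : w ∈ weights) :
    ∑ l, w l • pt a l ∈ sail (opM a) (pt a .B) := by
  obtain ⟨⟨τ, hτ⟩, hs⟩ := hw
  rw [ht.mem_sail_iff]
  refine ⟨ht.cell_subset_polyhedron (triCell τ : Set Label)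
    ((mem_cell_iff a _ _).2 ⟨w, hτ.nonneg, hτ.supp, hs, rfl⟩), 0, triTile τ, ?_⟩
  rw [faceForm_zero, tileForm_sum hτ, hs]

theorem mk_eq_mk_iff (x y : sail (opM a) (pt a .B)) :
    (Quotient.mk (orbitSetoid (opM a) (pt a .B)) x) = Quotient.mk (orbitSetoid (opM a) (pt a .B)) y ↔
      ∃ d, act (per a d) x = y := by
  rw [Quotient.eq]
  constructor
  · rintro ⟨g, hg, h⟩
    obtain ⟨d, rfl⟩ := (ht.mem_periodGroup_iff g).1 hg
    exact ⟨d, h⟩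
  · rintro ⟨d, h⟩
    exact ⟨_, ht.per_mem_periodGroup d, h⟩

theorem isOpenQuotientMap_mk :
    IsOpenQuotientMap (Quotient.mk (orbitSetoid (opM a) (pt a .B))) := by
  refine ⟨Quotient.mk_surjective, continuous_quotient_mk', fun U hU => ?_⟩
  have hc : ∀ d, Continuous fun x : sail (opM a) (pt a .B) =>
      (⟨act (per a d) x, ht.act_mem_sail d x.2⟩ : sail (opM a) (pt a .B)) := fun d =>
    ((continuous_act _).comp continuous_subtype_val).subtype_mk _
  have e : Quotient.mk (orbitSetoid (opM a) (pt a .B)) ⁻¹'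
      (Quotient.mk (orbitSetoid (opM a) (pt a .B)) '' U) =
      ⋃ d, (fun x : sail (opM a) (pt a .B) =>
        (⟨act (per a d) x, ht.act_mem_sail d x.2⟩ : sail (opM a) (pt a .B))) ⁻¹' U := by
    ext x
    simp only [Set.mem_preimage, Set.mem_image, Set.mem_iUnion]
    constructor
    · rintro ⟨y, hy, h⟩
      obtain ⟨d, hd⟩ := (ht.mk_eq_mk_iff x y).1 h.symm
      exact ⟨d, by convert hy⟩
    · rintro ⟨d, hd⟩
      exact ⟨_, hd, ((ht.mk_eq_mk_iff _ _).2 ⟨d, rfl⟩).symm⟩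
  exact isOpen_coinduced.2 (e ▸ isOpen_iUnion fun d => hU.preimage (hc d))

/-- Proper discontinuity: near an inequivalent pair (x, y), the eigenvalues of a period joining two
nearby points are bounded by C. Only finitely many periods remain, and each is excluded by
continuity on a smaller neighbourhood. -/
theorem t2Space_sailQuotient : T2Space (SailQuotient (opM a) (pt a .B)) := by
  rw [t2Space_iff_of_isOpenQuotientMap ht.isOpenQuotientMap_mk, ← isOpen_compl_iff,
    isOpen_iff_mem_nhds]
  rintro ⟨x, y⟩ hxy
  have hx : ∀ k, 0 < ell a (t k) x := ((ht.mem_sail_iff _).1 x.2).1.1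
  have hy : ∀ k, 0 < ell a (t k) y := ((ht.mem_sail_iff _).1 y.2).1.1
  set C := ∑ k, (ell a (t k) y + 1) / (ell a (t k) x / 2) with hC
  have hfin := ht.finite_mult_le C
  have hne : ∀ d, act (per a d) x ≠ y := fun d h => hxy ((ht.mk_eq_mk_iff x y).2 ⟨d, h⟩)
  have c1 : Continuous fun q : sail (opM a) (pt a .B) × sail (opM a) (pt a .B) => (q.1 : Space) :=
    continuous_subtype_val.comp continuous_fst
  have c2 : Continuous fun q : sail (opM a) (pt a .B) × sail (opM a) (pt a .B) => (q.2 : Space) :=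
    continuous_subtype_val.comp continuous_snd
  have h1 : ∀ k, ∀ᶠ q : sail (opM a) (pt a .B) × sail (opM a) (pt a .B) in nhds (x, y),
      ell a (t k) x / 2 < ell a (t k) q.1 := fun k =>
    ((ell a (t k)).continuous.comp c1).continuousAt.eventually_const_lt (half_lt_self (hx k))
  have h2 : ∀ k, ∀ᶠ q : sail (opM a) (pt a .B) × sail (opM a) (pt a .B) in nhds (x, y),
      ell a (t k) q.2 < ell a (t k) y + 1 := fun k =>
    ((ell a (t k)).continuous.comp c2).continuousAt.eventually_lt_const (lt_add_one _)
  have h3 : ∀ᶠ q : sail (opM a) (pt a .B) × sail (opM a) (pt a .B) in nhds (x, y),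
      ∀ d ∈ {d : ℤ × ℤ | ∀ k, ell a (t k) (act (per a d) (pt a .B)) ≤ C},
        act (per a d) q.1 ≠ q.2 := by
    rw [hfin.eventually_all]
    intro d _
    exact (((continuous_act _).comp c1).continuousAt.ne_iff_eventually_ne c2.continuousAt).1 (hne d)
  filter_upwards [Filter.eventually_all.2 h1, Filter.eventually_all.2 h2, h3] with q g1 g2 g3 hq
  obtain ⟨d, hd⟩ := (ht.mk_eq_mk_iff q.1 q.2).1 hq
  refine g3 d (fun k => ?_) hd
  have e : ell a (t k) q.2 = ell a (t k) (act (per a d) (pt a .B)) * ell a (t k) q.1 := by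
    rw [← hd, ht.ell_per, ht.ell_per, ell_base, mul_one]
  have hpos : 0 < ell a (t k) (act (per a d) (pt a .B)) := by
    rw [ht.ell_act_per_pos_iff, ell_base]
    exact one_pos
  have h4 : ell a (t k) (act (per a d) (pt a .B)) ≤ (ell a (t k) y + 1) / (ell a (t k) x / 2) := by
    rw [le_div_iff₀ (half_pos (hx k))]
    have := mul_le_mul_of_nonneg_left (g1 k).le hpos.le
    have := g2 k
    linarith
  refine h4.trans (Finset.single_le_sum (f := fun k => (ell a (t k) y + 1) / (ell a (t k) x / 2))
    (fun k _ => ?_) (Finset.mem_univ k))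
  exact div_nonneg (add_nonneg (hy k).le zero_le_one) (half_pos (hx k)).le

/-- The map from weights to the factor of the sail. -/
def weightsToSail (w : weights) : SailQuotient (opM a) (pt a .B) :=
  Quotient.mk (orbitSetoid (opM a) (pt a .B)) ⟨∑ l, w.1 l • pt a l, ht.sum_mem_sail w.2⟩

theorem continuous_weightsToSail : Continuous ht.weightsToSail := by
  refine continuous_quotient_mk'.comp (Continuous.subtype_mk ?_ _)
  refine continuous_finsetSum _ fun l _ => ?_
  have : Continuous fun w : weights => w.1 l := (continuous_apply l).comp continuous_subtype_val
  exact this.smul continuous_const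

theorem surjective_weightsToSail : Function.Surjective ht.weightsToSail := by
  intro q
  obtain ⟨x, rfl⟩ := Quotient.mk_surjective q
  obtain ⟨hx, d, n, h⟩ := (ht.mem_sail_iff _).1 x.2
  obtain ⟨τ, -, w, hw, hs, e⟩ := exists_weight_of_eq_one hx h
  exact ⟨⟨w, ⟨τ, hw⟩, hs⟩, ((ht.mk_eq_mk_iff _ _).2 ⟨d, e⟩).symm⟩

/-- Both equalities amount to one weight being transferred to the other by a period. The
combinatorics of `Moves` is common to the sail and the plane model, where the period acts as an
integer translation. -/
theorem weightsToSail_eq_iff (u v : weights) :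
    ht.weightsToSail u = ht.weightsToSail v ↔ weightsToTorus u = weightsToTorus v := by
  have sail_of : ∀ {u v : weights} {d}, Transfers d u.1 v.1 →
      ht.weightsToSail u = ht.weightsToSail v := by
    intro u v d h
    refine (ht.mk_eq_mk_iff _ _).2 ⟨d, ?_⟩
    rw [act_sum]
    exact h.sum_smul u.2 v.2 fun l l' hm => (ht.act_pt_eq_iff d l l').2 hm
  constructor
  · intro h
    obtain ⟨d, hd⟩ := (ht.mk_eq_mk_iff _ _).1 h
    have hT := ht.transfers_of_act_eq u.2 v.2 hd
    have e := hT.sum_smul u.2 v.2 (φ := fun l => modelPt l + ((d.1 : ℝ), (d.2 : ℝ)))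
      (ψ := modelPt) fun l l' hm => hm.modelPt_add
    simp only [smul_add, Finset.sum_add_distrib, ← Finset.sum_smul, u.2.2, one_smul] at e
    refine (toTorus_eq_iff _ _).2 ⟨d, ?_, ?_⟩
    · rw [← e]; rfl
    · rw [← e]; rfl
  · intro h
    obtain ⟨d, h1, h2⟩ := (toTorus_eq_iff _ _).1 h
    rcases exists_transfers_of_model u.2 v.2 h1 h2 with hT | hT
    · exact sail_of hT
    · exact (sail_of hT).symm

theorem exists_homeomorph : ∃ f : SailQuotient (opM a) (pt a .B) ≃ₜ Torus,
    (∀ c ∈ cells, f '' quotientImage (opM a) (pt a .B) (cell a c) = modelCell c) ∧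
    (fun K => f '' K) '' torusTriangulation (opM a) (pt a .B) = modelCell '' cells := by
  have := isCompact_iff_compactSpace.1 isCompact_weights
  have := ht.t2Space_sailQuotient
  obtain ⟨f, hf⟩ := exists_homeomorph_of_fibres ht.continuous_weightsToSail
    continuous_weightsToTorus ht.surjective_weightsToSail surjective_weightsToTorus
    ht.weightsToSail_eq_iff
  have hcell : ∀ c ∈ cells, f '' quotientImage (opM a) (pt a .B) (cell a c) = modelCell c := by
    intro c hc
    ext θ
    constructor
    · rintro ⟨_, ⟨x, hx, rfl⟩, rfl⟩
      obtain ⟨w, hw, hwc, e⟩ := exists_weight_of_mem_cell hc hx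
      refine ⟨∑ l, w l • modelPt l, (mem_convexHull_image_iff _ _ _).2
        ⟨w, nonneg_of_mem_weights hw, hwc, hw.2, rfl⟩, ?_⟩
      have h1 : ht.weightsToSail ⟨w, hw⟩ = Quotient.mk _ x :=
        congrArg (Quotient.mk _) (Subtype.ext e.symm)
      exact (hf ⟨w, hw⟩).symm.trans (congrArg f h1)
    · rintro ⟨z, hz, rfl⟩
      obtain ⟨w, hw, hwc, rfl⟩ := exists_weight_of_mem_modelCell hc hz
      exact ⟨_, ⟨⟨_, ht.sum_mem_sail hw⟩, (mem_cell_iff a _ _).2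
        ⟨w, nonneg_of_mem_weights hw, hwc, hw.2, rfl⟩, rfl⟩, hf ⟨w, hw⟩⟩
  refine ⟨f, hcell, ?_⟩
  have htrans : ∀ d F, quotientImage (opM a) (pt a .B) (act (per a d) '' F) =
      quotientImage (opM a) (pt a .B) F := by
    intro d F
    ext q
    constructor
    · rintro ⟨x, ⟨y, hy, e⟩, rfl⟩
      have hys : y ∈ sail (opM a) (pt a .B) := by
        have := ht.act_mem_sail (-d) x.2
        rwa [← e, act_per_neg_act] at this
      exact ⟨⟨y, hys⟩, hy, (ht.mk_eq_mk_iff _ _).2 ⟨d, e⟩⟩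
    · rintro ⟨x, hx, rfl⟩
      exact ⟨⟨_, ht.act_mem_sail d x.2⟩, ⟨_, hx, rfl⟩, ((ht.mk_eq_mk_iff _ _).2 ⟨d, rfl⟩).symm⟩
  ext S
  constructor
  · rintro ⟨_, ⟨F, hF, rfl⟩, rfl⟩
    obtain ⟨d, k, rfl⟩ := ht.exists_cell_of_face hF
    have hk := (mem_cells_iff _).2 ⟨k, rfl⟩
    refine ⟨_, hk, ?_⟩
    simp only
    rw [htrans, hcell _ hk]
  · rintro ⟨c, hc, rfl⟩
    obtain ⟨k, rfl⟩ := (mem_cells_iff c).1 hc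
    exact ⟨_, ⟨_, ht.cellList_mem_sailFaces k, rfl⟩, hcell _ hc⟩

theorem cells_spec {c : Set Label} (hc : c ∈ cells) :
    cell a c ∈ sailFaces (opM a) (pt a .B) ∧ cell a c ⊆ sail (opM a) (pt a .B) ∧
      (cell a c).extremePoints ℝ = pt a '' c := by
  refine ⟨?_, fun x hx => ?_, ht.extremePoints_cell c⟩
  · obtain ⟨k, rfl⟩ := (mem_cells_iff c).1 hc
    exact ht.cellList_mem_sailFaces k
  · obtain ⟨w, hw, -, rfl⟩ := exists_weight_of_mem_cell hc hx
    exact ht.sum_mem_sail hw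

theorem existsUnique_cell {F : Set Space} (hF : F ∈ sailFaces (opM a) (pt a .B)) :
    ∃! q : SL3 × Set Label,
      q.1 ∈ periodGroup (opM a) (pt a .B) ∧ q.2 ∈ cells ∧ act q.1 '' cell a q.2 = F := by
  obtain ⟨d, k, e⟩ := ht.exists_cell_of_face hF
  refine ⟨(per a d, (cellList k : Set Label)),
    ⟨ht.per_mem_periodGroup d, (mem_cells_iff _).2 ⟨k, rfl⟩, e⟩, ?_⟩
  rintro ⟨g, c⟩ ⟨hg, hc, e'⟩
  obtain ⟨d', rfl⟩ := (ht.mem_periodGroup_iff g).1 hg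
  obtain ⟨k', rfl⟩ := (mem_cells_iff c).1 hc
  obtain ⟨rfl, rfl⟩ := ht.cell_unique (e'.trans e.symm)
  rfl

theorem periodGroup_eq_closure :
    periodGroup (opM a) (pt a .B) = Subgroup.closure {opX a, opY a} := by
  ext g
  rw [ht.mem_periodGroup_iff, closure_eq_range_per]

theorem eq_zero_of_zpow_mul_zpow_eq_one (i j : ℤ) (h : opX a ^ i * opY a ^ j = 1) :
    i = 0 ∧ j = 0 := by
  have h1 : per a (i, j) = per a 0 := by rw [per_zero]; exact h
  exact Prod.mk.inj (ht.per_injective h1)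

end Roots

end SailTorus

theorem proposition3p4 (a : ℕ) (M : SL3) (hM : M = frobeniusOperator ((a : ℤ) - 1) (3 + 2 * (a : ℤ)))
    (e : Space) (he : e = ![0, 0, 1]) :
    -- the operator defines a continued fraction of a cubic irrationality
    Irreducible (M.1.map (fun k : ℤ => (k : ℚ))).charpoly ∧
    (realEigenvalues M).ncard = 3 ∧
    -- the period group: generators, freely generating a group isomorphic to `ℤ²`,
    -- and their action on the boundary of the fundamental region
    (∃ X Y : SL3,
      (X : Matrix (Fin 3) (Fin 3) ℤ) =
        (2 • (1 : Matrix (Fin 3) (Fin 3) ℤ) + ((M⁻¹ : SL3) : Matrix (Fin 3) (Fin 3) ℤ)) ^ (-2 : ℤ) ∧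
      Y = M ^ (-2 : ℤ) ∧
      periodGroup M e = Subgroup.closure {X, Y} ∧
      Commute X Y ∧
      (∀ i j : ℤ, X ^ i * Y ^ j = 1 → i = 0 ∧ j = 0) ∧
      act X (pt a .A) = pt a .D ∧ act X (pt a .B) = pt a .C ∧
      act Y (pt a .A) = pt a .B ∧ act Y (pt a .G) = pt a .E ∧ act Y (pt a .D) = pt a .C) ∧
    -- the seven points are vertices of the sail that contains `(0, 0, 1)`
    e ∈ sail M e ∧
    (∀ l : Label, {pt a l} ∈ sailFaces M e) ∧
    -- the cells are faces of the sail, of the expected dimensions and with the listed vertices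
    (∀ c ∈ cells, cell a c ∈ sailFaces M e ∧ cell a c ⊆ sail M e ∧
      (cell a c).extremePoints ℝ = pt a '' c) ∧
    (∀ c ∈ vertexCells, faceDim (cell a c) = 0) ∧
    (∀ c ∈ edgeCells, faceDim (cell a c) = 1) ∧
    (∀ c ∈ polygonCells, faceDim (cell a c) = 2) ∧
    -- every face is equivalent to exactly one of the cells, by exactly one period
    (∀ F ∈ sailFaces M e, ∃! q : SL3 × Set Label,
      q.1 ∈ periodGroup M e ∧ q.2 ∈ cells ∧ act q.1 '' cell a q.2 = F) ∧
    -- integer points in the interiors of the edges `BG`, `DF` and of the pentagon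
    (openSegment ℝ (pt a .B) (pt a .G) ∩ {x | IsIntegerPoint x}).encard = a ∧
    (openSegment ℝ (pt a .D) (pt a .F) ∩ {x | IsIntegerPoint x}).encard = a ∧
    intrinsicInterior ℝ (cell a pentagon) ∩ {x | IsIntegerPoint x} =
      {x | ∃ i j : ℤ, 1 ≤ i ∧ i ≤ a + 1 ∧ 1 ≤ j ∧ j ≤ 2 * i - 1 ∧
        x = ![(-j : ℝ), -i + j, (2 * a + 3) * i - (a + 2) * j + 1]} ∧
    (intrinsicInterior ℝ (cell a pentagon) ∩ {x | IsIntegerPoint x}).encard =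
      ((a + 1) ^ 2 : ℕ) ∧
    -- the homeomorphism type of the torus triangulation
    ∃ f : SailQuotient M e ≃ₜ Torus,
      (∀ c ∈ cells, f '' quotientImage M e (cell a c) = modelCell c) ∧
      (fun K => f '' K) '' torusTriangulation M e = modelCell '' cells := by
  obtain ⟨t, ht⟩ := exists_roots a
  obtain rfl : e = pt a .B := by
    rw [he]
    ext i
    fin_cases i <;> simp [pt, coords]
  obtain rfl : M = opM a := hM
  exact ⟨irreducible_charpoly_opM a, ht.ncard_realEigenvalues,
    ⟨opX a, opY a, opX_eq a, opY_eq a, ht.periodGroup_eq_closure, commute_opX_opY a,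
      ht.eq_zero_of_zpow_mul_zpow_eq_one, act_X_A a, act_X_B a, act_Y_A a, act_Y_G a, act_Y_D a⟩,
    (ht.cells_spec (c := {.B}) ((mem_cells_iff _).2 ⟨0, by simp [cellList]⟩)).2.1
      (pt_mem_cell a rfl),
    ht.pt_mem_sailFaces, fun c hc => ht.cells_spec hc, faceDim_vertexCells a, ht.faceDim_edgeCells,
    faceDim_polygonCells a, fun F hF => ht.existsUnique_cell hF, encard_openSegment_BG a,
    encard_openSegment_DF a, intrinsicInterior_pentagon_inter a,
    encard_intrinsicInterior_pentagon_inter a, ht.exists_homeomorph⟩
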